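/- **Theorem.** There is a deterministic algorithm (one fixed program) that, given a non-empty finite digraph $D$ with $n=|V(D)|\ge 1$ vertices (loops and multiple edges are allowed; $D$ is given by its adjacency matrix, whose entry at $(u,v)$ is the number of edges from $u$ to $v$) and a non-negative integer $k$, runs in time $2^{O(k\log k)}\cdot n^{O(1)}$ and either correctly states that $D$ admits a haven of order $k$, or produces an arboreal decomposition of $D$ of width at most $3k-2$. That is, the running time is at most $2^{f(k)}\cdot n^{d}$ for a function $f(k)=O(k\log k)$ and a constant $d$ that do not depend on $D$ or $k$. (The machine model is that of while-programs over linked cells, i.e. binary trees, with unit cost for copying a pointer, creating a cell, following a pointer and testing for the empty tree.) Here a *strong component* of a digraph is a maximal (non-empty) strongly connected induced subdigraph. A *haven of order $k$* in $D$ is a function $\beta$ that assigns to every $Z\subseteq V(D)$ with $|Z|\le k-1$ the vertex set of a strong component of $D\setminus Z$ such that $\beta(Z)\subseteq\beta(Z')$ whenever $Z'\subseteq Z$ and $|Z|\le k-1$. For $Z\subseteq V(D)$, a set $S\subseteq V(D)\setminus Z$ is *$Z$-guarded* if no directed walk in $D\setminus Z$ with first and last vertices in $S$ uses a vertex outside $Z\cup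 S$. An *arborescence* is an orientation $R$ of a (finite) tree with a root from which every vertex can be reached; for an edge $e$ of $R$ with head $r'$ and a vertex $r$ of $R$, write $r>e$ if there is a directed path from $r'$ to $r$ in $R$, and $e\sim r$ if $r$ is the head or the tail of $e$. An *arboreal decomposition* of $D$ is a triple $(R,(X_e)_{e\in E(R)},(W_r)_{r\in V(R)})$, where $R$ is an arborescence, the $X_e$ and $W_r$ are subsets of $V(D)$, the sets $W_r$ form a partition of $V(D)$ into non-empty sets, and for every $e\in E(R)$ the set $\bigcup\{W_r : r>e\}$ is $X_e$-guarded. Its *width* is the least integer $w$ such that $|W_r\cup\bigcup_{e\sim r}X_e|\le w+1$ for all $r\in V(R)$. -/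

import Mathlib

namespace Arboreal

/-! ### Digraphs, walks, strong components

A finite digraph with loops and multiple edges is given by its adjacency matrix `M`, where `M u v`
is the number of edges from `u` to `v`.  Walks, strong components, havens and arboreal
decompositions depend only on which pairs `(u, v)` are joined by an edge, that is, on `support M`. -/

/-- The adjacency relation of the digraph with adjacency matrix `M`. -/
def support {V : Type*} (M : V → V → ℕ) : Digraph V := ⟨fun u v => M u v ≠ 0⟩

/-- `l` is the vertex sequence of a directed walk from `u` to `v` in `D[U]` (a single vertex is a
walk). -/
def IsWalk {V : Type*} (D : Digraph V) (U : Set V) (u v : V) (l : List V) : Prop :=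
  l.IsChain D.Adj ∧ l.head? = some u ∧ l.getLast? = some v ∧ ∀ x ∈ l, x ∈ U

/-- There is a directed walk (equivalently, a directed path) from `u` to `v` in `D[U]`. -/
def Reaches {V : Type*} (D : Digraph V) (U : Set V) (u v : V) : Prop :=
  ∃ l, IsWalk D U u v l

/-- The induced subdigraph `D[C]` is strongly connected. -/
def StronglyConnectedOn {V : Type*} (D : Digraph V) (C : Set V) : Prop :=
  ∀ u ∈ C, ∀ v ∈ C, Reaches D C u v

/-- `C` is the vertex set of a strong component of `D ∖ Z`. -/
def IsStrongComponent {V : Type*} (D : Digraph V) (Z C : Set V) : Prop :=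
  Maximal (fun S : Set V => S ⊆ Zᶜ ∧ S.Nonempty ∧ StronglyConnectedOn D S) C

/-! ### Havens -/

/-- `β` is a haven of order `k` in `D`; only its values on sets of at most `k - 1` vertices
matter. -/
def IsHaven {V : Type*} (D : Digraph V) (k : ℕ) (β : Finset V → Set V) : Prop :=
  (∀ Z : Finset V, Z.card < k → IsStrongComponent D Z (β Z)) ∧
    ∀ Z' Z : Finset V, Z' ⊆ Z → Z.card < k → β Z ⊆ β Z'

/-- `D` admits a haven of order `k`. -/
def HasHaven {V : Type*} (D : Digraph V) (k : ℕ) : Prop :=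
  ∃ β : Finset V → Set V, IsHaven D k β

/-! ### Arboreal decompositions -/

/-- `S` is `Z`-guarded: `S` is disjoint from `Z` and no directed walk in `D ∖ Z` with first and
last vertices in `S` uses a vertex outside `Z ∪ S`. -/
def IsGuarded {V : Type*} (D : Digraph V) (Z S : Set V) : Prop :=
  S ⊆ Zᶜ ∧ ¬ ∃ u ∈ S, ∃ v ∈ S, ∃ l, IsWalk D Zᶜ u v l ∧ ∃ x ∈ l, x ∉ Z ∪ S

/-- `R` is an arborescence: an orientation of a tree (no edge is present in both directions, there
are no loops, and the underlying simple graph is a tree) with a root from which every vertex can be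
reached. -/
def IsArborescence {ι : Type*} (R : Digraph ι) : Prop :=
  (∀ r s, R.Adj r s → ¬ R.Adj s r) ∧ R.toSimpleGraphInclusive.IsTree ∧
    ∃ root, ∀ r, Reaches R Set.univ root r

/-- An arboreal decomposition `(R, X, W)` of `D`, with the nodes of `R` indexed by `ι`.  The guard
`X_e` of the edge `e = (r, s)` of `R` is `X r s`; the values of `X` at pairs that are not edges are
never used. -/
structure ArborealDecomposition {V : Type*} (D : Digraph V) (ι : Type*) where
  R : Digraph ι
  X : ι → ι → Finset V
  W : ι → Finset V
  isArborescence : IsArborescence R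
  nonempty : ∀ r, (W r).Nonempty
  disjoint : ∀ r s, r ≠ s → Disjoint (W r) (W s)
  cover : ∀ x, ∃ r, x ∈ W r
  guarded : ∀ r s, R.Adj r s →
    IsGuarded D (X r s) {x | ∃ q, Reaches R Set.univ s q ∧ x ∈ W q}

open Classical in
/-- The set `W_r ∪ ⋃_{e ∼ r} X_e`, where `e ∼ r` means that `r` is the tail or the head of `e`. -/
noncomputable def ArborealDecomposition.nodeSet {V ι : Type*} [Fintype V] {D : Digraph V}
    (A : ArborealDecomposition D ι) (r : ι) : Finset V :=
  {x | x ∈ A.W r ∨ ∃ p q, A.R.Adj p q ∧ (r = p ∨ r = q) ∧ x ∈ A.X p q}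

/-- The least integer `w` with `|W_r ∪ ⋃_{e ∼ r} X_e| ≤ w + 1` for every node `r`. -/
noncomputable def ArborealDecomposition.width {V ι : Type*} [Fintype V] [Fintype ι] {D : Digraph V}
    (A : ArborealDecomposition D ι) : ℤ :=
  ((Finset.univ.sup fun r => (A.nodeSet r).card : ℕ) : ℤ) - 1

/-! ### The machine model

While-programs over binary trees (the textbook language WHILE).  A variable holds a
pointer to an immutable tree; every operation below (copying a pointer, allocating one cell,
following one pointer, testing for `nil`) takes constant time on a pointer machine or on a
random-access machine, and is charged one step. -/

/-- The values a program computes with. -/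
inductive Val where
  | nil : Val
  | cons : Val → Val → Val

def Val.hd : Val → Val
  | .nil => .nil
  | .cons a _ => a

def Val.tl : Val → Val
  | .nil => .nil
  | .cons _ b => b

inductive Expr where
  | var : ℕ → Expr
  | nil : Expr
  | cons : Expr → Expr → Expr
  | hd : Expr → Expr
  | tl : Expr → Expr

/-- The contents of the program variables. -/
abbrev Store := ℕ → Val

def Expr.eval (σ : Store) : Expr → Val
  | .var x => σ x
  | .nil => .nil
  | .cons e f => .cons (e.eval σ) (f.eval σ)
  | .hd e => (e.eval σ).hd
  | .tl e => (e.eval σ).tl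

/-- The number of steps spent on evaluating an expression. -/
def Expr.cost : Expr → ℕ
  | .var _ => 1
  | .nil => 1
  | .cons e f => e.cost + f.cost + 1
  | .hd e => e.cost + 1
  | .tl e => e.cost + 1

/-- Programs.  In `ite e c d` and `loop e c` the test succeeds if the value of `e` is not `nil`. -/
inductive Prog where
  | skip : Prog
  | assign : ℕ → Expr → Prog
  | seq : Prog → Prog → Prog
  | ite : Expr → Prog → Prog → Prog
  | loop : Expr → Prog → Prog

/-- `Runs p σ t σ'`: started in the store `σ`, the program `p` halts after exactly `t` steps in the
store `σ'`. -/
inductive Runs : Prog → Store → ℕ → Store → Prop where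
  | skip (σ) : Runs .skip σ 1 σ
  | assign (x e σ) : Runs (.assign x e) σ (e.cost + 1) (Function.update σ x (e.eval σ))
  | seq {c d σ₁ σ₂ σ₃ t₁ t₂} : Runs c σ₁ t₁ σ₂ → Runs d σ₂ t₂ σ₃ →
      Runs (.seq c d) σ₁ (t₁ + t₂) σ₃
  | ite_true {e c d σ σ' t} : e.eval σ ≠ .nil → Runs c σ t σ' →
      Runs (.ite e c d) σ (e.cost + 1 + t) σ'
  | ite_false {e c d σ σ' t} : e.eval σ = .nil → Runs d σ t σ' →
      Runs (.ite e c d) σ (e.cost + 1 + t) σ'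
  | loop_true {e c σ₁ σ₂ σ₃ t₁ t₂} : e.eval σ₁ ≠ .nil → Runs c σ₁ t₁ σ₂ →
      Runs (.loop e c) σ₂ t₂ σ₃ → Runs (.loop e c) σ₁ (e.cost + 1 + t₁ + t₂) σ₃
  | loop_false {e c σ} : e.eval σ = .nil → Runs (.loop e c) σ (e.cost + 1) σ

/-- On input `a`, which is placed in variable `0` while all other variables are `nil`, the program
`p` halts after exactly `t` steps with output `b` in variable `0`. -/
def Computes (p : Prog) (a : Val) (t : ℕ) (b : Val) : Prop :=
  ∃ σ, Runs p (Function.update (fun _ => .nil) 0 a) t σ ∧ σ 0 = b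

/-! ### Encodings -/

/-- Lists are encoded by nested pairs. -/
def encodeList : List Val → Val
  | [] => .nil
  | a :: l => .cons a (encodeList l)

/-- Natural numbers are encoded in unary. -/
def encodeNat (m : ℕ) : Val := encodeList (List.replicate m .nil)

open Classical in
/-- Truth values: `nil` is false, `cons nil nil` is true. -/
noncomputable def encodeBit (p : Prop) : Val := if p then .cons .nil .nil else .nil

/-- A family indexed by `0, …, m - 1`, as a list of length `m`. -/
def encodeFamily {m : ℕ} (f : Fin m → Val) : Val := encodeList (List.ofFn f)

/-- Sets of vertices are encoded by their characteristic vectors. -/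
noncomputable def encodeSet {n : ℕ} (S : Finset (Fin n)) : Val :=
  encodeFamily fun v => encodeBit (v ∈ S)

/-- The instance `(D, k)`, where `D` has adjacency matrix `M`. -/
def encodeInstance {n : ℕ} (M : Fin n → Fin n → ℕ) (k : ℕ) : Val :=
  .cons (encodeNat k) (encodeFamily fun u => encodeFamily fun v => encodeNat (M u v))

open Classical in
/-- An arboreal decomposition is written as the matrix whose entry at `(r, s)` is `nil` if `(r, s)`
is not an edge of `R` and carries the guard `X_{(r, s)}` otherwise, together with the list of the
bags `W_r`. -/
noncomputable def ArborealDecomposition.encode {n m : ℕ} {D : Digraph (Fin n)}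
    (A : ArborealDecomposition D (Fin m)) : Val :=
  .cons
    (encodeFamily fun r => encodeFamily fun s =>
      if A.R.Adj r s then .cons .nil (encodeSet (A.X r s)) else .nil)
    (encodeFamily fun r => encodeSet (A.W r))

/-- The output by which a program states that the input digraph admits a haven; it differs from the
encoding of every arboreal decomposition. -/
def statesHaven : Val := .nil

end Arboreal

open Arboreal

/-!
The algorithm computes a decomposition whose nodes are the vertices of `D` themselves: every bag
is a single vertex. The vertices are split into ever smaller parts, each a set `B` with a guard `T` of at
most `2k - 1` vertices; at the start `B` is everything and `T` is empty. For a part it looks for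
a set `Z` of fewer than `k` vertices such that every strong component of `D ∖ Z` contains at most
half of `T` (`Balanced`). If there is none for some `T`, then for each `Z` with `|Z| < k` some
strong component of `D ∖ Z` contains more than half of `T`. Any two of these components, for
whatever sets `Z`, meet in `T`, so that they form a haven (`hasHaven_of_not_balanced`). Otherwise
the vertices of `Z` in `B`, with one extra vertex of `B` to guarantee progress, become a path in the
tree, and every strong component of the rest of `D[B]` is a new part. It is guarded by `Z`, the
extra vertex and the part of `T`, at most half of it, that lies in its component of `D ∖ Z`: these
are at most `k + (k - 1) = 2k - 1` vertices. All guards at a node lie in the union of `T`, `Z` and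
the extra vertex, which has at most `3k - 1` elements (`exists_node_bound`), so that the width is at
most `3k - 2`. The path attached to a part is organised by the numbering of the vertices, and the
part of each vertex is found by following that vertex alone (`finalPart`); the tree is recovered
from the resulting parent function (`parentData`, `ParentData.decomposition`).

The separators are found in time `2 ^ O(k log k)` times a polynomial in `n`. In the topological
order of the strong components of `D ∖ Z`, a balanced separator splits `T ∖ Z` into three sets `A`,
`B`, `C` such that nothing is reachable from a later one in an earlier one (`exists_tripartition`,
`balanced_of_tripartition`). The partition is guessed, as `T` is small. It remains to find a skew
separator: a small set that leaves no path from `C` to `A ∪ B` and none from `B` to `A`. A minimum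
cut between `C` and `A ∪ B` with farthest source side can be pushed towards `A ∪ B` through one of
its vertices; guessing which vertex is pushed in each of at most `k` rounds reaches a cut that is
contained in some optimal solution, since by submodularity every farthest minimum cut lies within
the source side of such a solution, and each push increases the value of the cut. The rest of the
separator is a minimum cut between `B` and `A` (`exists_candidate`). All guesses together form a
number below `(k + 4) ^ (3k)`, written in base `k + 4` (`digits`, `separator`).

For the running time, `PolyTime s c x` says that one program turns `c i` into `x i` in time
polynomial in a measure `s i` of the index `i`. This notion is closed under composition, bounded
loops, quantifiers over vertices and the formation of sets and matrices, so that each function of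
the algorithm is shown to be in it by following its definition. With the measure
`n + (k + 4) ^ (3k)` (`Instance.size`) the time is at most `(n + (k + 4) ^ (3k) + 2) ^ e` for a
constant `e`.
-/

namespace Arboreal

/-! ### Polynomial-time evaluation in context -/

/-- `t` is bounded by a polynomial in the size measure `s`, in the form `(s + 2) ^ e`. -/
def PolyBound {I : Type*} (s t : I → ℕ) : Prop := ∃ e : ℕ, ∀ i, t i ≤ (s i + 2) ^ e

section PolyBound
variable {I J : Type*} {s t u : I → ℕ}

theorem PolyBound.mono (h : PolyBound s u) (htu : ∀ i, t i ≤ u i) : PolyBound s t :=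
  h.imp fun _ he i => (htu i).trans (he i)

theorem PolyBound.const (a : ℕ) : PolyBound s (fun _ => a) :=
  ⟨a, fun i => (Nat.lt_two_pow_self (n := a)).le.trans (Nat.pow_le_pow_left (by omega) a)⟩

theorem PolyBound.self : PolyBound s s := ⟨1, fun i => by simp⟩

theorem PolyBound.mul (ht : PolyBound s t) (hu : PolyBound s u) :
    PolyBound s (fun i => t i * u i) := by
  obtain ⟨a, ha⟩ := ht
  obtain ⟨b, hb⟩ := hu
  exact ⟨a + b, fun i => by rw [pow_add]; exact Nat.mul_le_mul (ha i) (hb i)⟩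

theorem PolyBound.add (ht : PolyBound s t) (hu : PolyBound s u) :
    PolyBound s (fun i => t i + u i) := by
  obtain ⟨a, ha⟩ := ht
  obtain ⟨b, hb⟩ := hu
  refine ⟨a + b + 1, fun i => ?_⟩
  have h1 : (s i + 2) ^ a ≤ (s i + 2) ^ (a + b) := Nat.pow_le_pow_right (by omega) (by omega)
  have h2 : (s i + 2) ^ b ≤ (s i + 2) ^ (a + b) := Nat.pow_le_pow_right (by omega) (by omega)
  have h3 : (s i + 2) ^ (a + b + 1) = (s i + 2) ^ (a + b) * (s i + 2) := pow_succ _ _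
  have := ha i
  have := hb i
  nlinarith

theorem PolyBound.comp (h : PolyBound s t) (π : J → I) :
    PolyBound (fun j => s (π j)) (fun j => t (π j)) :=
  h.imp fun _ he j => he (π j)

end PolyBound

/-- The values `x i` can be computed from the values `c i` in time polynomial in `s i`, uniformly in
`i`.  The program receives `c i` in variable `0` and leaves `x i` there.  Variable `1` serves as a
stack and is restored; all other variables may be overwritten.  The measure `s` belongs to the index
and need not be related to the sizes of the trees `c i` and `x i`, as a step of the machine costs
the same for every tree. -/
def PolyTime {I : Type*} (s : I → ℕ) (c x : I → Val) : Prop :=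
  ∃ (p : Prog) (T : I → ℕ), PolyBound s T ∧ ∀ i (σ : Store), σ 0 = c i →
    ∃ t σ', Runs p σ t σ' ∧ t ≤ T i ∧ σ' 0 = x i ∧ σ' 1 = σ 1

@[simp] theorem Val.hd_cons (a b : Val) : (Val.cons a b).hd = a := rfl

@[simp] theorem Val.tl_cons (a b : Val) : (Val.cons a b).tl = b := rfl

@[simp] theorem Val.tl_nil : Val.nil.tl = .nil := rfl

section PolyTime
variable {I J : Type*} {s : I → ℕ} {c x y z : I → Val}

theorem PolyTime.congr (h : PolyTime s c x) (hxy : ∀ i, x i = y i) : PolyTime s c y := by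
  rwa [show y = x from funext fun i => (hxy i).symm]

theorem PolyTime.trans (h : PolyTime s c x) (h' : PolyTime s x z) : PolyTime s c z := by
  obtain ⟨p, T, hT, hp⟩ := h
  obtain ⟨q, U, hU, hq⟩ := h'
  refine ⟨p.seq q, _, hT.add hU, fun i σ hσ => ?_⟩
  obtain ⟨t, σ', hr, ht, h0, h1⟩ := hp i σ hσ
  obtain ⟨u, σ'', hr', hu, h0', h1'⟩ := hq i σ' h0
  exact ⟨_, _, .seq hr hr', by omega, h0', h1'.trans h1⟩

theorem PolyTime.comp (h : PolyTime s c x) (π : J → I) :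
    PolyTime (fun j => s (π j)) (fun j => c (π j)) (fun j => x (π j)) := by
  obtain ⟨p, T, hT, hp⟩ := h
  exact ⟨p, _, hT.comp π, fun j σ hσ => hp (π j) σ hσ⟩

/-- A single assignment to variable `0`, by an expression in that variable. -/
theorem PolyTime.assign (e : Expr) (h : ∀ i (σ : Store), σ 0 = c i → e.eval σ = x i) :
    PolyTime s c x :=
  ⟨.assign 0 e, _, .const (e.cost + 1), fun i σ hσ =>
    ⟨_, _, .assign 0 e σ, le_rfl, by simp [h i σ hσ], by simp⟩⟩

theorem PolyTime.id : PolyTime s c c := .assign (.var 0) fun _ _ h => h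

theorem PolyTime.nil : PolyTime s c (fun _ => .nil) := .assign .nil fun _ _ _ => rfl

theorem PolyTime.hd (h : PolyTime s c x) : PolyTime s c (fun i => (x i).hd) :=
  h.trans (.assign (.hd (.var 0)) fun _ _ h => congrArg Val.hd h)

theorem PolyTime.tl (h : PolyTime s c x) : PolyTime s c (fun i => (x i).tl) :=
  h.trans (.assign (.tl (.var 0)) fun _ _ h => congrArg Val.tl h)

theorem PolyTime.cons (h : PolyTime s c x) (h' : PolyTime s c y) :
    PolyTime s c (fun i => .cons (x i) (y i)) := by
  obtain ⟨p, T, hT, hp⟩ := h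
  obtain ⟨q, U, hU, hq⟩ := h'
  -- While `p` runs, `c i` is kept on the stack; while `q` runs, `x i` is.
  refine ⟨.seq (.assign 1 (.cons (.var 0) (.var 1))) (.seq p
      (.seq (.assign 2 (.var 0)) (.seq (.assign 0 (.hd (.var 1)))
        (.seq (.assign 1 (.cons (.var 2) (.tl (.var 1)))) (.seq q
          (.seq (.assign 0 (.cons (.hd (.var 1)) (.var 0))) (.assign 1 (.tl (.var 1))))))))),
    _, (hT.add hU).add (.const 30), fun i σ hσ => ?_⟩
  obtain ⟨t, σ', hr, ht, h0, h1⟩ := hp i (Function.update σ 1 (.cons (σ 0) (σ 1))) (by simp [hσ])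
  have r1 := Runs.assign 2 (.var 0) σ'
  set τ1 := Function.update σ' 2 ((Expr.var 0).eval σ') with hτ1
  have r2 := Runs.assign 0 (.hd (.var 1)) τ1
  set τ2 := Function.update τ1 0 ((Expr.hd (.var 1)).eval τ1) with hτ2
  have r3 := Runs.assign 1 (.cons (.var 2) (.tl (.var 1))) τ2
  set τ3 := Function.update τ2 1 ((Expr.cons (.var 2) (.tl (.var 1))).eval τ2) with hτ3
  have e3 : τ3 0 = c i := by
    simp [hτ3, hτ2, hτ1, Expr.eval, h1, hσ]
  have e3' : τ3 1 = .cons (x i) (σ 1) := by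
    simp [hτ3, hτ2, hτ1, Expr.eval, h1, h0]
  obtain ⟨u, σ'', hr', hu, h0', h1'⟩ := hq i τ3 e3
  have r4 := Runs.assign 0 (.cons (.hd (.var 1)) (.var 0)) σ''
  set τ4 := Function.update σ'' 0 ((Expr.cons (.hd (.var 1)) (.var 0)).eval σ'') with hτ4
  have r5 := Runs.assign 1 (.tl (.var 1)) τ4
  refine ⟨_, _, .seq (.assign _ _ _) (.seq hr (.seq r1 (.seq r2 (.seq r3 (.seq hr'
    (.seq r4 r5)))))), ?_, ?_, ?_⟩
  · simp only [Expr.cost]; omega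
  · simp [hτ4, Expr.eval, h1', e3', h0']
  · simp [hτ4, Expr.eval, h1', e3']

/-- A context `c` may be extended by a further variable `v`, also along a change of the index; the
contexts of loop bodies and quantified formulas are of this form. -/
theorem PolyTime.weaken (h : PolyTime s c x) (π : J → I) (v : J → Val) :
    PolyTime (fun j => s (π j)) (fun j => .cons (v j) (c (π j))) (fun j => x (π j)) :=
  (PolyTime.id.tl : PolyTime _ (fun j => Val.cons (v j) (c (π j))) fun j => c (π j)).trans
    (h.comp π)

/-- The most recently bound variable. -/
theorem PolyTime.top (v : I → Val) : PolyTime s (fun i => .cons (v i) (c i)) v :=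
  PolyTime.id.hd

/-- Branching: any value that is `nil` exactly if `P` fails may serve as a test for `P`. -/
theorem PolyTime.iteOfTest {P : I → Prop} [∀ i, Decidable (P i)] {b : I → Val} (hP : PolyTime s c b)
    (hb : ∀ i, b i = .nil ↔ ¬ P i)
    (hx : PolyTime s c x) (hy : PolyTime s c y) :
    PolyTime s c (fun i => if P i then x i else y i) := by
  obtain ⟨p, T, hT, hp⟩ := hx
  obtain ⟨q, U, hU, hq⟩ := hy
  refine (hP.cons .id).trans ⟨.seq (.assign 2 (.hd (.var 0))) (.seq (.assign 0 (.tl (.var 0)))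
    (.ite (.var 2) p q)), _, (hT.add hU).add (.const 20), fun i σ hσ => ?_⟩
  have r1 := Runs.assign 2 (.hd (.var 0)) σ
  set τ1 := Function.update σ 2 ((Expr.hd (.var 0)).eval σ) with hτ1
  have r2 := Runs.assign 0 (.tl (.var 0)) τ1
  set τ2 := Function.update τ1 0 ((Expr.tl (.var 0)).eval τ1) with hτ2
  have e0 : τ2 0 = c i := by simp [hτ2, hτ1, Expr.eval, hσ]
  have e1 : τ2 1 = σ 1 := by simp [hτ2, hτ1]
  have e2 : τ2 2 = b i := by simp [hτ2, hτ1, Expr.eval, hσ]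
  by_cases h : P i
  · obtain ⟨t, σ', hr, ht, h0, h1⟩ := hp i τ2 e0
    refine ⟨_, _, .seq r1 (.seq r2 (.ite_true ?_ hr)), ?_, ?_, h1.trans e1⟩
    · simp [Expr.eval, e2, hb, h]
    · simp only [Expr.cost]; omega
    · simp [h, h0]
  · obtain ⟨t, σ', hr, ht, h0, h1⟩ := hq i τ2 e0
    refine ⟨_, _, .seq r1 (.seq r2 (.ite_false ?_ hr)), ?_, ?_, h1.trans e1⟩
    · simp [Expr.eval, e2, hb, h]
    · simp only [Expr.cost]; omega
    · simp [h, h0]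

theorem encodeBit_eq_nil {p : Prop} : encodeBit p = .nil ↔ ¬ p := by
  by_cases h : p <;> simp [encodeBit, h]

theorem PolyTime.ite {P : I → Prop} [∀ i, Decidable (P i)]
    (hP : PolyTime s c (fun i => encodeBit (P i)))
    (hx : PolyTime s c x) (hy : PolyTime s c y) :
    PolyTime s c (fun i => if P i then x i else y i) :=
  hP.iteOfTest (fun _ => encodeBit_eq_nil) hx hy

/-- The basic loop.  The counter takes the values `ctr i (m i), …, ctr i 0 = nil`, each of which is
the tail of the one before; with `ctr i = encodeNat` this is a countdown, and with the final
segments of a list it is a loop over that list.  The body may read the counter after the tail has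
been taken, the accumulator and the context. -/
theorem PolyTime.foldrList {m : I → ℕ} {σ : I → Type*} {enc : ∀ i, σ i → Val}
    {f : ∀ i, Fin (m i) → σ i → σ i} {init : ∀ i, σ i} (ctr : I → ℕ → Val)
    (hm : PolyBound s m) (h0 : ∀ i, ctr i 0 = .nil)
    (hsucc : ∀ i j, ctr i (j + 1) ≠ .nil) (htl : ∀ i j, (ctr i (j + 1)).tl = ctr i j)
    (hctr : PolyTime s c (fun i => ctr i (m i)))
    (hinit : PolyTime s c (fun i => enc i (init i)))
    (hbody : PolyTime (fun j : Σ i, Fin (m i) × σ i => s j.1)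
      (fun j => .cons (ctr j.1 j.2.1) (.cons (enc j.1 j.2.2) (c j.1)))
      (fun j => enc j.1 (f j.1 j.2.1 j.2.2))) :
    PolyTime s c (fun i => enc i (Fin.foldr (m i) (f i) (init i))) := by
  obtain ⟨p, T, ⟨e, hT⟩, hp⟩ := hbody
  set body : Prog := .seq (.assign 0 (.cons (.tl (.hd (.var 0))) (.tl (.var 0))))
    (.seq (.assign 1 (.cons (.var 0) (.var 1))) (.seq p
      (.seq (.assign 0 (.cons (.hd (.hd (.var 1))) (.cons (.var 0) (.tl (.tl (.hd (.var 1)))))))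
        (.assign 1 (.tl (.var 1)))))) with hbody
  -- In the loop, variable `0` holds the counter, the accumulator and the context; a copy with the
  -- new counter is kept on the stack while the body runs.
  have key : ∀ i (st : Store) (k : ℕ) (hk : k ≤ m i) (acc : σ i),
      st 0 = .cons (ctr i k) (.cons (enc i acc) (c i)) →
      ∃ t st', Runs (.loop (.hd (.var 0)) body) st t st' ∧ t ≤ k * ((s i + 2) ^ e + 40) + 3 ∧
        st' 0 = .cons .nil (.cons (enc i (Fin.foldr k (fun v => f i (v.castLE hk)) acc)) (c i)) ∧
        st' 1 = st 1 := by
    intro i st k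
    induction k generalizing st with
    | zero =>
      intro hk acc hst
      refine ⟨_, _, .loop_false (by simp [Expr.eval, hst, h0]), by simp [Expr.cost],
        by simp [hst, h0], rfl⟩
    | succ k ih =>
      intro hk acc hst
      have r1 := Runs.assign 0 (.cons (.tl (.hd (.var 0))) (.tl (.var 0))) st
      set τ1 := Function.update st 0 ((Expr.cons (.tl (.hd (.var 0))) (.tl (.var 0))).eval st)
        with hτ1
      have r2 := Runs.assign 1 (.cons (.var 0) (.var 1)) τ1
      set τ2 := Function.update τ1 1 ((Expr.cons (.var 0) (.var 1)).eval τ1) with hτ2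
      have e0 : τ2 0 = .cons (ctr i k) (.cons (enc i acc) (c i)) := by
        simp [hτ2, hτ1, Expr.eval, hst, htl]
      have e1 : τ2 1 = .cons (.cons (ctr i k) (.cons (enc i acc) (c i))) (st 1) := by
        simp [hτ2, hτ1, Expr.eval, hst, htl]
      obtain ⟨t, σ', hr, ht, h0', h1'⟩ := hp ⟨i, ⟨k, hk⟩, acc⟩ τ2 e0
      have r3 := Runs.assign 0 (.cons (.hd (.hd (.var 1)))
        (.cons (.var 0) (.tl (.tl (.hd (.var 1)))))) σ'
      set τ3 := Function.update σ' 0 ((Expr.cons (.hd (.hd (.var 1)))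
        (.cons (.var 0) (.tl (.tl (.hd (.var 1)))))).eval σ') with hτ3
      have r4 := Runs.assign 1 (.tl (.var 1)) τ3
      set τ4 := Function.update τ3 1 ((Expr.tl (.var 1)).eval τ3) with hτ4
      have e4 : τ4 0 = .cons (ctr i k) (.cons (enc i (f i ⟨k, hk⟩ acc)) (c i)) := by
        simp [hτ4, hτ3, Expr.eval, h1', e1, h0']
      have e4' : τ4 1 = st 1 := by
        simp [hτ4, hτ3, Expr.eval, h1', e1]
      obtain ⟨u, st', hr', hu, h0'', h1''⟩ := ih τ4 (by omega) _ e4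
      refine ⟨_, _, .loop_true ?_ (.seq r1 (.seq r2 (.seq hr (.seq r3 r4)))) hr', ?_, ?_,
        h1''.trans e4'⟩
      · simpa [Expr.eval, hst] using hsucc i k
      · have := hT ⟨i, ⟨k, hk⟩, acc⟩
        simp only at this
        simp only [Expr.cost, add_mul, one_mul]
        omega
      · rw [h0'', Fin.foldr_succ_last]
        rfl
  have hloop : PolyTime s (fun i => .cons (ctr i (m i)) (.cons (enc i (init i)) (c i)))
      (fun i => .cons .nil (.cons (enc i (Fin.foldr (m i) (f i) (init i))) (c i))) := by
    refine ⟨.loop (.hd (.var 0)) body, _, (hm.mul (.add ⟨e, fun i => le_rfl⟩ (.const 40))).add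
      (.const 3), fun i st hst => key i st (m i) le_rfl (init i) hst⟩
  exact ((hctr.cons (hinit.cons .id)).trans hloop).tl.hd

end PolyTime

/-! ### Loops, truth values and numbers -/

theorem encodeNat_zero : encodeNat 0 = .nil := rfl

theorem encodeNat_succ (m : ℕ) : encodeNat (m + 1) = .cons .nil (encodeNat m) := rfl

/-- The numbers `m i` are computable in unary in polynomial time, and they are polynomially
bounded, so that they may serve as numbers of iterations. -/
def PolyNat {I : Type*} (s : I → ℕ) (c : I → Val) (m : I → ℕ) : Prop :=
  PolyTime s c (fun i => encodeNat (m i)) ∧ PolyBound s m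

section Library
variable {I J : Type*} {s : I → ℕ} {c x y z : I → Val}

/-- Weakening under one binder.  The variants `wk₂` (one index for two variables) and `lift₂`,
`lift₃`, `lift₄` (nested indices) are instances of `PolyTime.weaken` in a form that
unification can use. -/
theorem PolyTime.wk {β : I → Type*} {v : (Σ i, β i) → Val} (h : PolyTime s c x) :
    PolyTime (fun j : Σ i, β i => s j.1) (fun j => .cons (v j) (c j.1)) (fun j => x j.1) :=
  h.weaken Sigma.fst v

theorem PolyTime.wk₂ {β : I → Type*} {u v : (Σ i, β i) → Val} (h : PolyTime s c x) :
    PolyTime (fun j : Σ i, β i => s j.1) (fun j => .cons (u j) (.cons (v j) (c j.1)))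
      (fun j => x j.1) :=
  (h.weaken Sigma.fst v).weaken (fun j => j) u

theorem PolyNat.wk {β : I → Type*} {v : (Σ i, β i) → Val} {m : I → ℕ} (h : PolyNat s c m) :
    PolyNat (fun j : Σ i, β i => s j.1) (fun j => .cons (v j) (c j.1)) (fun j => m j.1) :=
  ⟨h.1.wk, h.2.comp Sigma.fst⟩

theorem PolyNat.wk₂ {β : I → Type*} {u v : (Σ i, β i) → Val} {m : I → ℕ} (h : PolyNat s c m) :
    PolyNat (fun j : Σ i, β i => s j.1) (fun j => .cons (u j) (.cons (v j) (c j.1)))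
      (fun j => m j.1) :=
  ⟨h.1.wk₂, h.2.comp Sigma.fst⟩

section Nested
variable {β : I → Type*} {γ : (Σ i, β i) → Type*} {δ : (Σ j : Σ i, β i, γ j) → Type*}
  {ε : (Σ l : Σ j : Σ i, β i, γ j, δ l) → Type*}

theorem PolyTime.lift₂ {u v : (Σ j : Σ i, β i, γ j) → Val} (h : PolyTime s c x) :
    PolyTime (fun j : Σ j : Σ i, β i, γ j => s j.1.1)
      (fun j => .cons (u j) (.cons (v j) (c j.1.1))) (fun j => x j.1.1) :=
  (h.weaken (fun j : Σ j : Σ i, β i, γ j => j.1.1) v).weaken (fun j => j) u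

theorem PolyTime.lift₃ {u v w : (Σ l : Σ j : Σ i, β i, γ j, δ l) → Val} (h : PolyTime s c x) :
    PolyTime (fun j : Σ l : Σ j : Σ i, β i, γ j, δ l => s j.1.1.1)
      (fun j => .cons (u j) (.cons (v j) (.cons (w j) (c j.1.1.1)))) (fun j => x j.1.1.1) :=
  ((h.weaken (fun j : Σ l : Σ j : Σ i, β i, γ j, δ l => j.1.1.1) w).weaken
    (fun j => j) v).weaken (fun j => j) u

theorem PolyTime.lift₄ {u v w t : (Σ l : Σ l : Σ j : Σ i, β i, γ j, δ l, ε l) → Val}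
    (h : PolyTime s c x) :
    PolyTime (fun j : Σ l : Σ l : Σ j : Σ i, β i, γ j, δ l, ε l => s j.1.1.1.1)
      (fun j => .cons (u j) (.cons (v j) (.cons (w j) (.cons (t j) (c j.1.1.1.1)))))
      (fun j => x j.1.1.1.1) :=
  (((h.weaken (fun j : Σ l : Σ l : Σ j : Σ i, β i, γ j, δ l, ε l => j.1.1.1.1) t).weaken
    (fun j => j) w).weaken (fun j => j) v).weaken (fun j => j) u

theorem PolyNat.lift₂ {u v : (Σ j : Σ i, β i, γ j) → Val} {m : I → ℕ} (h : PolyNat s c m) :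
    PolyNat (fun j : Σ j : Σ i, β i, γ j => s j.1.1)
      (fun j => .cons (u j) (.cons (v j) (c j.1.1))) (fun j => m j.1.1) :=
  ⟨h.1.lift₂, h.2.comp _⟩

theorem PolyNat.lift₃ {u v w : (Σ l : Σ j : Σ i, β i, γ j, δ l) → Val} {m : I → ℕ}
    (h : PolyNat s c m) :
    PolyNat (fun j : Σ l : Σ j : Σ i, β i, γ j, δ l => s j.1.1.1)
      (fun j => .cons (u j) (.cons (v j) (.cons (w j) (c j.1.1.1)))) (fun j => m j.1.1.1) :=
  ⟨h.1.lift₃, h.2.comp _⟩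

theorem PolyNat.lift₄ {u v w t : (Σ l : Σ l : Σ j : Σ i, β i, γ j, δ l, ε l) → Val} {m : I → ℕ}
    (h : PolyNat s c m) :
    PolyNat (fun j : Σ l : Σ l : Σ j : Σ i, β i, γ j, δ l, ε l => s j.1.1.1.1)
      (fun j => .cons (u j) (.cons (v j) (.cons (w j) (.cons (t j) (c j.1.1.1.1)))))
      (fun j => m j.1.1.1.1) :=
  ⟨h.1.lift₄, h.2.comp _⟩

end Nested

/-- The last variable but one, in a context extended by two variables. -/
theorem PolyTime.top₂ (u v : I → Val) : PolyTime s (fun i => .cons (u i) (.cons (v i) (c i))) v :=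
  PolyTime.id.tl.hd

theorem PolyTime.top₃ (u v w : I → Val) :
    PolyTime s (fun i => .cons (u i) (.cons (v i) (.cons (w i) (c i)))) w := PolyTime.id.tl.tl.hd

theorem PolyTime.top₄ (u v w t : I → Val) :
    PolyTime s (fun i => .cons (u i) (.cons (v i) (.cons (w i) (.cons (t i) (c i))))) t :=
  PolyTime.id.tl.tl.tl.hd

theorem PolyTime.foldr {m : I → ℕ} {σ : I → Type*} {enc : ∀ i, σ i → Val}
    {f : ∀ i, Fin (m i) → σ i → σ i} {init : ∀ i, σ i}
    (hm : PolyNat s c m) (hinit : PolyTime s c (fun i => enc i (init i)))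
    (hbody : PolyTime (fun j : Σ i, Fin (m i) × σ i => s j.1)
      (fun j => .cons (encodeNat j.2.1) (.cons (enc j.1 j.2.2) (c j.1)))
      (fun j => enc j.1 (f j.1 j.2.1 j.2.2))) :
    PolyTime s c (fun i => enc i (Fin.foldr (m i) (f i) (init i))) :=
  .foldrList (fun _ => encodeNat) hm.2 (fun _ => rfl) (fun _ _ => by simp [encodeNat_succ])
    (fun _ _ => rfl) hm.1 hinit hbody

theorem foldr_const {α : Type*} (m : ℕ) (f : α → α) (a : α) :
    Fin.foldr m (fun _ => f) a = f^[m] a := by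
  induction m generalizing a with
  | zero => simp
  | succ m ih => rw [Fin.foldr_succ_last, ih, Function.iterate_succ_apply]

theorem PolyTime.iterate {m : I → ℕ} {σ : I → Type*} {enc : ∀ i, σ i → Val}
    {f : ∀ i, σ i → σ i} {init : ∀ i, σ i}
    (hm : PolyNat s c m) (hinit : PolyTime s c (fun i => enc i (init i)))
    (hbody : PolyTime (fun j : Σ i, σ i => s j.1) (fun j => .cons (enc j.1 j.2) (c j.1))
      (fun j => enc j.1 (f j.1 j.2))) :
    PolyTime s c (fun i => enc i ((f i)^[m i] (init i))) := by
  simp only [← foldr_const]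
  exact .foldr (f := fun i _ => f i) hm hinit
    (hbody.weaken (fun j : Σ i, Fin (m i) × σ i => ⟨j.1, j.2.2⟩) _)

theorem PolyTime.bit_congr {P Q : I → Prop} (h : PolyTime s c (fun i => encodeBit (P i)))
    (hPQ : ∀ i, P i ↔ Q i) : PolyTime s c (fun i => encodeBit (Q i)) :=
  h.congr fun i => by rw [propext (hPQ i)]

theorem PolyTime.true : PolyTime s c (fun _ => encodeBit True) :=
  (PolyTime.nil.cons .nil).congr fun _ => by simp [encodeBit]

theorem PolyTime.false : PolyTime s c (fun _ => encodeBit False) :=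
  PolyTime.nil.congr fun _ => by simp [encodeBit]

theorem PolyTime.bitOfTest {P : I → Prop} {b : I → Val} (h : PolyTime s c b)
    (hb : ∀ i, b i = .nil ↔ ¬ P i) : PolyTime s c (fun i => encodeBit (P i)) := by
  classical
  exact (h.iteOfTest hb .true .false).congr fun i => by by_cases h : P i <;> simp [h]

theorem PolyTime.not {P : I → Prop} (h : PolyTime s c (fun i => encodeBit (P i))) :
    PolyTime s c (fun i => encodeBit (¬ P i)) := by
  classical
  exact (h.ite .false .true).congr fun i => by by_cases h : P i <;> simp [h]

theorem PolyTime.and {P Q : I → Prop} (h : PolyTime s c (fun i => encodeBit (P i)))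
    (h' : PolyTime s c (fun i => encodeBit (Q i))) :
    PolyTime s c (fun i => encodeBit (P i ∧ Q i)) := by
  classical
  exact (h.ite h' .false).congr fun i => by by_cases h : P i <;> simp [h]

theorem PolyTime.or {P Q : I → Prop} (h : PolyTime s c (fun i => encodeBit (P i)))
    (h' : PolyTime s c (fun i => encodeBit (Q i))) :
    PolyTime s c (fun i => encodeBit (P i ∨ Q i)) := by
  classical
  exact (h.ite .true h').congr fun i => by by_cases h : P i <;> simp [h]

theorem PolyTime.imp {P Q : I → Prop} (h : PolyTime s c (fun i => encodeBit (P i)))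
    (h' : PolyTime s c (fun i => encodeBit (Q i))) :
    PolyTime s c (fun i => encodeBit (P i → Q i)) := by
  classical
  exact (h.ite h' .true).congr fun i => by by_cases h : P i <;> simp [h]

theorem foldr_or {m : ℕ} (P : Fin m → Prop) :
    Fin.foldr m (fun v acc => P v ∨ acc) False ↔ ∃ v, P v := by
  induction m with
  | zero => simp
  | succ m ih => rw [Fin.foldr_succ, ih, Fin.exists_fin_succ]

theorem PolyTime.exists {m : I → ℕ} {P : ∀ i, Fin (m i) → Prop} (hm : PolyNat s c m)
    (h : PolyTime (fun j : Σ i, Fin (m i) => s j.1) (fun j => .cons (encodeNat j.2) (c j.1))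
      (fun j => encodeBit (P j.1 j.2))) :
    PolyTime s c (fun i => encodeBit (∃ v, P i v)) := by
  refine (PolyTime.foldr (σ := fun _ => Prop) (enc := fun _ => encodeBit)
    (f := fun i v acc => P i v ∨ acc) hm .false (.or ?_ (.top₂ _ _))).bit_congr
    fun i => foldr_or _
  exact (PolyTime.id.hd.cons PolyTime.id.tl.tl).trans
    (h.comp fun j : Σ i, Fin (m i) × Prop => ⟨j.1, j.2.1⟩)

theorem PolyTime.forall {m : I → ℕ} {P : ∀ i, Fin (m i) → Prop} (hm : PolyNat s c m)
    (h : PolyTime (fun j : Σ i, Fin (m i) => s j.1) (fun j => .cons (encodeNat j.2) (c j.1))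
      (fun j => encodeBit (P j.1 j.2))) :
    PolyTime s c (fun i => encodeBit (∀ v, P i v)) :=
  (PolyTime.exists (P := fun i v => ¬ P i v) hm h.not).not.bit_congr fun i => by simp

theorem PolyNat.const (a : ℕ) : PolyNat s c (fun _ => a) := by
  refine ⟨?_, .const a⟩
  induction a with
  | zero => exact .nil
  | succ a ih => exact PolyTime.nil.cons ih

theorem PolyTime.succ {m : I → ℕ} (h : PolyTime s c (fun i => encodeNat (m i))) :
    PolyTime s c (fun i => encodeNat (m i + 1)) := PolyTime.nil.cons h

/-- Truncated predecessor: the tail of `nil` is `nil`. -/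
theorem PolyTime.pred {m : I → ℕ} (h : PolyTime s c (fun i => encodeNat (m i))) :
    PolyTime s c (fun i => encodeNat (m i - 1)) :=
  h.tl.congr fun i => by cases m i <;> rfl

theorem PolyTime.pos {m : I → ℕ} (h : PolyTime s c (fun i => encodeNat (m i))) :
    PolyTime s c (fun i => encodeBit (0 < m i)) :=
  h.bitOfTest fun i => by cases m i <;> simp [encodeNat_zero, encodeNat_succ]

theorem PolyTime.add {a b : I → ℕ} (ha : PolyTime s c (fun i => encodeNat (a i)))
    (hb : PolyNat s c b) : PolyTime s c (fun i => encodeNat (a i + b i)) :=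
  (PolyTime.iterate (σ := fun _ => ℕ) (enc := fun _ => encodeNat) (f := fun _ m => m + 1)
    hb ha (PolyTime.top _).succ).congr fun i => by simp

theorem PolyTime.sub {a b : I → ℕ} (ha : PolyTime s c (fun i => encodeNat (a i)))
    (hb : PolyNat s c b) : PolyTime s c (fun i => encodeNat (a i - b i)) :=
  (PolyTime.iterate (σ := fun _ => ℕ) (enc := fun _ => encodeNat) (f := fun _ m => m - 1)
    hb ha (PolyTime.top _).pred).congr fun i => by
      congr 1
      induction b i with
      | zero => rfl
      | succ b ih => rw [Function.iterate_succ_apply', ih]; omega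

theorem PolyNat.add {a b : I → ℕ} (ha : PolyNat s c a) (hb : PolyNat s c b) :
    PolyNat s c (fun i => a i + b i) := ⟨ha.1.add hb, ha.2.add hb.2⟩

theorem PolyNat.sub {a b : I → ℕ} (ha : PolyNat s c a) (hb : PolyNat s c b) :
    PolyNat s c (fun i => a i - b i) := ⟨ha.1.sub hb, ha.2.mono fun _ => Nat.sub_le _ _⟩

theorem PolyNat.mul {a b : I → ℕ} (ha : PolyNat s c a) (hb : PolyNat s c b) :
    PolyNat s c (fun i => a i * b i) := by
  refine ⟨(PolyTime.iterate (σ := fun _ => ℕ) (enc := fun _ => encodeNat)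
    (f := fun j m => m + b j) (init := fun _ => 0) ha .nil ((PolyTime.top _).add hb.wk)).congr
    fun i => ?_, ha.2.mul hb.2⟩
  congr 1
  dsimp only
  induction a i with
  | zero => simp
  | succ a ih => rw [Function.iterate_succ_apply', ih]; ring

theorem PolyTime.lt {a b : I → ℕ} (ha : PolyNat s c a) (hb : PolyNat s c b) :
    PolyTime s c (fun i => encodeBit (a i < b i)) :=
  (hb.1.sub ha).pos.bit_congr fun i => by omega

theorem PolyTime.le {a b : I → ℕ} (ha : PolyNat s c a) (hb : PolyNat s c b) :
    PolyTime s c (fun i => encodeBit (a i ≤ b i)) :=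
  (PolyTime.lt hb ha).not.bit_congr fun i => by omega

theorem PolyTime.eq {a b : I → ℕ} (ha : PolyNat s c a) (hb : PolyNat s c b) :
    PolyTime s c (fun i => encodeBit (a i = b i)) :=
  ((PolyTime.le ha hb).and (.le hb ha)).bit_congr fun i => by omega

theorem PolyNat.fin {n : I → ℕ} {v : ∀ i, Fin (n i)} (hn : PolyBound s n)
    (hv : PolyTime s c (fun i => encodeNat (v i))) : PolyNat s c (fun i => v i) :=
  ⟨hv, hn.mono fun i => (v i).2.le⟩

theorem PolyTime.eqFin {n : I → ℕ} {v w : ∀ i, Fin (n i)} (hn : PolyBound s n)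
    (hv : PolyTime s c (fun i => encodeNat (v i))) (hw : PolyTime s c (fun i => encodeNat (w i))) :
    PolyTime s c (fun i => encodeBit (v i = w i)) :=
  (PolyTime.eq (.fin hn hv) (.fin hn hw)).bit_congr fun i => by rw [Fin.ext_iff]

theorem PolyTime.ltFin {n : I → ℕ} {v w : ∀ i, Fin (n i)} (hn : PolyBound s n)
    (hv : PolyTime s c (fun i => encodeNat (v i))) (hw : PolyTime s c (fun i => encodeNat (w i))) :
    PolyTime s c (fun i => encodeBit (v i < w i)) :=
  (PolyTime.lt (.fin hn hv) (.fin hn hw)).bit_congr fun i => by rw [Fin.lt_def]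

theorem foldr_count {m : ℕ} (P : Fin m → Prop) [DecidablePred P] :
    Fin.foldr m (fun v acc => if P v then acc + 1 else acc) 0 =
      (Finset.univ.filter P).card := by
  induction m with
  | zero => simp
  | succ m ih =>
    rw [Fin.foldr_succ, ih, Fin.card_filter_univ_succ]

theorem PolyNat.card {n : I → ℕ} {S : ∀ i, Finset (Fin (n i))} (hn : PolyNat s c n)
    (h : PolyTime (fun j : Σ i, Fin (n i) => s j.1) (fun j => .cons (encodeNat j.2) (c j.1))
      (fun j => encodeBit (j.2 ∈ S j.1))) :
    PolyNat s c (fun i => (S i).card) := by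
  refine ⟨(PolyTime.foldr (σ := fun _ => ℕ) (enc := fun _ => encodeNat)
    (f := fun i v acc => if v ∈ S i then acc + 1 else acc) (init := fun _ => 0) hn .nil
    ((PolyTime.ite (P := fun j : Σ i, Fin (n i) × ℕ => j.2.1 ∈ S j.1) ?_ (PolyTime.top₂ _ _).succ
      (.top₂ _ _)).congr fun j => (apply_ite encodeNat _ _ _).symm)).congr fun i => ?_,
    hn.2.mono fun i => by simpa using (S i).card_le_univ⟩
  · exact (PolyTime.id.hd.cons PolyTime.id.tl.tl).trans
      (h.comp fun j : Σ i, Fin (n i) × ℕ => ⟨j.1, j.2.1⟩)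
  · rw [foldr_count]; simp

theorem PolyNat.div {a b : I → ℕ} (ha : PolyNat s c a) (hb : PolyNat s c b)
    (hpos : ∀ i, 0 < b i) : PolyNat s c (fun i => a i / b i) := by
  classical
  have := PolyNat.card (S := fun i => Finset.univ.filter fun t : Fin (a i) =>
    (t + 1) * b i ≤ a i) ha
    ((PolyTime.le (.mul (.add (.fin (ha.2.comp _) (.top _)) (.const 1)) hb.wk) ha.wk).bit_congr
      fun i => by simp)
  convert this using 2 with i
  have : (Finset.univ.filter fun t : Fin (a i) => (t + 1) * b i ≤ a i) =
      Finset.univ.filter fun t : Fin (a i) => (t : ℕ) < a i / b i := by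
    ext t
    simp [← Nat.le_div_iff_mul_le (hpos i)]
  rw [this, Fin.card_filter_val_lt, min_eq_right (Nat.div_le_self _ _)]

theorem PolyNat.mod {a b : I → ℕ} (ha : PolyNat s c a) (hb : PolyNat s c b)
    (hpos : ∀ i, 0 < b i) : PolyNat s c (fun i => a i % b i) := by
  convert ha.sub (hb.mul (ha.div hb hpos)) using 2 with i
  have := Nat.div_add_mod (a i) (b i)
  omega

/-- The digits of a number in a given base. -/
theorem PolyNat.digit {q b m : I → ℕ} (hq : PolyNat s c q) (hb : PolyNat s c b)
    (hm : PolyNat s c m) (hpos : ∀ i, 0 < b i) :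
    PolyNat s c (fun i => q i / b i ^ m i % b i) := by
  refine .mod ⟨?_, hq.2.mono fun i => Nat.div_le_self _ _⟩ hb hpos
  -- The states of the loop are restricted to numbers at most `q i`, to have them bounded.
  refine (PolyTime.iterate (σ := fun i => {r : ℕ // r ≤ q i}) (enc := fun i r => encodeNat r)
    (f := fun i r => ⟨r / b i, (Nat.div_le_self _ _).trans r.2⟩) (init := fun i => ⟨q i, le_refl _⟩)
    hm hq.1 (PolyNat.div (a := fun j : Σ i, {r : ℕ // r ≤ q i} => (j.2 : ℕ)) ⟨.top _, ?_⟩ hb.wk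
      fun j => hpos j.1).1).congr fun i => ?_
  · exact (hq.2.comp Sigma.fst).mono fun j => j.2.2
  · dsimp only
    congr 1
    induction m i with
    | zero => simp
    | succ m ih => rw [Function.iterate_succ_apply', pow_succ, ← Nat.div_div_eq_div_mul, ← ih]

/-! ### Families, sets, relations and matrices -/

theorem PolyTime.family {n : I → ℕ} {f : ∀ i, Fin (n i) → Val} (hn : PolyNat s c n)
    (h : PolyTime (fun j : Σ i, Fin (n i) => s j.1) (fun j => .cons (encodeNat j.2) (c j.1))
      (fun j => f j.1 j.2)) :
    PolyTime s c (fun i => encodeFamily (f i)) := by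
  refine (PolyTime.foldr (σ := fun _ => Val) (enc := fun _ => _root_.id)
    (f := fun i v acc => Val.cons (f i v) acc) (init := fun _ => .nil) hn .nil
    (.cons ?_ (.top₂ _ _))).congr fun i => ?_
  · exact (PolyTime.id.hd.cons PolyTime.id.tl.tl).trans
      (h.comp fun j : Σ i, Fin (n i) × Val => ⟨j.1, j.2.1⟩)
  · have : ∀ (m : ℕ) (g : Fin m → Val),
        Fin.foldr m (fun v acc => Val.cons (g v) acc) .nil = encodeFamily g := by
      intro m
      induction m with
      | zero => intro g; simp [encodeFamily, encodeList]
      | succ m ih =>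
        intro g
        rw [Fin.foldr_succ, ih]
        simp [encodeFamily, encodeList, List.ofFn_succ]
    exact this _ _

theorem encodeList_tl_iterate (l : List Val) (a : ℕ) :
    Val.tl^[a] (encodeList l) = encodeList (l.drop a) := by
  induction a generalizing l with
  | zero => rfl
  | succ a ih =>
    cases l with
    | nil => simpa [encodeList] using ih []
    | cons x l => simpa [encodeList] using ih l

theorem PolyTime.lookup {n : I → ℕ} {f : ∀ i, Fin (n i) → Val} {v : ∀ i, Fin (n i)}
    (hn : PolyBound s n) (hf : PolyTime s c (fun i => encodeFamily (f i)))
    (hv : PolyTime s c (fun i => encodeNat (v i))) : PolyTime s c (fun i => f i (v i)) :=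
  (PolyTime.iterate (σ := fun _ => Val) (enc := fun _ => _root_.id) (f := fun _ => Val.tl)
    (.fin hn hv) hf (PolyTime.top _).tl).hd.congr fun i => by
      dsimp only [_root_.id, encodeFamily]
      rw [encodeList_tl_iterate]
      rw [List.drop_eq_getElem_cons (by simp)]
      simp [encodeList]

theorem PolyTime.mem {n : I → ℕ} {S : ∀ i, Finset (Fin (n i))} {v : ∀ i, Fin (n i)}
    (hn : PolyBound s n) (hS : PolyTime s c (fun i => encodeSet (S i)))
    (hv : PolyTime s c (fun i => encodeNat (v i))) :
    PolyTime s c (fun i => encodeBit (v i ∈ S i)) :=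
  .lookup (f := fun i v => encodeBit (v ∈ S i)) hn hS hv

theorem PolyTime.set {n : I → ℕ} {S : ∀ i, Finset (Fin (n i))} (hn : PolyNat s c n)
    (h : PolyTime (fun j : Σ i, Fin (n i) => s j.1) (fun j => .cons (encodeNat j.2) (c j.1))
      (fun j => encodeBit (j.2 ∈ S j.1))) :
    PolyTime s c (fun i => encodeSet (S i)) :=
  .family hn h

theorem PolyNat.cardSet {n : I → ℕ} {S : ∀ i, Finset (Fin (n i))} (hn : PolyNat s c n)
    (hS : PolyTime s c (fun i => encodeSet (S i))) : PolyNat s c (fun i => (S i).card) :=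
  .card hn (.mem (hn.2.comp _) hS.wk (.top _))

/-- The adjacency matrix of a relation, with truth values as entries. -/
noncomputable def encodeRel {n : ℕ} (r : Fin n → Fin n → Prop) : Val :=
  encodeFamily fun u => encodeFamily fun v => encodeBit (r u v)

/-- A matrix of numbers in unary. -/
def encodeMatrix {n : ℕ} (w : Fin n → Fin n → ℕ) : Val :=
  encodeFamily fun u => encodeFamily fun v => encodeNat (w u v)

theorem PolyTime.relApply {n : I → ℕ} {r : ∀ i, Fin (n i) → Fin (n i) → Prop}
    {u v : ∀ i, Fin (n i)} (hn : PolyBound s n) (hr : PolyTime s c (fun i => encodeRel (r i)))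
    (hu : PolyTime s c (fun i => encodeNat (u i))) (hv : PolyTime s c (fun i => encodeNat (v i))) :
    PolyTime s c (fun i => encodeBit (r i (u i) (v i))) :=
  .lookup (f := fun i v => encodeBit (r i (u i) v)) hn
    (.lookup (f := fun i u => encodeFamily fun v => encodeBit (r i u v)) hn hr hu) hv

theorem PolyTime.matrixApply {n : I → ℕ} {w : ∀ i, Fin (n i) → Fin (n i) → ℕ}
    {u v : ∀ i, Fin (n i)} (hn : PolyBound s n) (hw : PolyTime s c (fun i => encodeMatrix (w i)))
    (hu : PolyTime s c (fun i => encodeNat (u i))) (hv : PolyTime s c (fun i => encodeNat (v i))) :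
    PolyTime s c (fun i => encodeNat (w i (u i) (v i))) :=
  .lookup (f := fun i v => encodeNat (w i (u i) v)) hn
    (.lookup (f := fun i u => encodeFamily fun v => encodeNat (w i u v)) hn hw hu) hv

theorem PolyTime.matrixOf {n : I → ℕ} {f : ∀ i, Fin (n i) → Fin (n i) → Val} (hn : PolyNat s c n)
    (h : PolyTime (fun j : Σ j : Σ i, Fin (n i), Fin (n j.1) => s j.1.1)
      (fun j => .cons (encodeNat j.2) (.cons (encodeNat j.1.2) (c j.1.1)))
      (fun j => f j.1.1 j.1.2 j.2)) :
    PolyTime s c (fun i => encodeFamily fun u => encodeFamily (f i u)) :=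
  .family (f := fun i u => encodeFamily (f i u)) hn
    (.family (f := fun (j : Σ i, Fin (n i)) v => f j.1 j.2 v) hn.wk h)

theorem PolyTime.rel {n : I → ℕ} {r : ∀ i, Fin (n i) → Fin (n i) → Prop} (hn : PolyNat s c n)
    (h : PolyTime (fun j : Σ j : Σ i, Fin (n i), Fin (n j.1) => s j.1.1)
      (fun j => .cons (encodeNat j.2) (.cons (encodeNat j.1.2) (c j.1.1)))
      (fun j => encodeBit (r j.1.1 j.1.2 j.2))) :
    PolyTime s c (fun i => encodeRel (r i)) :=
  .matrixOf (f := fun i u v => encodeBit (r i u v)) hn h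

theorem PolyTime.matrix {n : I → ℕ} {w : ∀ i, Fin (n i) → Fin (n i) → ℕ} (hn : PolyNat s c n)
    (h : PolyTime (fun j : Σ j : Σ i, Fin (n i), Fin (n j.1) => s j.1.1)
      (fun j => .cons (encodeNat j.2) (.cons (encodeNat j.1.2) (c j.1.1)))
      (fun j => encodeNat (w j.1.1 j.1.2 j.2))) :
    PolyTime s c (fun i => encodeMatrix (w i)) :=
  .matrixOf (f := fun i u v => encodeNat (w i u v)) hn h

end Library

/-! ### Reachability by layers -/

open Classical in
/-- The set `S` together with all elements related to an element of `S`. -/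
noncomputable def expand {n : ℕ} (r : Fin n → Fin n → Prop) (S : Finset (Fin n)) : Finset (Fin n) :=
  {x | x ∈ S ∨ ∃ y ∈ S, r x y}

/-- The elements from which `S` can be reached in at most `j` steps of the relation `r`. -/
noncomputable def layer {n : ℕ} (r : Fin n → Fin n → Prop) (S : Finset (Fin n)) (j : ℕ) :
    Finset (Fin n) :=
  (expand r)^[j] S

section Layer
variable {n : ℕ} {r : Fin n → Fin n → Prop} {S : Finset (Fin n)}

theorem mem_expand {x : Fin n} : x ∈ expand r S ↔ x ∈ S ∨ ∃ y ∈ S, r x y := by simp [expand]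

theorem subset_expand : S ⊆ expand r S := fun _ h => mem_expand.2 (.inl h)

theorem layer_succ (j : ℕ) : layer r S (j + 1) = expand r (layer r S j) :=
  Function.iterate_succ_apply' _ _ _

theorem layer_subset_succ (j : ℕ) : layer r S j ⊆ layer r S (j + 1) := by
  rw [layer_succ]; exact subset_expand

theorem subset_layer (j : ℕ) : S ⊆ layer r S j := by
  induction j with
  | zero => exact subset_rfl
  | succ j ih => exact ih.trans (layer_subset_succ j)

/-- As long as the layers are not stable, they grow by at least one element. -/
theorem expand_layer_self : expand r (layer r S n) = layer r S n := by
  have key : ∀ j, expand r (layer r S j) = layer r S j ∨ j ≤ (layer r S j).card := by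
    intro j
    induction j with
    | zero => right; omega
    | succ j ih =>
      by_cases h : expand r (layer r S j) = layer r S j
      · left; rw [layer_succ, h, h]
      · right
        have h1 := ih.resolve_left h
        have h2 := Finset.card_lt_card (Finset.ssubset_iff_subset_ne.2 ⟨subset_expand, Ne.symm h⟩)
        rw [layer_succ]; omega
  rcases key n with h | h
  · exact h
  · have : layer r S n = Finset.univ := by
      rw [← Finset.card_eq_iff_eq_univ]
      exact le_antisymm (Finset.card_le_univ _) (by simpa using h)
    rw [this]
    exact Finset.univ_subset_iff.1 subset_expand

theorem mem_layer {x : Fin n} : x ∈ layer r S n ↔ ∃ y ∈ S, Relation.ReflTransGen r x y := by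
  constructor
  · have : ∀ k x, x ∈ layer r S k → ∃ y ∈ S, Relation.ReflTransGen r x y := by
      intro k
      induction k with
      | zero => exact fun x hx => ⟨x, hx, .refl⟩
      | succ k ih =>
        intro x hx
        rw [layer_succ, mem_expand] at hx
        rcases hx with hx | ⟨y, hy, hxy⟩
        · exact ih x hx
        · obtain ⟨z, hz, hyz⟩ := ih y hy
          exact ⟨z, hz, .head hxy hyz⟩
    exact this n x
  · rintro ⟨y, hy, hxy⟩
    induction hxy using Relation.ReflTransGen.head_induction_on with
    | refl => exact subset_layer n hy
    | head h _ ih =>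
      rw [← expand_layer_self, mem_expand]
      exact .inr ⟨_, ih, h⟩

end Layer

open Classical in
/-- The set consisting of the least element of `S`, empty if `S` is. -/
noncomputable def least {n : ℕ} (S : Finset (Fin n)) : Finset (Fin n) := {x ∈ S | ∀ y ∈ S, ¬ y < x}

theorem least_empty {n : ℕ} : least (∅ : Finset (Fin n)) = ∅ := by simp [least]

theorem exists_least_eq {n : ℕ} {S : Finset (Fin n)} (h : S.Nonempty) :
    ∃ x ∈ S, least S = {x} := by
  refine ⟨S.min' h, S.min'_mem h, ?_⟩
  ext y
  simp only [least, Finset.mem_filter, Finset.mem_singleton, not_lt]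
  constructor
  · rintro ⟨hy, h'⟩
    exact le_antisymm (h' _ (S.min'_mem h)) (S.min'_le _ hy)
  · rintro rfl
    exact ⟨S.min'_mem h, fun z hz => S.min'_le _ hz⟩

/-! ### Minimum cuts by reversing paths -/

open Classical in
/-- The weight of the arcs that leave `R`. -/
noncomputable def cutWeight {m : ℕ} (w : Fin m → Fin m → ℕ) (R : Finset (Fin m)) : ℕ :=
  ∑ p : Fin m × Fin m, if p.1 ∈ R ∧ p.2 ∉ R then w p.1 p.2 else 0

/-- There is an arc of positive weight. -/
def Residual {m : ℕ} (w : Fin m → Fin m → ℕ) (x y : Fin m) : Prop := 0 < w x y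

open Classical in
/-- One unit of weight is turned around on every arc from `X` to `Y`. -/
noncomputable def reverseArc {m : ℕ} (w : Fin m → Fin m → ℕ) (X Y : Finset (Fin m)) (a b : Fin m) :
    ℕ :=
  if a ∈ X ∧ b ∈ Y then w a b - 1 else if a ∈ Y ∧ b ∈ X then w a b + 1 else w a b

open Classical in
/-- One step along a shortest path to `S` in the arcs of positive weight `w`.  The state consists
of the current vertex, as a singleton, and of the weights with the path so far reversed.  The step
for `j` leads into the layer `j`, unless the current vertex is already there. -/
noncomputable def augmentStep {m : ℕ} (w : Fin m → Fin m → ℕ) (S : Finset (Fin m)) (j : ℕ)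
    (q : Finset (Fin m) × (Fin m → Fin m → ℕ)) : Finset (Fin m) × (Fin m → Fin m → ℕ) :=
  if q.1 ⊆ layer (Residual w) S j then q else
    (least {y ∈ layer (Residual w) S j | ∃ x ∈ q.1, Residual w x y},
      reverseArc q.2 q.1 (least {y ∈ layer (Residual w) S j | ∃ x ∈ q.1, Residual w x y}))

/-- One unit of weight is turned around along a path from `A` to `S` in the arcs of positive
weight, if there is one. -/
noncomputable def augment {m : ℕ} (A S : Finset (Fin m)) (w : Fin m → Fin m → ℕ) :
    Fin m → Fin m → ℕ :=
  (Fin.foldr m (fun j q => augmentStep w S j q) (least (A ∩ layer (Residual w) S m), w)).2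

/-- The largest side of a minimum cut between `A` and `S`, provided that its weight is less than
`k`. -/
noncomputable def farCut {m : ℕ} (k : ℕ) (w : Fin m → Fin m → ℕ) (A S : Finset (Fin m)) :
    Finset (Fin m) :=
  (layer (Residual ((augment A S)^[k] w)) S m)ᶜ

/-- `R` contains the sources `A` and none of the sinks `S`. -/
def Separates {m : ℕ} (A S R : Finset (Fin m)) : Prop := A ⊆ R ∧ Disjoint R S

section Flow
variable {m : ℕ} {w : Fin m → Fin m → ℕ} {A S R : Finset (Fin m)}

theorem cutWeight_union_add_inter (w : Fin m → Fin m → ℕ) (R Q : Finset (Fin m)) :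
    cutWeight w (R ∪ Q) + cutWeight w (R ∩ Q) ≤ cutWeight w R + cutWeight w Q := by
  classical
  simp only [cutWeight, ← Finset.sum_add_distrib]
  refine Finset.sum_le_sum fun p _ => ?_
  by_cases h1 : p.1 ∈ R <;> by_cases h2 : p.2 ∈ R <;> by_cases h3 : p.1 ∈ Q <;>
    by_cases h4 : p.2 ∈ Q <;> simp [h1, h2, h3, h4]

open Classical in
theorem cutWeight_reverseArc {x y : Fin m} (hxy : x ≠ y) (hw : 0 < w x y) (R : Finset (Fin m)) :
    cutWeight (reverseArc w {x} {y}) R + (if x ∈ R then 1 else 0) =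
      cutWeight w R + (if y ∈ R then 1 else 0) := by
  have h : ∀ p : Fin m × Fin m,
      ((if p.1 ∈ R ∧ p.2 ∉ R then (reverseArc w {x} {y} p.1 p.2 : ℤ) else 0) =
        (if p.1 ∈ R ∧ p.2 ∉ R then (w p.1 p.2 : ℤ) else 0)
          - (if (x, y) = p then (if x ∈ R ∧ y ∉ R then 1 else 0) else 0)
          + (if (y, x) = p then (if y ∈ R ∧ x ∉ R then 1 else 0) else 0)) := by
    rintro ⟨a, b⟩
    simp only [reverseArc, Finset.mem_singleton, Prod.mk.injEq]
    by_cases h1 : x = a ∧ y = b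
    · obtain ⟨rfl, rfl⟩ := h1
      simp only [and_self, if_true, hxy.symm, false_and, if_false]
      split_ifs <;> simp
      omega
    · by_cases h2 : y = a ∧ x = b
      · obtain ⟨rfl, rfl⟩ := h2
        simp only [and_self, if_true, hxy.symm, hxy, if_false]
        split_ifs <;> simp
      · have h1' : ¬ (a = x ∧ b = y) := fun h => h1 ⟨h.1.symm, h.2.symm⟩
        have h2' : ¬ (a = y ∧ b = x) := fun h => h2 ⟨h.1.symm, h.2.symm⟩
        simp [h1, h2, h1', h2']
  have h' : (cutWeight (reverseArc w {x} {y}) R : ℤ) = cutWeight w R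
      - (if x ∈ R ∧ y ∉ R then 1 else 0) + (if y ∈ R ∧ x ∉ R then 1 else 0) := by
    simp only [cutWeight]
    push_cast
    rw [Finset.sum_congr rfl fun p _ => h p, Finset.sum_add_distrib, Finset.sum_sub_distrib]
    simp
  by_cases h1 : x ∈ R <;> by_cases h2 : y ∈ R <;> simp [h1, h2] at h' ⊢ <;> omega

open Classical in
/-- The invariant of the path reversal: the reversal changes the weight of a cut only through the
ends of the path. -/
theorem cutWeight_foldr_augmentStep (hR : Disjoint R S) (k : ℕ) (x : Fin m)
    (w' : Fin m → Fin m → ℕ) (hx : x ∈ layer (Residual w) S k)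
    (hw : ∀ a ∈ layer (Residual w) S k, ∀ b ∈ layer (Residual w) S k, w' a b = w a b) :
    cutWeight (Fin.foldr k (fun j q => augmentStep w S j q) ({x}, w')).2 R +
      (if x ∈ R then 1 else 0) = cutWeight w' R := by
  induction k generalizing x w' with
  | zero =>
    have : x ∉ R := fun h => Finset.disjoint_left.1 hR h hx
    simp [this]
  | succ k ih =>
    rw [Fin.foldr_succ_last]
    by_cases hk : x ∈ layer (Residual w) S k
    · have e : augmentStep w S (Fin.last k) ({x}, w') = ({x}, w') :=
        if_pos (by simpa using hk)
      rw [e]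
      exact ih x w' hk fun a ha b hb =>
        hw a (layer_subset_succ k ha) b (layer_subset_succ k hb)
    · have hx' := hx
      rw [layer_succ, mem_expand] at hx'
      obtain ⟨z, hz, hxz⟩ := hx'.resolve_left hk
      obtain ⟨y, hy, hyl⟩ := exists_least_eq
        (S := {y ∈ layer (Residual w) S k | ∃ x' ∈ ({x} : Finset (Fin m)), Residual w x' y})
        ⟨z, by simpa using ⟨hz, hxz⟩⟩
      simp only [Finset.mem_filter, Finset.mem_singleton, exists_eq_left] at hy
      have e : augmentStep w S (Fin.last k) ({x}, w') = ({y}, reverseArc w' {x} {y}) := by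
        rw [augmentStep, if_neg (by simpa using hk)]
        simp only [Fin.val_last]
        rw [hyl]
      have hxy : x ≠ y := fun h => hk (h ▸ hy.1)
      have hpos : 0 < w' x y := by
        rw [hw x hx y (layer_subset_succ k hy.1)]; exact hy.2
      rw [e]
      have h1 := ih y (reverseArc w' {x} {y}) hy.1 fun a ha b hb => by
        have ha' : a ≠ x := fun h => hk (h ▸ ha)
        have hb' : b ≠ x := fun h => hk (h ▸ hb)
        simp only [reverseArc, Finset.mem_singleton, ha', hb', false_and, and_false, if_false]
        exact hw a (layer_subset_succ k ha) b (layer_subset_succ k hb)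
      have h2 := cutWeight_reverseArc hxy hpos R
      simp only [Fin.val_castSucc] at h1 ⊢
      omega

theorem cutWeight_augment (h : ¬ Disjoint A (layer (Residual w) S m)) (hR : Separates A S R) :
    cutWeight (augment A S w) R + 1 = cutWeight w R := by
  classical
  rw [Finset.disjoint_iff_inter_eq_empty, ← ne_eq, ← Finset.nonempty_iff_ne_empty] at h
  obtain ⟨x, hx, he⟩ := exists_least_eq h
  rw [Finset.mem_inter] at hx
  have := cutWeight_foldr_augmentStep hR.2 m x w hx.2 fun _ _ _ _ => rfl
  rw [if_pos (hR.1 hx.1)] at this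
  rw [augment, he, this]

theorem augment_of_disjoint (h : Disjoint A (layer (Residual w) S m)) : augment A S w = w := by
  have key : ∀ k, Fin.foldr k (fun j q => augmentStep w S j q) (∅, w) = (∅, w) := by
    intro k
    induction k with
    | zero => simp
    | succ k ih =>
      rw [Fin.foldr_succ_last]
      have e : augmentStep w S (Fin.last k) (∅, w) = (∅, w) := if_pos (by simp)
      rw [e]
      exact ih
  rw [augment, Finset.disjoint_iff_inter_eq_empty.1 h, least_empty, key]

/-- Every reversal lowers the weights of all separating cuts by one, until no path is left. -/
theorem cutWeight_iterate_augment (k : ℕ) :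
    ∃ c, (∀ R, Separates A S R → cutWeight ((augment A S)^[k] w) R + c = cutWeight w R) ∧
      (c = k ∨ Disjoint A (layer (Residual ((augment A S)^[k] w)) S m)) := by
  induction k with
  | zero => exact ⟨0, fun R _ => rfl, .inl rfl⟩
  | succ k ih =>
    obtain ⟨c, hc, hc'⟩ := ih
    rw [Function.iterate_succ_apply']
    by_cases hd : Disjoint A (layer (Residual ((augment A S)^[k] w)) S m)
    · rw [augment_of_disjoint hd]
      exact ⟨c, hc, .inr hd⟩
    · refine ⟨c + 1, fun R hR => ?_, .inl ?_⟩
      · have := cutWeight_augment hd hR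
        have := hc R hR
        omega
      · rw [hc'.resolve_right hd]

theorem cutWeight_eq_zero : cutWeight w R = 0 ↔ ∀ x ∈ R, ∀ y, y ∉ R → w x y = 0 := by
  simp only [cutWeight, Finset.sum_eq_zero_iff, Finset.mem_univ, true_implies, Prod.forall,
    ite_eq_right_iff, and_imp]
  exact ⟨fun h x hx y hy => h x y hx hy, fun h x y hx hy => h x hx y hy⟩

/-- If some cut has weight less than `k`, then `farCut` is a minimum cut, and it is the largest
one. -/
theorem farCut_spec {k : ℕ} {R₀ : Finset (Fin m)} (h₀ : Separates A S R₀)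
    (hk : cutWeight w R₀ < k) :
    Separates A S (farCut k w A S) ∧
      (∀ R, Separates A S R → cutWeight w (farCut k w A S) ≤ cutWeight w R) ∧
      ∀ R, Separates A S R → cutWeight w R ≤ cutWeight w (farCut k w A S) →
        R ⊆ farCut k w A S := by
  obtain ⟨c, hc, hc'⟩ := cutWeight_iterate_augment (w := w) (A := A) (S := S) k
  set w' := (augment A S)^[k] w with hw'
  have hd : Disjoint A (layer (Residual w') S m) := hc'.resolve_left fun h => by
    have := hc R₀ h₀
    omega
  have hsep : Separates A S (farCut k w A S) := by
    refine ⟨fun x hx => Finset.mem_compl.2 (Finset.disjoint_left.1 hd hx), ?_⟩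
    exact Finset.disjoint_left.2 fun x hx hxS => Finset.mem_compl.1 hx (subset_layer m hxS)
  have hzero : cutWeight w' (farCut k w A S) = 0 := by
    rw [cutWeight_eq_zero]
    intro x hx y hy
    by_contra hxy
    refine Finset.mem_compl.1 hx ?_
    rw [← hw', ← expand_layer_self, mem_expand]
    exact .inr ⟨y, by simpa [farCut] using hy, Nat.pos_of_ne_zero hxy⟩
  refine ⟨hsep, fun R hR => ?_, fun R hR hle x hx => ?_⟩
  · have := hc R hR
    have := hc _ hsep
    omega
  · have hR0 : cutWeight w' R = 0 := by
      have := hc R hR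
      have := hc _ hsep
      omega
    rw [cutWeight_eq_zero] at hR0
    refine Finset.mem_compl.2 fun hxl => ?_
    rw [← hw', mem_layer] at hxl
    obtain ⟨y, hy, hxy⟩ := hxl
    refine Finset.disjoint_left.1 hR.2 ?_ hy
    clear hy
    induction hxy with
    | refl => exact hx
    | tail _ h ih =>
      by_contra hn
      exact absurd (hR0 _ ih _ hn) (Nat.pos_iff_ne_zero.1 h)

end Flow

/-! ### Balanced separators -/

/-- The arcs of the digraph with the vertices in `Z` deleted. -/
def Avoiding {n : ℕ} (E : Fin n → Fin n → Prop) (Z : Finset (Fin n)) (a b : Fin n) : Prop :=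
  E a b ∧ a ∉ Z ∧ b ∉ Z

/-- There is a directed path from `u` to `v` that avoids `Z`; the trivial path is allowed also if
`u = v` lies in `Z`. -/
def Path {n : ℕ} (E : Fin n → Fin n → Prop) (Z : Finset (Fin n)) : Fin n → Fin n → Prop :=
  Relation.ReflTransGen (Avoiding E Z)

open Classical in
/-- The vertex set of the strong component of `u` after the deletion of `Z`, provided `u ∉ Z`. -/
noncomputable def component {n : ℕ} (E : Fin n → Fin n → Prop) (Z : Finset (Fin n)) (u : Fin n) :
    Finset (Fin n) :=
  {v | Path E Z u v ∧ Path E Z v u}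

/-- `Z` has less than `k` elements, and its deletion leaves no strong component with more than half
of the vertices in `T`. -/
def Balanced {n : ℕ} (E : Fin n → Fin n → Prop) (k : ℕ) (T Z : Finset (Fin n)) : Prop :=
  Z.card < k ∧ ∀ u, u ∉ Z → 2 * (T ∩ component E Z u).card ≤ T.card

section Balanced
variable {n : ℕ} {E : Fin n → Fin n → Prop} {k : ℕ} {T U Z A B C : Finset (Fin n)} {u v x : Fin n}

theorem mem_component : v ∈ component E Z u ↔ Path E Z u v ∧ Path E Z v u := by simp [component]

theorem Path.notMem (h : Path E Z u v) (hu : u ∉ Z) : v ∉ Z := by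
  induction h with
  | refl => exact hu
  | tail _ h _ => exact h.2.2

theorem Path.mono {Z' : Finset (Fin n)} (hZ : Z' ⊆ Z) (h : Path E Z u v) : Path E Z' u v :=
  Relation.ReflTransGen.mono
    (fun _ _ h => ⟨h.1, fun h' => h.2.1 (hZ h'), fun h' => h.2.2 (hZ h')⟩) _ _ h

/-- In the topological order of the strong components of `D ∖ Z`, the sets `C`, `B`, `A` collect the
vertices of `T` in an end segment, in the component next to it, and in the rest: if `C` is the
longest end segment with at most half of `T`, then `A` has at most half of `T` as well. -/
theorem exists_tripartition (h : Balanced E k T Z) :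
    ∃ A B C : Finset (Fin n), A ∪ B ∪ C = T \ Z ∧
      2 * A.card ≤ T.card ∧ 2 * B.card ≤ T.card ∧ 2 * C.card ≤ T.card ∧
      (∀ c ∈ C, ∀ x ∈ A ∪ B, ¬ Path E Z c x) ∧ ∀ b ∈ B, ∀ a ∈ A, ¬ Path E Z b a := by
  classical
  let closed : Finset (Fin n) → Prop := fun C => ∀ c ∈ C, ∀ x ∈ T \ Z, Path E Z c x → x ∈ C
  obtain ⟨C, hC, hmax⟩ := Finset.exists_max_image
    ((T \ Z).powerset.filter fun C => closed C ∧ 2 * C.card ≤ T.card) Finset.card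
    ⟨∅, by simp [closed]⟩
  simp only [Finset.mem_filter, Finset.mem_powerset] at hC hmax
  obtain ⟨hCT, hcl, hCc⟩ := hC
  by_cases hall : C = T \ Z
  · exact ⟨∅, ∅, C, by simpa using hall, by simp, by simp, hCc, by simp, by simp⟩
  -- A vertex from which as few others as possible are reached: its component `K` comes next to `C`.
  obtain ⟨x, hx, hmin⟩ := Finset.exists_min_image ((T \ Z) \ C)
    (fun x => (((T \ Z) \ C).filter fun y => Path E Z x y).card)
    (by rw [Finset.sdiff_nonempty]; exact fun h => hall (hCT.antisymm h))
  rw [Finset.mem_sdiff] at hx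
  set K := (T \ Z).filter fun y => Path E Z x y ∧ Path E Z y x with hK
  have hxK : x ∈ K := Finset.mem_filter.2 ⟨hx.1, .refl, .refl⟩
  have hKT : K ⊆ T \ Z := Finset.filter_subset _ _
  have hCK : closed (C ∪ K) := by
    intro c hc z hz hcz
    by_cases hzC : z ∈ C
    · exact Finset.mem_union_left _ hzC
    rcases Finset.mem_union.1 hc with hc | hc
    · exact absurd (hcl c hc z hz hcz) hzC
    refine Finset.mem_union_right _ (Finset.mem_filter.2 ⟨hz, ?_⟩)
    have hxz : Path E Z x z := (Finset.mem_filter.1 hc).2.1.trans hcz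
    refine ⟨hxz, ?_⟩
    have hsub : (((T \ Z) \ C).filter fun y => Path E Z z y) ⊆
        (((T \ Z) \ C).filter fun y => Path E Z x y) := fun y hy => by
      rw [Finset.mem_filter] at hy ⊢
      exact ⟨hy.1, hxz.trans hy.2⟩
    have heq := Finset.eq_of_subset_of_card_le hsub
      (hmin z (Finset.mem_sdiff.2 ⟨hz, hzC⟩))
    have : x ∈ (((T \ Z) \ C).filter fun y => Path E Z x y) :=
      Finset.mem_filter.2 ⟨Finset.mem_sdiff.2 hx, .refl⟩
    rw [← heq] at this
    exact (Finset.mem_filter.1 this).2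
  have hbig : T.card < 2 * (C ∪ K).card := by
    by_contra hle
    have h1 := hmax (C ∪ K) ⟨Finset.union_subset hCT hKT, hCK, by omega⟩
    have h2 : C.card < (C ∪ K).card := Finset.card_lt_card (Finset.ssubset_iff_subset_ne.2
      ⟨Finset.subset_union_left, fun h => hx.2 (h ▸ Finset.mem_union_right _ hxK)⟩)
    omega
  refine ⟨(T \ Z) \ (C ∪ K), K, C, ?_, ?_, ?_, hCc, ?_, ?_⟩
  · ext y
    have := @hKT y
    have := @hCT y
    simp only [Finset.mem_union, Finset.mem_sdiff] at *
    tauto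
  · have h1 := Finset.card_sdiff_add_card_eq_card (Finset.union_subset hCT hKT)
    have h2 := Finset.card_le_card (Finset.sdiff_subset : T \ Z ⊆ T)
    omega
  · refine le_trans (Nat.mul_le_mul_left 2 (Finset.card_le_card fun y hy => ?_))
      (h.2 x (Finset.mem_sdiff.1 hx.1).2)
    rw [hK, Finset.mem_filter, Finset.mem_sdiff] at hy
    exact Finset.mem_inter.2 ⟨hy.1.1, mem_component.2 hy.2⟩
  · intro c hc y hy hcy
    rcases Finset.mem_union.1 hy with hy | hy
    · rw [Finset.mem_sdiff] at hy
      exact hy.2 (Finset.mem_union_left _ (hcl c hc y hy.1 hcy))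
    · exact hx.2 (hcl c hc x hx.1 (hcy.trans (Finset.mem_filter.1 hy).2.2))
  · intro b hb a ha hba
    rw [Finset.mem_sdiff] at ha
    exact ha.2 (hCK b (Finset.mem_union_right _ hb) a ha.1 hba)

/-- Conversely, a set that separates three such parts from one another is balanced. -/
theorem balanced_of_tripartition (hZ : Z.card < k) (hT : T ⊆ Z ∪ A ∪ B ∪ C)
    (hA : 2 * A.card ≤ T.card) (hB : 2 * B.card ≤ T.card) (hC : 2 * C.card ≤ T.card)
    (h1 : ∀ c ∈ C, ∀ x ∈ A ∪ B, ¬ Path E Z c x) (h2 : ∀ b ∈ B, ∀ a ∈ A, ¬ Path E Z b a) :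
    Balanced E k T Z := by
  refine ⟨hZ, fun u hu => ?_⟩
  have hmem : ∀ x ∈ T ∩ component E Z u, x ∈ A ∨ x ∈ B ∨ x ∈ C := by
    intro x hx
    rw [Finset.mem_inter, mem_component] at hx
    have := hx.2.1.notMem hu
    have := hT hx.1
    simp only [Finset.mem_union] at this
    tauto
  have hpath : ∀ x ∈ T ∩ component E Z u, ∀ y ∈ T ∩ component E Z u, Path E Z x y := by
    intro x hx y hy
    rw [Finset.mem_inter, mem_component] at hx hy
    exact hx.2.2.trans hy.2.1
  have key : T ∩ component E Z u ⊆ A ∨ T ∩ component E Z u ⊆ B ∨ T ∩ component E Z u ⊆ C := by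
    by_cases hc : ∃ x ∈ T ∩ component E Z u, x ∈ C
    · obtain ⟨x, hx, hxC⟩ := hc
      refine .inr (.inr fun y hy => ?_)
      rcases hmem y hy with h | h | h
      · exact absurd (hpath x hx y hy) (h1 x hxC y (Finset.mem_union_left _ h))
      · exact absurd (hpath x hx y hy) (h1 x hxC y (Finset.mem_union_right _ h))
      · exact h
    push Not at hc
    by_cases hb : ∃ x ∈ T ∩ component E Z u, x ∈ B
    · obtain ⟨x, hx, hxB⟩ := hb
      refine .inr (.inl fun y hy => ?_)
      rcases hmem y hy with h | h | h
      · exact absurd (hpath x hx y hy) (h2 x hxB y h)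
      · exact h
      · exact absurd h (hc y hy)
    push Not at hb
    refine .inl fun y hy => ?_
    rcases hmem y hy with h | h | h
    · exact h
    · exact absurd h (hb y hy)
    · exact absurd h (hc y hy)
  rcases key with h | h | h <;> have := Finset.card_le_card h <;> omega

end Balanced

/-! ### Vertex separators as cuts -/

open Classical in
/-- Each vertex `v` is split into `castAdd n v`, where all arcs enter, and `natAdd n v`, where all
arcs leave.  The arc between the two halves has weight `1`, or `0` if `v` belongs to the deleted set
`U`; the other arcs have weight `k` and are not used by cuts of weight less than `k`. -/
noncomputable def splitWeight {n : ℕ} (E : Fin n → Fin n → Prop) (k : ℕ) (U : Finset (Fin n))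
    (x y : Fin (n + n)) : ℕ :=
  if ∃ v, v ∉ U ∧ x = Fin.castAdd n v ∧ y = Fin.natAdd n v then 1
  else if ∃ u v, E u v ∧ x = Fin.natAdd n u ∧ y = Fin.castAdd n v then k else 0

open Classical in
/-- The vertices whose halves are separated by `R`. -/
noncomputable def crossing {n : ℕ} (U : Finset (Fin n)) (R : Finset (Fin (n + n))) :
    Finset (Fin n) :=
  {v | v ∉ U ∧ Fin.castAdd n v ∈ R ∧ Fin.natAdd n v ∉ R}

open Classical in
/-- The halves of the vertices in `C` where arcs leave. -/
noncomputable def sources {n : ℕ} (C : Finset (Fin n)) : Finset (Fin (n + n)) :=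
  {x | ∃ v ∈ C, x = Fin.natAdd n v}

open Classical in
/-- The halves of the vertices in `S` where arcs enter. -/
noncomputable def sinks {n : ℕ} (S : Finset (Fin n)) : Finset (Fin (n + n)) :=
  {x | ∃ v ∈ S, x = Fin.castAdd n v}

/-- No arc of the digraph leaves `R`, except arcs between the halves of a vertex. -/
def ArcClosed {n : ℕ} (E : Fin n → Fin n → Prop) (R : Finset (Fin (n + n))) : Prop :=
  ∀ u v, E u v → Fin.natAdd n u ∈ R → Fin.castAdd n v ∈ R

section Split
variable {n : ℕ} {E : Fin n → Fin n → Prop} {k : ℕ} {T U Z A B C S : Finset (Fin n)}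
  {R : Finset (Fin (n + n))} {u v x : Fin n}

theorem castAdd_ne_natAdd (u v : Fin n) : Fin.castAdd n u ≠ Fin.natAdd n v := fun h => by
  have := congrArg Fin.val h
  simp at this
  omega

theorem mem_crossing : v ∈ crossing U R ↔ v ∉ U ∧ Fin.castAdd n v ∈ R ∧ Fin.natAdd n v ∉ R := by
  simp [crossing]

theorem separates_iff : Separates (sources C) (sinks S) R ↔
    (∀ v ∈ C, Fin.natAdd n v ∈ R) ∧ ∀ v ∈ S, Fin.castAdd n v ∉ R := by
  constructor
  · exact fun h => ⟨fun v hv => h.1 (by simpa [sources] using hv), fun v hv hR =>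
      Finset.disjoint_left.1 h.2 hR (by simpa [sinks] using hv)⟩
  · refine fun h => ⟨fun x hx => ?_, Finset.disjoint_left.2 fun x hx hx' => ?_⟩
    · simp only [sources, Finset.mem_filter, Finset.mem_univ, true_and] at hx
      obtain ⟨v, hv, rfl⟩ := hx
      exact h.1 v hv
    · simp only [sinks, Finset.mem_filter, Finset.mem_univ, true_and] at hx'
      obtain ⟨v, hv, rfl⟩ := hx'
      exact h.2 v hv hx

theorem arcClosed_of_cutWeight_lt (h : cutWeight (splitWeight E k U) R < k) : ArcClosed E R := by
  classical
  intro u v huv hu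
  by_contra hv
  have h1 := Finset.single_le_sum
    (f := fun p : Fin (n + n) × Fin (n + n) =>
      if p.1 ∈ R ∧ p.2 ∉ R then splitWeight E k U p.1 p.2 else 0)
    (fun _ _ => Nat.zero_le _) (Finset.mem_univ (Fin.natAdd n u, Fin.castAdd n v))
  have h2 : splitWeight E k U (Fin.natAdd n u) (Fin.castAdd n v) = k := by
    rw [splitWeight, if_neg, if_pos ⟨u, v, huv, rfl, rfl⟩]
    rintro ⟨z, _, h, _⟩
    exact castAdd_ne_natAdd _ _ h.symm
  simp only [hu, hv, not_false_eq_true, and_self, if_true, h2] at h1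
  rw [cutWeight] at h
  omega

theorem cutWeight_eq_card (h : ArcClosed E R) :
    cutWeight (splitWeight E k U) R = (crossing U R).card := by
  classical
  set I := (crossing U R).image fun v => (Fin.castAdd n v, Fin.natAdd n v) with hI
  have hcard : (crossing U R).card = I.card := by
    rw [Finset.card_image_of_injective]
    intro u v huv
    simpa using (Prod.mk.inj huv).1
  have hsum : cutWeight (splitWeight E k U) R = ∑ p, if p ∈ I then 1 else 0 := by
    refine Finset.sum_congr rfl fun p _ => ?_
    by_cases hp : p ∈ I
    · rw [if_pos hp]
      obtain ⟨v, hv, rfl⟩ := Finset.mem_image.1 hp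
      rw [mem_crossing] at hv
      rw [if_pos hv.2, splitWeight, if_pos ⟨v, hv.1, rfl, rfl⟩]
    · rw [if_neg hp]
      by_cases hpR : p.1 ∈ R ∧ p.2 ∉ R
      · rw [if_pos hpR, splitWeight, if_neg, if_neg]
        · rintro ⟨u, v, huv, h1, h2⟩
          rw [h1, h2] at hpR
          exact hpR.2 (h u v huv hpR.1)
        · rintro ⟨v, hv, h1, h2⟩
          rw [h1, h2] at hpR
          exact hp (Finset.mem_image.2 ⟨v, mem_crossing.2 ⟨hv, hpR⟩, Prod.ext h1.symm h2.symm⟩)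
      · rw [if_neg hpR]
  rw [hcard, hsum]
  simp

/-- A separating set of vertices gives rise to a cut. -/
theorem exists_cut (hC : Disjoint C Z) (hS : Disjoint S Z)
    (h : ∀ c ∈ C, ∀ x ∈ S, ¬ Path E Z c x) :
    ∃ R, Separates (sources C) (sinks S) R ∧ ArcClosed E R ∧ crossing U R ⊆ Z := by
  classical
  have hZ : ∀ x, (∃ c ∈ C, Path E Z c x) → x ∉ Z := fun x ⟨c, hc, hcx⟩ =>
    hcx.notMem (Finset.disjoint_left.1 hC hc)
  have hstep : ∀ x y, (∃ c ∈ C, Path E Z c x) → E x y → y ∉ Z → ∃ c ∈ C, Path E Z c y :=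
    fun x y hx hxy hy => by
      have hxZ := hZ x hx
      obtain ⟨c, hc, hcx⟩ := hx
      exact ⟨c, hc, hcx.tail ⟨hxy, hxZ, hy⟩⟩
  set R : Finset (Fin (n + n)) := Finset.univ.filter fun z =>
    (∃ x, (∃ c ∈ C, Path E Z c x) ∧ z = Fin.natAdd n x) ∨
    (∃ x y, (∃ c ∈ C, Path E Z c x) ∧ E x y ∧ z = Fin.castAdd n y) with hR
  have hout : ∀ x, Fin.natAdd n x ∈ R ↔ ∃ c ∈ C, Path E Z c x := by
    intro x
    simp only [hR, Finset.mem_filter, Finset.mem_univ, true_and]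
    constructor
    · rintro (⟨y, hy, hxy⟩ | ⟨y, z, _, _, h⟩)
      · rwa [(Fin.natAdd_inj n).1 hxy]
      · exact absurd h.symm (castAdd_ne_natAdd _ _)
    · exact fun h => .inl ⟨x, h, rfl⟩
  have hin : ∀ y, Fin.castAdd n y ∈ R ↔ ∃ x, (∃ c ∈ C, Path E Z c x) ∧ E x y := by
    intro y
    simp only [hR, Finset.mem_filter, Finset.mem_univ, true_and]
    constructor
    · rintro (⟨z, _, h⟩ | ⟨x, z, hx, hxz, h⟩)
      · exact absurd h (castAdd_ne_natAdd _ _)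
      · rw [Fin.castAdd_inj.1 h]
        exact ⟨x, hx, hxz⟩
    · exact fun ⟨x, hx, hxy⟩ => .inr ⟨x, y, hx, hxy, rfl⟩
  refine ⟨R, separates_iff.2 ⟨fun c hc => (hout c).2 ⟨c, hc, .refl⟩, fun s hs hsR => ?_⟩,
    fun u v huv hu => (hin v).2 ⟨u, (hout u).1 hu, huv⟩, fun v hv => ?_⟩
  · obtain ⟨x, hx, hxs⟩ := (hin s).1 hsR
    obtain ⟨c, hc, hcs⟩ := hstep x s hx hxs (Finset.disjoint_left.1 hS hs)
    exact h c hc s hs hcs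
  · obtain ⟨_, h1, h2⟩ := mem_crossing.1 hv
    obtain ⟨x, hx, hxv⟩ := (hin v).1 h1
    by_contra hvZ
    exact h2 ((hout v).2 (hstep x v hx hxv hvZ))

/-- A path that starts in a closed set `R` and avoids its crossing vertices stays in `R`. -/
theorem Path.mem_of_arcClosed (hR : ArcClosed E R) (hU : U ⊆ Z) (hZ : crossing U R ⊆ Z)
    (hu : Fin.natAdd n u ∈ R) (h : Path E Z u v) :
    Fin.natAdd n v ∈ R ∧ (v = u ∨ Fin.castAdd n v ∈ R) := by
  induction h with
  | refl => exact ⟨hu, .inl rfl⟩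
  | tail _ h ih =>
    have h1 := hR _ _ h.1 ih.1
    refine ⟨?_, .inr h1⟩
    by_contra h2
    exact h.2.2 (hZ (mem_crossing.2 ⟨fun h' => h.2.2 (hU h'), h1, h2⟩))

theorem not_path_of_cut (hCS : Disjoint C S) (hsep : Separates (sources C) (sinks S) R)
    (hR : ArcClosed E R) (hU : U ⊆ Z) (hZ : crossing U R ⊆ Z) :
    ∀ c ∈ C, ∀ x ∈ S, ¬ Path E Z c x := by
  rw [separates_iff] at hsep
  intro c hc x hx hcx
  rcases (hcx.mem_of_arcClosed hR hU hZ (hsep.1 c hc)).2 with rfl | h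
  · exact Finset.disjoint_left.1 hCS hc hx
  · exact hsep.2 x hx h

end Split

/-! ### Enumeration of separators -/

open Classical in
/-- The number of elements of `S` below `v`. -/
noncomputable def rank {n : ℕ} (S : Finset (Fin n)) (v : Fin n) : ℕ := {u ∈ S | u < v}.card

open Classical in
/-- The far minimum cut between the sinks and the set `R` enlarged by the crossing vertex of
rank `a`; if there is no such vertex, `R` is not enlarged. -/
noncomputable def pushStep {n : ℕ} (E : Fin n → Fin n → Prop) (k : ℕ) (U S : Finset (Fin n))
    (a : ℕ) (R : Finset (Fin (n + n))) : Finset (Fin (n + n)) :=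
  farCut k (splitWeight E k U) (R ∪ sources {v ∈ crossing U R | rank (crossing U R) v = a})
    (sinks S)

/-- The cut that arises from the far minimum cut by `j` pushes, guided by the word `g`. -/
noncomputable def pushes {n : ℕ} (E : Fin n → Fin n → Prop) (k : ℕ) (U C S : Finset (Fin n))
    (g : ℕ → ℕ) (j : ℕ) : Finset (Fin (n + n)) :=
  Fin.foldr j (fun a R => pushStep E k U S (g a) R)
    (farCut k (splitWeight E k U) (sources C) (sinks S))

/-- `Z` contains `U`, has less than `k` elements, avoids the other three sets, and cuts all paths
from `C` to `A ∪ B` and from `B` to `A`. -/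
structure IsSkewSeparator {n : ℕ} (E : Fin n → Fin n → Prop) (k : ℕ) (U A B C Z : Finset (Fin n)) :
    Prop where
  subset : U ⊆ Z
  card_lt : Z.card < k
  disjointA : Disjoint A Z
  disjointB : Disjoint B Z
  disjointC : Disjoint C Z
  not_path : ∀ c ∈ C, ∀ x ∈ A ∪ B, ¬ Path E Z c x
  not_path' : ∀ b ∈ B, ∀ a ∈ A, ¬ Path E Z b a

/-- `R` is a cut between `C` and `A ∪ B` that uses only vertices of the separator `Z`. -/
structure IsSkewCut {n : ℕ} (E : Fin n → Fin n → Prop) (k : ℕ) (U A B C : Finset (Fin n))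
    (R : Finset (Fin (n + n))) (Z : Finset (Fin n)) : Prop extends
    IsSkewSeparator E k U A B C Z where
  separates : Separates (sources C) (sinks (A ∪ B)) R
  arcClosed : ArcClosed E R
  crossing_subset : crossing U R ⊆ Z

section Enumeration
variable {n : ℕ} {E : Fin n → Fin n → Prop} {k : ℕ} {T U Z A B C S : Finset (Fin n)}
  {R Q : Finset (Fin (n + n))} {u v x : Fin n}

theorem rank_lt_card (hv : v ∈ S) : rank S v < S.card := by
  classical
  exact Finset.card_lt_card (Finset.ssubset_iff_subset_ne.2 ⟨Finset.filter_subset _ _, fun h => by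
    rw [← h] at hv
    simp at hv⟩)

theorem rank_lt_rank (hu : u ∈ S) (h : u < v) : rank S u < rank S v := by
  classical
  refine Finset.card_lt_card (Finset.ssubset_iff_subset_ne.2 ⟨fun x hx => ?_, fun h' => ?_⟩)
  · rw [Finset.mem_filter] at hx ⊢
    exact ⟨hx.1, hx.2.trans h⟩
  · have : u ∈ ({u ∈ S | u < v} : Finset (Fin n)) := Finset.mem_filter.2 ⟨hu, h⟩
    rw [← h'] at this
    simp at this

theorem rank_inj (hu : u ∈ S) (hv : v ∈ S) (h : rank S u = rank S v) : u = v := by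
  rcases lt_trichotomy u v with h' | h' | h'
  · exact absurd h (rank_lt_rank hu h').ne
  · exact h'
  · exact absurd h (rank_lt_rank hv h').ne'

theorem IsSkewSeparator.disjoint_left (h : IsSkewSeparator E k U A B C Z) :
    Disjoint C (A ∪ B) :=
  Finset.disjoint_left.2 fun x hx hx' => h.not_path x hx x hx' .refl

/-- Pushing a cut away from its source: if a cut is replaced by a larger one that is not heavier,
then the separator can be changed accordingly.  A path from `B` to `A` that has become possible
would run through a crossing vertex of the old cut into the larger set, and could not leave it. -/
theorem IsSkewCut.push (h : IsSkewCut E k U A B C R Z) (hRQ : R ⊆ Q)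
    (hQ : Separates (sources C) (sinks (A ∪ B)) Q)
    (hw : cutWeight (splitWeight E k U) Q ≤ cutWeight (splitWeight E k U) R) :
    ∃ Z', IsSkewCut E k U A B C Q Z' := by
  classical
  have hRc := cutWeight_eq_card (k := k) (U := U) h.arcClosed
  have hRZ := Finset.card_le_card h.crossing_subset
  have hlt := h.card_lt
  have hQa : ArcClosed E Q := arcClosed_of_cutWeight_lt (k := k) (U := U) (by omega)
  have hQc := cutWeight_eq_card (k := k) (U := U) hQa
  have hQ' := separates_iff.1 hQ
  have hUsub : U ⊆ (Z \ crossing U R) ∪ crossing U Q := fun v hv =>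
    Finset.mem_union_left _ (Finset.mem_sdiff.2 ⟨h.subset hv, fun h' => (mem_crossing.1 h').1 hv⟩)
  have hdisj : ∀ X : Finset (Fin n), X ⊆ A ∪ B ∪ C → Disjoint X Z →
      Disjoint X ((Z \ crossing U R) ∪ crossing U Q) := by
    intro X hX hXZ
    refine Finset.disjoint_left.2 fun v hv hv' => ?_
    rcases Finset.mem_union.1 hv' with hv' | hv'
    · exact Finset.disjoint_left.1 hXZ hv (Finset.mem_sdiff.1 hv').1
    · obtain ⟨_, h1, h2⟩ := mem_crossing.1 hv'
      rcases Finset.mem_union.1 (hX hv) with hv | hv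
      · exact hQ'.2 v hv h1
      · exact h2 (hQ'.1 v hv)
  refine ⟨(Z \ crossing U R) ∪ crossing U Q, ⟨⟨hUsub, ?_, ?_, ?_, ?_, ?_, ?_⟩, hQ, hQa,
    Finset.subset_union_right⟩⟩
  · have h1 := Finset.card_union_le (Z \ crossing U R) (crossing U Q)
    have h2 := Finset.card_sdiff_add_card_eq_card h.crossing_subset
    omega
  · exact hdisj A (fun _ h => by simp [h]) h.disjointA
  · exact hdisj B (fun _ h => by simp [h]) h.disjointB
  · exact hdisj C (fun _ h => by simp [h]) h.disjointC
  · exact not_path_of_cut h.disjoint_left hQ hQa hUsub Finset.subset_union_right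
  · intro b hb a ha hba
    have key : ∀ x, Path E ((Z \ crossing U R) ∪ crossing U Q) b x →
        (Path E Z b x ∧ x ∉ Z) ∨ (Fin.natAdd n x ∈ Q ∧ Fin.castAdd n x ∈ Q) := by
      intro x hx
      induction hx with
      | refl => exact .inl ⟨.refl, Finset.disjoint_left.1 h.disjointB hb⟩
      | @tail x y _ hxy ih =>
        obtain ⟨hxy, -, hy⟩ := hxy
        have hyU : y ∉ U := fun h' => hy (hUsub h')
        have hyQ : Fin.castAdd n y ∈ Q → Fin.natAdd n y ∈ Q := fun h1 => by
          by_contra h2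
          exact hy (Finset.mem_union_right _ (mem_crossing.2 ⟨hyU, h1, h2⟩))
        rcases ih with ⟨hx, hxZ⟩ | ⟨hx, _⟩
        · by_cases hyZ : y ∈ Z
          · have hyR : y ∈ crossing U R := by
              by_contra h'
              exact hy (Finset.mem_union_left _ (Finset.mem_sdiff.2 ⟨hyZ, h'⟩))
            have := hRQ (mem_crossing.1 hyR).2.1
            exact .inr ⟨hyQ this, this⟩
          · exact .inl ⟨hx.tail ⟨hxy, hxZ, hyZ⟩, hyZ⟩
        · have := hQa x y hxy hx
          exact .inr ⟨hyQ this, this⟩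
    rcases key a hba with h' | h'
    · exact h.not_path' b hb a ha h'.1
    · exact hQ'.2 a (Finset.mem_union_left _ ha) h'.2

theorem IsSkewCut.cutWeight_lt (h : IsSkewCut E k U A B C R Z) :
    cutWeight (splitWeight E k U) R < k := by
  rw [cutWeight_eq_card h.arcClosed]
  exact (Finset.card_le_card h.crossing_subset).trans_lt h.card_lt

theorem IsSkewSeparator.exists_cut (h : IsSkewSeparator E k U A B C Z) :
    ∃ R, IsSkewCut E k U A B C R Z := by
  obtain ⟨R, h1, h2, h3⟩ := Arboreal.exists_cut (U := U) h.disjointC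
    (Finset.disjoint_union_left.2 ⟨h.disjointA, h.disjointB⟩) h.not_path
  exact ⟨R, h, h1, h2, h3⟩

/-- `R` is the largest cut that contains `R`, avoids the sinks `S` and is not heavier than `R`. -/
def IsFar {m : ℕ} (w : Fin m → Fin m → ℕ) (S R : Finset (Fin m)) : Prop :=
  ∀ Q, R ⊆ Q → Disjoint Q S → cutWeight w Q ≤ cutWeight w R → Q ⊆ R

/-- Among the cuts of separators take a largest one, `R`.  By submodularity, the far minimum cut of
any set of sources inside `R` stays inside `R`. -/
theorem IsSkewCut.farCut_subset (h : IsSkewCut E k U A B C R Z)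
    (hmax : ∀ R' Z', IsSkewCut E k U A B C R' Z' → R'.card ≤ R.card)
    {X : Finset (Fin (n + n))} (hX : X ⊆ R) :
    X ⊆ farCut k (splitWeight E k U) X (sinks (A ∪ B)) ∧
      farCut k (splitWeight E k U) X (sinks (A ∪ B)) ⊆ R ∧
      IsFar (splitWeight E k U) (sinks (A ∪ B))
        (farCut k (splitWeight E k U) X (sinks (A ∪ B))) := by
  obtain ⟨h1, h2, h3⟩ := farCut_spec (A := X) ⟨hX, h.separates.2⟩ h.cutWeight_lt
  set Q := farCut k (splitWeight E k U) X (sinks (A ∪ B))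
  refine ⟨h1.1, ?_, fun Q' hQ' hd hle => h3 Q' ⟨h1.1.trans hQ', hd⟩ hle⟩
  have hsub := cutWeight_union_add_inter (splitWeight E k U) R Q
  have hinter := h2 (R ∩ Q) ⟨Finset.subset_inter hX h1.1,
    h1.2.mono_left Finset.inter_subset_right⟩
  obtain ⟨Z', hZ'⟩ := h.push (Q := R ∪ Q) Finset.subset_union_left
    ⟨h.separates.1.trans Finset.subset_union_left,
      Finset.disjoint_union_left.2 ⟨h.separates.2, h1.2⟩⟩ (by omega)
  have := Finset.eq_of_subset_of_card_le Finset.subset_union_left (hmax _ _ hZ')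
  rw [this]
  exact Finset.subset_union_right

/-- As long as some crossing vertex of a far cut `R'` inside `R` does not cross `R`, pushing it
makes the cut heavier.  As no cut inside `R` is as heavy as `k`, this ends after at most `k`
steps. -/
theorem IsSkewCut.exists_pushes (h : IsSkewCut E k U A B C R Z)
    (hmax : ∀ R' Z', IsSkewCut E k U A B C R' Z' → R'.card ≤ R.card) (j : ℕ)
    {R' : Finset (Fin (n + n))} (hsub : R' ⊆ R)
    (hfar : IsFar (splitWeight E k U) (sinks (A ∪ B)) R')
    (hj : k ≤ cutWeight (splitWeight E k U) R' + j) :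
    ∃ g : ℕ → ℕ, (∀ a, g a ≤ k) ∧
      R' ⊆ Fin.foldr j (fun a R => pushStep E k U (A ∪ B) (g a) R) R' ∧
      Fin.foldr j (fun a R => pushStep E k U (A ∪ B) (g a) R) R' ⊆ R ∧
      ArcClosed E (Fin.foldr j (fun a R => pushStep E k U (A ∪ B) (g a) R) R') ∧
      crossing U (Fin.foldr j (fun a R => pushStep E k U (A ∪ B) (g a) R) R') ⊆
        crossing U R := by
  classical
  induction j generalizing R' with
  | zero =>
    have h1 := h.cutWeight_lt
    have := hfar R hsub h.separates.2 (by omega)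
    rw [hsub.antisymm this] at hj
    omega
  | succ j ih =>
    have hle : cutWeight (splitWeight E k U) R' ≤ cutWeight (splitWeight E k U) R := by
      by_contra hlt
      have := hfar R hsub h.separates.2 (by omega)
      rw [hsub.antisymm this] at hlt
      omega
    have hlt := h.cutWeight_lt
    have harc : ArcClosed E R' := arcClosed_of_cutWeight_lt (k := k) (U := U) (by omega)
    have hcard := cutWeight_eq_card (k := k) (U := U) harc
    by_cases hv : ∃ v ∈ crossing U R', Fin.natAdd n v ∈ R
    · obtain ⟨v, hv, hvR⟩ := hv
      have hX : R' ∪ sources {z ∈ crossing U R' | rank (crossing U R') z = rank (crossing U R') v}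
          ⊆ R := by
        refine Finset.union_subset hsub fun x hx => ?_
        simp only [sources, Finset.mem_filter, Finset.mem_univ, true_and] at hx
        obtain ⟨z, ⟨hz, hzv⟩, rfl⟩ := hx
        rwa [rank_inj hz hv hzv]
      obtain ⟨h1, h2, h3⟩ := h.farCut_subset hmax hX
      have hvmem : Fin.natAdd n v ∈ pushStep E k U (A ∪ B) (rank (crossing U R') v) R' :=
        h1 (Finset.mem_union_right _ (by simp [sources, hv]))
      have hss : R' ⊆ pushStep E k U (A ∪ B) (rank (crossing U R') v) R' :=
        Finset.subset_union_left.trans h1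
      have hgt : cutWeight (splitWeight E k U) R' < cutWeight (splitWeight E k U)
          (pushStep E k U (A ∪ B) (rank (crossing U R') v) R') := by
        by_contra hle'
        exact (mem_crossing.1 hv).2.2 (hfar _ hss
          (h.separates.2.mono_left h2) (by omega) hvmem)
      obtain ⟨g, hg, hg1, hg2, hg3, hg4⟩ := ih h2 h3 (by
        change _ ≤ cutWeight _ (pushStep E k U (A ∪ B) (rank (crossing U R') v) R') + _
        omega)
      refine ⟨fun a => if a = j then rank (crossing U R') v else g a, fun a => ?_, ?_⟩
      · dsimp only
        split_ifs
        · have := rank_lt_card hv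
          omega
        · exact hg a
      · have e : Fin.foldr (j + 1) (fun a R => pushStep E k U (A ∪ B)
            (if (a : ℕ) = j then rank (crossing U R') v else g a) R) R' =
            Fin.foldr j (fun a R => pushStep E k U (A ∪ B) (g a) R)
              (pushStep E k U (A ∪ B) (rank (crossing U R') v) R') := by
          rw [Fin.foldr_succ_last]
          simp only [Fin.val_last, if_true, Fin.val_castSucc]
          congr 1
          funext a R
          rw [if_neg a.2.ne]
        rw [e]
        exact ⟨hss.trans hg1, hg2, hg3, hg4⟩
    · push Not at hv
      -- A letter that is not a rank leaves the cut unchanged.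
      have hstep : pushStep E k U (A ∪ B) k R' = R' := by
        have he : ({z ∈ crossing U R' | rank (crossing U R') z = k} : Finset (Fin n)) = ∅ := by
          refine Finset.filter_eq_empty_iff.2 fun z hz => ?_
          have := rank_lt_card hz
          omega
        obtain ⟨h1, h2, h3⟩ := h.farCut_subset hmax hsub
        have hs : (sources ∅ : Finset (Fin (n + n))) = ∅ := by simp [sources]
        have hsp := farCut_spec (A := R') ⟨hsub, h.separates.2⟩ h.cutWeight_lt
        rw [pushStep, he, hs, Finset.union_empty]
        refine Finset.Subset.antisymm (hfar _ h1 hsp.1.2 ?_) h1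
        exact hsp.2.1 R' ⟨subset_rfl, h.separates.2.mono_left hsub⟩
      have e : Fin.foldr (j + 1) (fun _ R => pushStep E k U (A ∪ B) k R) R' = R' := by
        rw [foldr_const]
        exact Function.iterate_fixed hstep _
      refine ⟨fun _ => k, fun _ => le_rfl, ?_⟩
      simp only [e]
      refine ⟨subset_rfl, hsub, harc, fun v hvc => ?_⟩
      exact mem_crossing.2 ⟨(mem_crossing.1 hvc).1, hsub (mem_crossing.1 hvc).2.1, hv v hvc⟩

/-- Some word leads to a cut all of whose crossing vertices lie in one separator. -/
theorem IsSkewSeparator.exists_word (h : IsSkewSeparator E k U A B C Z) :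
    ∃ (g : ℕ → ℕ) (Z' : Finset (Fin n)), (∀ a, g a ≤ k) ∧ IsSkewSeparator E k U A B C Z' ∧
      Separates (sources C) (sinks (A ∪ B)) (pushes E k U C (A ∪ B) g k) ∧
      ArcClosed E (pushes E k U C (A ∪ B) g k) ∧
      crossing U (pushes E k U C (A ∪ B) g k) ⊆ Z' := by
  classical
  obtain ⟨R₀, h₀⟩ := h.exists_cut
  obtain ⟨R, hR, hmax⟩ := Finset.exists_max_image
    (Finset.univ.filter fun R => ∃ Z', IsSkewCut E k U A B C R Z') Finset.card
    ⟨R₀, by simpa using ⟨Z, h₀⟩⟩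
  simp only [Finset.mem_filter, Finset.mem_univ, true_and] at hR hmax
  obtain ⟨Z', hR⟩ := hR
  have hmax' : ∀ R' Z', IsSkewCut E k U A B C R' Z' → R'.card ≤ R.card :=
    fun R' Z' h' => hmax R' ⟨Z', h'⟩
  obtain ⟨h1, h2, h3⟩ := hR.farCut_subset hmax' hR.separates.1
  obtain ⟨g, hg, hg1, hg2, hg3, hg4⟩ := hR.exists_pushes hmax' k h2 h3 (by omega)
  exact ⟨g, Z', hg, hR.toIsSkewSeparator, ⟨h1.trans hg1, hR.separates.2.mono_left hg2⟩, hg3,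
    hg4.trans hR.crossing_subset⟩

end Enumeration

open Classical in
/-- The vertices of `T` with the label `a`: the labels are given by the first letters of the word
`l`, in the order of the vertices. -/
noncomputable def labelled {n : ℕ} (T : Finset (Fin n)) (l : ℕ → ℕ) (a : ℕ) : Finset (Fin n) :=
  {v ∈ T | l (rank T v) = a}

/-- The first part of the candidate: the vertices with label `3`, and a separator of those with
label `2` from those with label `0` or `1`, found by pushes that are guided by the letters from
`2 * k` on. -/
noncomputable def candidate₁ {n : ℕ} (E : Fin n → Fin n → Prop) (k : ℕ) (T : Finset (Fin n))
    (l : ℕ → ℕ) : Finset (Fin n) :=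
  labelled T l 3 ∪ crossing (labelled T l 3)
    (pushes E k (labelled T l 3) (labelled T l 2) (labelled T l 0 ∪ labelled T l 1)
      (fun a => l (2 * k + a)) k)

/-- The candidate for a balanced separator of `T` that the word `l` describes: a minimum separator
of the labels `1` and `0` is added to the first part. -/
noncomputable def candidate {n : ℕ} (E : Fin n → Fin n → Prop) (k : ℕ) (T : Finset (Fin n))
    (l : ℕ → ℕ) : Finset (Fin n) :=
  candidate₁ E k T l ∪ crossing (candidate₁ E k T l)
    (farCut k (splitWeight E k (candidate₁ E k T l)) (sources (labelled T l 1))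
      (sinks (labelled T l 0)))

/-- A word may prescribe any labels, followed by any letters. -/
theorem exists_word_of_labels {n m b : ℕ} {T : Finset (Fin n)} (hT : T.card ≤ m)
    (lab : Fin n → ℕ) (g : ℕ → ℕ) (hlab : ∀ v, lab v < b) (hg : ∀ a, g a < b) :
    ∃ l : ℕ → ℕ, (∀ a, l a < b) ∧ (∀ a, labelled T l a = T.filter fun v => lab v = a) ∧
      (fun a => l (m + a)) = g := by
  classical
  let l : ℕ → ℕ := fun a => if a < m then
    (if h : ∃ v ∈ T, rank T v = a then lab h.choose else g 0) else g (a - m)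
  refine ⟨l, fun a => ?_, fun a => ?_, ?_⟩
  · simp only [l]
    split_ifs with h1 h2
    · exact hlab _
    · exact hg 0
    · exact hg _
  · refine Finset.filter_congr fun v hv => ?_
    have h1 : rank T v < m := (rank_lt_card hv).trans_le hT
    have h2 : ∃ v' ∈ T, rank T v' = rank T v := ⟨v, hv, rfl⟩
    simp only [l]
    rw [if_pos h1, dif_pos h2, rank_inj h2.choose_spec.1 hv h2.choose_spec.2]
  · funext a
    simp [l]

/-- If there is a balanced separator at all, then one is described by a word. -/
theorem exists_candidate {n : ℕ} {E : Fin n → Fin n → Prop} {k : ℕ} {T Z : Finset (Fin n)}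
    (hT : T.card ≤ 2 * k) (h : Balanced E k T Z) :
    ∃ l : ℕ → ℕ, (∀ a, l a < k + 4) ∧ Balanced E k T (candidate E k T l) := by
  classical
  obtain ⟨A, B, C, hABC, hA, hB, hC, hp, hp'⟩ := exists_tripartition h
  have hmem : ∀ v, (v ∈ A ∨ v ∈ B ∨ v ∈ C) ↔ v ∈ T ∧ v ∉ Z := by
    intro v
    rw [← Finset.mem_sdiff, ← hABC]
    simp
  have hCA : ∀ v ∈ C, v ∉ A := fun v hv hv' => hp v hv v (Finset.mem_union_left _ hv') .refl
  have hCB : ∀ v ∈ C, v ∉ B := fun v hv hv' => hp v hv v (Finset.mem_union_right _ hv') .refl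
  have hBA : ∀ v ∈ B, v ∉ A := fun v hv hv' => hp' v hv v hv' .refl
  have hsol : IsSkewSeparator E k (T ∩ Z) A B C Z :=
    ⟨Finset.inter_subset_right, h.1,
      Finset.disjoint_left.2 fun v hv => ((hmem v).1 (.inl hv)).2,
      Finset.disjoint_left.2 fun v hv => ((hmem v).1 (.inr (.inl hv))).2,
      Finset.disjoint_left.2 fun v hv => ((hmem v).1 (.inr (.inr hv))).2, hp, hp'⟩
  obtain ⟨g, Z', hg, hZ', hsep, harc, hcr⟩ := hsol.exists_word
  obtain ⟨l, hlb, hl, hgl⟩ := exists_word_of_labels (b := k + 4) hT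
    (fun v => if v ∈ A then 0 else if v ∈ B then 1 else if v ∈ C then 2 else 3) g
    (fun v => by split_ifs <;> omega) (fun a => (hg a).trans_lt (by omega))
  have hl0 : labelled T l 0 = A := by
    rw [hl]
    ext v
    have := hmem v
    by_cases h1 : v ∈ A <;> by_cases h2 : v ∈ B <;> by_cases h3 : v ∈ C <;>
      simp [h1, h2, h3] at this ⊢
    all_goals exact this.1
  have hl1 : labelled T l 1 = B := by
    rw [hl]
    ext v
    have h0 := hmem v
    have h4 := hBA v
    by_cases h1 : v ∈ A <;> by_cases h2 : v ∈ B <;> by_cases h3 : v ∈ C <;>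
      simp [h1, h2, h3] at h0 h4 ⊢
    all_goals exact h0.1
  have hl2 : labelled T l 2 = C := by
    rw [hl]
    ext v
    have h0 := hmem v
    have h4 := hCA v
    have h5 := hCB v
    by_cases h1 : v ∈ A <;> by_cases h2 : v ∈ B <;> by_cases h3 : v ∈ C <;>
      simp [h1, h2, h3] at h0 h4 h5 ⊢
    all_goals exact h0.1
  have hl3 : labelled T l 3 = T ∩ Z := by
    rw [hl]
    ext v
    have h0 := hmem v
    by_cases h1 : v ∈ A <;> by_cases h2 : v ∈ B <;> by_cases h3 : v ∈ C <;>
      simp [h1, h2, h3] at h0 ⊢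
    all_goals tauto
  refine ⟨l, hlb, ?_⟩
  obtain ⟨W, hW⟩ : ∃ W, W = T ∩ Z ∪ crossing (T ∩ Z) (pushes E k (T ∩ Z) C (A ∪ B) g k) :=
    ⟨_, rfl⟩
  have hc₁ : candidate₁ E k T l = W := by
    rw [candidate₁, hl3, hl2, hl1, hl0, hgl, hW]
  rw [candidate, hc₁, hl1, hl0]
  have hTW : T ∩ Z ⊆ W := hW ▸ Finset.subset_union_left
  have hcW : crossing (T ∩ Z) (pushes E k (T ∩ Z) C (A ∪ B) g k) ⊆ W :=
    hW ▸ Finset.subset_union_right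
  have hWZ : W ⊆ Z' := hW ▸ Finset.union_subset hZ'.subset hcr
  clear hW hc₁ hl hl0 hl1 hl2 hl3 hgl
  obtain ⟨R₂, hR₂, hR₂a, hR₂c⟩ := exists_cut (U := W) hZ'.disjointB hZ'.disjointA hZ'.not_path'
  have hR₂w := cutWeight_eq_card (k := k) (U := W) hR₂a
  have hcard : W.card + (crossing W R₂).card ≤ Z'.card := by
    rw [← Finset.card_union_of_disjoint]
    · exact Finset.card_le_card (Finset.union_subset hWZ hR₂c)
    · exact Finset.disjoint_left.2 fun v hv hv' => (mem_crossing.1 hv').1 hv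
  have hZlt := hZ'.card_lt
  obtain ⟨hF, hFmin, -⟩ := farCut_spec (w := splitWeight E k W) (k := k) hR₂ (by omega)
  obtain ⟨F, hFdef⟩ : ∃ F, F = farCut k (splitWeight E k W) (sources B) (sinks A) := ⟨_, rfl⟩
  rw [← hFdef] at hF hFmin ⊢
  have hFle := hFmin R₂ hR₂
  have hFa : ArcClosed E F := arcClosed_of_cutWeight_lt (k := k) (U := W) (by omega)
  have hFw := cutWeight_eq_card (k := k) (U := W) hFa
  refine balanced_of_tripartition (A := A) (B := B) (C := C) ?_ ?_ hA hB hC ?_ ?_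
  · have := Finset.card_union_le W (crossing W F)
    omega
  · intro v hv
    have h1 := hmem v
    have h2 := @hTW v
    simp only [Finset.mem_union, Finset.mem_inter] at h2 ⊢
    tauto
  · exact not_path_of_cut hZ'.disjoint_left hsep harc (hTW.trans Finset.subset_union_left)
      (hcW.trans Finset.subset_union_left)
  · exact not_path_of_cut (Finset.disjoint_left.2 hBA) hF hFa Finset.subset_union_left
      Finset.subset_union_right

/-! ### Search for a balanced separator -/

/-- The word whose letters are the digits of `q` in base `k + 4`. -/
def digits (k q a : ℕ) : ℕ := q / (k + 4) ^ a % (k + 4)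

open Classical in
/-- A balanced separator of `T`, if there is one, found by trying all words of length `3 * k` over
`k + 4` letters. -/
noncomputable def separator {n : ℕ} (E : Fin n → Fin n → Prop) (k : ℕ) (T : Finset (Fin n)) :
    Finset (Fin n) :=
  Fin.foldr ((k + 4) ^ (3 * k))
    (fun q acc => if Balanced E k T (candidate E k T (digits k q)) then
      candidate E k T (digits k q) else acc) ∅

theorem foldr_search {α : Type*} {P : α → Prop} [DecidablePred P] {m : ℕ} {x : Fin m → α}
    (h : ∃ v, P (x v)) (a : α) : P (Fin.foldr m (fun v acc => if P (x v) then x v else acc) a) := by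
  induction m with
  | zero => exact h.choose.elim0
  | succ m ih =>
    rw [Fin.foldr_succ]
    by_cases h0 : P (x 0)
    · rwa [if_pos h0]
    · rw [if_neg h0]
      rcases Fin.exists_fin_succ.1 h with h | h
      · exact absurd h h0
      · exact ih h

theorem candidate_congr {n : ℕ} {E : Fin n → Fin n → Prop} {k : ℕ} {T : Finset (Fin n)}
    {l l' : ℕ → ℕ} (hT : T.card ≤ 2 * k) (h : ∀ a < 3 * k, l a = l' a) :
    candidate E k T l = candidate E k T l' := by
  classical
  have hl : ∀ a, labelled T l a = labelled T l' a := fun a =>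
    Finset.filter_congr fun v hv => by
      have := rank_lt_card hv
      rw [h _ (by omega)]
  have hp : ∀ U C S, pushes E k U C S (fun a => l (2 * k + a)) k =
      pushes E k U C S (fun a => l' (2 * k + a)) k := by
    intro U C S
    unfold pushes
    congr 1
    funext a R
    dsimp only
    rw [h (2 * k + a) (by omega)]
  simp only [candidate, candidate₁, hl, hp]

theorem exists_digits {k m : ℕ} {l : ℕ → ℕ} (hl : ∀ a, l a < k + 4) :
    ∃ q : Fin ((k + 4) ^ m), ∀ a < m, l a = digits k q a := by
  refine ⟨finFunctionFinEquiv fun a => ⟨l a, hl a⟩, fun a ha => ?_⟩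
  have := finFunctionFinEquiv_symm_apply_val
    (finFunctionFinEquiv fun a : Fin m => (⟨l a, hl a⟩ : Fin (k + 4))) ⟨a, ha⟩
  rw [Equiv.symm_apply_apply] at this
  exact this

/-- The search is complete, as the candidate depends only on the first `3 * k` letters of the
word. -/
theorem balanced_separator {n : ℕ} {E : Fin n → Fin n → Prop} {k : ℕ} {T Z : Finset (Fin n)}
    (hT : T.card ≤ 2 * k) (h : Balanced E k T Z) : Balanced E k T (separator E k T) := by
  classical
  obtain ⟨l, hl, hb⟩ := exists_candidate hT h
  obtain ⟨q, hq⟩ := exists_digits (m := 3 * k) hl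
  rw [candidate_congr hT hq] at hb
  exact foldr_search (P := Balanced E k T) (x := fun q => candidate E k T (digits k q)) ⟨q, hb⟩ _

/-! ### Havens from sets without a balanced separator -/

section Reaches
variable {n : ℕ} {D : Digraph (Fin n)} {E : Fin n → Fin n → Prop} {k : ℕ}
  {T Z Z₁ Z₂ : Finset (Fin n)} {u v x a b : Fin n}

theorem reaches_iff {V : Type*} {D : Digraph V} {U : Set V} {u v : V} : Reaches D U u v ↔
    u ∈ U ∧ Relation.ReflTransGen (fun a b => D.Adj a b ∧ a ∈ U ∧ b ∈ U) u v := by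
  constructor
  · rintro ⟨l, hc, hh, hl, hU⟩
    induction l generalizing u with
    | nil => simp at hh
    | cons a l ih =>
      obtain rfl : a = u := by simpa using hh
      refine ⟨hU a (by simp), ?_⟩
      cases l with
      | nil =>
        obtain rfl : a = v := by simpa using hl
        exact .refl
      | cons b l =>
        rw [List.isChain_cons_cons] at hc
        exact .head ⟨hc.1, hU a (by simp), hU b (by simp)⟩
          (ih hc.2 rfl (by simpa using hl) fun x hx => hU x (by simp [hx])).2
  · rintro ⟨hu, h⟩
    induction h using Relation.ReflTransGen.head_induction_on with
    | refl => exact ⟨[v], by simp, rfl, rfl, by simpa using hu⟩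
    | @head a b hab _ ih =>
      obtain ⟨l, hc, hh, hl, hU⟩ := ih hab.2.2
      cases l with
      | nil => simp at hh
      | cons c l =>
        obtain rfl : c = b := by simpa using hh
        refine ⟨a :: c :: l, List.isChain_cons_cons.2 ⟨hab.1, hc⟩, rfl, by simpa using hl, ?_⟩
        intro x hx
        rcases List.mem_cons.1 hx with rfl | hx
        · exact hu
        · exact hU x hx

theorem reaches_compl_iff : Reaches D (Z : Set (Fin n))ᶜ u v ↔ u ∉ Z ∧ Path D.Adj Z u v := by
  rw [reaches_iff]
  rfl

/-- A walk that avoids `Z₁` can be seen as a walk that avoids `Z₂`, if no vertex between its ends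
belongs to `Z₂`. -/
theorem Path.transfer (h : ∀ y, Path E Z₁ a y → Path E Z₁ y b → y ∉ Z₂) (hax : Path E Z₁ a x)
    (hxb : Path E Z₁ x b) : Path E Z₂ a x ∧ Path E Z₂ x b := by
  constructor
  · induction hax with
    | refl => exact .refl
    | @tail y z hy hyz ih =>
      have hyb : Path E Z₁ y b := .head hyz hxb
      exact (ih hyb).tail ⟨hyz.1, h y hy hyb, h z (hy.tail hyz) hxb⟩
  · induction hxb using Relation.ReflTransGen.head_induction_on with
    | refl => exact .refl
    | @head y z hyz hz ih =>
      have haz : Path E Z₁ a z := hax.tail hyz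
      exact .head ⟨hyz.1, h y hax (.head hyz hz), h z haz hz⟩ (ih haz)

theorem self_mem_component : u ∈ component E Z u := mem_component.2 ⟨.refl, .refl⟩

theorem component_eq_of_mem (h : v ∈ component E Z u) : component E Z v = component E Z u := by
  rw [mem_component] at h
  ext x
  rw [mem_component, mem_component]
  exact ⟨fun hx => ⟨h.1.trans hx.1, hx.2.trans h.2⟩, fun hx => ⟨h.2.trans hx.1, hx.2.trans h.1⟩⟩

theorem isStrongComponent_component (hu : u ∉ Z) :
    IsStrongComponent D (Z : Set (Fin n)) (component D.Adj Z u : Set (Fin n)) := by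
  refine ⟨⟨fun x hx => ?_, ⟨u, self_mem_component⟩, fun x hx y hy => ?_⟩, fun S hS hsub x hx => ?_⟩
  · exact ((mem_component.1 hx).1.notMem hu)
  · refine reaches_iff.2 ⟨hx, ?_⟩
    have hxu := mem_component.1 hx
    have hyu := mem_component.1 hy
    -- Every vertex between `x` and `y` lies in the component.
    have h := Path.transfer (E := D.Adj) (Z₁ := Z) (Z₂ := (component D.Adj Z u)ᶜ) (x := y)
      (fun z hxz hzy => by
        rw [Finset.mem_compl, not_not]
        exact mem_component.2 ⟨hxu.1.trans hxz, hzy.trans hyu.2⟩)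
      (hxu.2.trans hyu.1) .refl
    exact Relation.ReflTransGen.mono (fun a b hab => ⟨hab.1, by simpa using hab.2.1,
      by simpa using hab.2.2⟩) _ _ h.1
  · have hu' : u ∈ S := hsub self_mem_component
    have key : ∀ a ∈ S, ∀ b ∈ S, Path D.Adj Z a b := fun a ha b hb =>
      Relation.ReflTransGen.mono (fun a b hab => ⟨hab.1, hS.1 hab.2.1, hS.1 hab.2.2⟩) _ _
        (reaches_iff.1 (hS.2.2 a ha b hb)).2
    exact mem_component.2 ⟨key u hu' x hx, key x hx u hu'⟩

/-- If `T` has no balanced separator, then the strong components with more than half of `T` form a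
haven: any two of them meet. -/
theorem hasHaven_of_not_balanced (hn : 0 < n) (h : ∀ Z, ¬ Balanced D.Adj k T Z) : HasHaven D k := by
  classical
  have key : ∀ Z : Finset (Fin n), ∃ u, Z.card < k →
      u ∉ Z ∧ T.card < 2 * (T ∩ component D.Adj Z u).card := by
    intro Z
    by_cases hZ : Z.card < k
    · have := h Z
      simp only [Balanced, hZ, true_and, not_forall, not_le] at this
      obtain ⟨u, hu, hlt⟩ := this
      exact ⟨u, fun _ => ⟨hu, hlt⟩⟩
    · exact ⟨⟨0, hn⟩, fun h => absurd h hZ⟩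
  choose u hu using key
  refine ⟨fun Z => component D.Adj Z (u Z), fun Z hZ => isStrongComponent_component (hu Z hZ).1,
    fun Z' Z hsub hZ => ?_⟩
  have hZ' : Z'.card < k := (Finset.card_le_card hsub).trans_lt hZ
  have h1 : component D.Adj Z (u Z) ⊆ component D.Adj Z' (u Z) := fun x hx => by
    rw [mem_component] at hx ⊢
    exact ⟨hx.1.mono hsub, hx.2.mono hsub⟩
  obtain ⟨x, hx⟩ : (T ∩ component D.Adj Z (u Z) ∩ (T ∩ component D.Adj Z' (u Z'))).Nonempty := by
    rw [← Finset.card_pos]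
    have h2 := (hu Z hZ).2
    have h3 := (hu Z' hZ').2
    have h4 := Finset.card_union_add_card_inter (T ∩ component D.Adj Z (u Z))
      (T ∩ component D.Adj Z' (u Z'))
    have h5 := Finset.card_le_card (Finset.union_subset
      (Finset.inter_subset_left : T ∩ component D.Adj Z (u Z) ⊆ T)
      (Finset.inter_subset_left : T ∩ component D.Adj Z' (u Z') ⊆ T))
    omega
  simp only [Finset.mem_inter] at hx
  have h2 : component D.Adj Z' (u Z) = component D.Adj Z' (u Z') := by
    rw [← component_eq_of_mem (h1 hx.1.2), component_eq_of_mem hx.2.2]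
  rw [h2] at h1
  exact_mod_cast h1

end Reaches

/-! ### Arboreal decompositions from parent functions -/

/-- `S` is disjoint from `Z`, and every vertex on a walk that avoids `Z` and has its ends in `S`
belongs to `S`. -/
def Guards {n : ℕ} (E : Fin n → Fin n → Prop) (Z S : Finset (Fin n)) : Prop :=
  Disjoint S Z ∧ ∀ a ∈ S, ∀ b ∈ S, ∀ x, Path E Z a x → Path E Z x b → x ∈ S

theorem IsWalk.reaches {V : Type*} {D : Digraph V} {U : Set V} {u v x : V} {l : List V}
    (h : IsWalk D U u v l) (hx : x ∈ l) : Reaches D U u x ∧ Reaches D U x v := by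
  obtain ⟨hc, hh, hl, hU⟩ := h
  obtain ⟨l₁, l₂, rfl⟩ := List.append_of_mem hx
  constructor
  · refine ⟨l₁ ++ [x], ?_, ?_, by simp, fun y hy => hU y ?_⟩
    · rw [List.append_cons] at hc
      exact hc.left_of_append
    · cases l₁ <;> simpa using hh
    · simp at hy ⊢
      tauto
  · refine ⟨x :: l₂, hc.right_of_append, rfl, ?_, fun y hy => hU y ?_⟩
    · simpa using hl
    · simp at hy ⊢
      tauto

theorem Guards.isGuarded {n : ℕ} {D : Digraph (Fin n)} {Z S : Finset (Fin n)}
    (h : Guards D.Adj Z S) : IsGuarded D (Z : Set (Fin n)) (S : Set (Fin n)) := by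
  refine ⟨fun x hx => Finset.disjoint_left.1 h.1 hx, ?_⟩
  rintro ⟨u, hu, v, hv, l, hl, x, hx, hxn⟩
  obtain ⟨h1, h2⟩ := hl.reaches hx
  rw [reaches_compl_iff] at h1 h2
  exact hxn (.inr (h.2 u hu v hv x h1.2 h2.2))

/-- The combinatorial data of an arboreal decomposition with one vertex in every bag.  The nodes are
the vertices; `par s` consists of the parent of `s` and is empty for the root, `guard s` is the
guard of the edge that enters `s`, and `sub s` is the set of vertices at or below `s`. -/
structure ParentData {n : ℕ} (D : Digraph (Fin n)) (par guard sub : Fin n → Finset (Fin n)) :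
    Prop where
  mem_sub_self : ∀ s, s ∈ sub s
  sub_subset : ∀ r s, r ∈ par s → sub s ⊆ (sub r).erase r
  exists_child : ∀ r, ∀ x ∈ sub r, x ≠ r → ∃ s, r ∈ par s ∧ x ∈ sub s
  par_unique : ∀ s, ∀ r ∈ par s, ∀ r' ∈ par s, r = r'
  exists_root : ∃ r, par r = ∅ ∧ sub r = Finset.univ
  guards : ∀ s, Guards D.Adj (guard s) (sub s)

section ParentData
variable {n : ℕ} {D : Digraph (Fin n)} {par guard sub : Fin n → Finset (Fin n)}

theorem ParentData.reaches_iff (h : ParentData D par guard sub) {r x : Fin n} :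
    Reaches ⟨fun r s => r ∈ par s⟩ Set.univ r x ↔ x ∈ sub r := by
  rw [Arboreal.reaches_iff]
  simp only [Set.mem_univ, and_true, true_and]
  constructor
  · intro hx
    induction hx using Relation.ReflTransGen.head_induction_on with
    | refl => exact h.mem_sub_self x
    | head hrs _ ih => exact Finset.mem_of_mem_erase (h.sub_subset _ _ hrs ih)
  · induction hc : (sub r).card using Nat.strong_induction_on generalizing r with
    | _ c ih =>
      intro hx
      by_cases hxr : x = r
      · rw [hxr]
      · obtain ⟨s, hs, hxs⟩ := h.exists_child r x hx hxr
        have := Finset.card_le_card (h.sub_subset r s hs)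
        rw [Finset.card_erase_of_mem (h.mem_sub_self r)] at this
        have := Finset.card_pos.2 ⟨r, h.mem_sub_self r⟩
        exact .head hs (ih _ (by omega) rfl hxs)

theorem ParentData.isArborescence (h : ParentData D par guard sub) :
    IsArborescence ⟨fun r s => r ∈ par s⟩ := by
  classical
  obtain ⟨r₀, hpar, hsub⟩ := h.exists_root
  have hne : ∀ r s, r ∈ par s → s ≠ r := fun r s hrs hsr => by
    have := h.sub_subset r s hrs (h.mem_sub_self s)
    simp [hsr] at this
  have hreach : ∀ x, Relation.ReflTransGen (fun r s => r ∈ par s) r₀ x := fun x => by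
    have := h.reaches_iff.2 (hsub ▸ Finset.mem_univ x : x ∈ sub r₀)
    rw [Arboreal.reaches_iff] at this
    simpa using this.2
  refine ⟨fun r s hrs hsr => ?_, ?_, r₀, fun r => h.reaches_iff.2 (hsub ▸ Finset.mem_univ r)⟩
  · have h1 := h.sub_subset r s hrs
    have h2 := h.sub_subset s r hsr (Finset.mem_of_mem_erase (h1 (h.mem_sub_self s)))
    simp at h2
  · set G := Digraph.toSimpleGraphInclusive ⟨fun r s => r ∈ par s⟩ with hG
    have hadj : ∀ r s, G.Adj r s ↔ r ≠ s ∧ (r ∈ par s ∨ s ∈ par r) := fun r s => by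
      simp [hG, Digraph.toSimpleGraphInclusive, SimpleGraph.fromRel_adj]
    have hconn : G.Connected := by
      have hr : ∀ x, G.Reachable r₀ x := fun x => by
        induction hreach x with
        | refl => exact .refl _
        | @tail a b _ hab ih =>
          exact ih.trans (SimpleGraph.Adj.reachable
            ((hadj a b).2 ⟨(hne a b hab).symm, .inl hab⟩))
      have : Nonempty (Fin n) := ⟨r₀⟩
      exact ⟨fun x y => (hr x).symm.trans (hr y)⟩
    rw [SimpleGraph.isTree_iff_connected_and_card]
    refine ⟨hconn, le_antisymm ?_ hconn.card_vert_le_card_edgeSet_add_one⟩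
    -- Every edge joins some vertex other than the root to its parent.
    set F : Finset (Sym2 (Fin n)) := (Finset.univ.erase r₀).image fun s =>
        if hs : (par s).Nonempty then s(hs.choose, s) else s(s, s) with hF
    have hedges : G.edgeSet ⊆ F := by
      intro e
      induction e using Sym2.ind with
      | _ a b =>
        have key : ∀ a b, a ∈ par b → s(a, b) ∈ F := by
          intro a b hab
          refine Finset.mem_image.2 ⟨b, ?_, ?_⟩
          · refine Finset.mem_erase.2 ⟨fun hb => ?_, Finset.mem_univ b⟩
            rw [hb, hpar] at hab
            simp at hab
          · have hb : (par b).Nonempty := ⟨a, hab⟩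
            rw [dif_pos hb, h.par_unique b _ hb.choose_spec a hab]
        intro hab
        rw [SimpleGraph.mem_edgeSet, hadj] at hab
        rcases hab.2 with hab | hab
        · exact key a b hab
        · rw [Sym2.eq_swap]
          exact key b a hab
    have h1 : Nat.card G.edgeSet ≤ F.card :=
      (Nat.card_mono F.finite_toSet hedges).trans_eq (by simp)
    have h2 : F.card ≤ n - 1 := Finset.card_image_le.trans (by simp)
    have h3 : 0 < n := r₀.pos
    rw [Nat.card_eq_fintype_card (α := Fin n), Fintype.card_fin]
    omega

/-- The arboreal decomposition given by parents and guards. -/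
def ParentData.decomposition (h : ParentData D par guard sub) :
    ArborealDecomposition D (Fin n) where
  R := ⟨fun r s => r ∈ par s⟩
  X := fun _ s => guard s
  W := fun r => {r}
  isArborescence := h.isArborescence
  nonempty := fun r => ⟨r, by simp⟩
  disjoint := fun r s hrs => by simpa using hrs
  cover := fun x => ⟨x, by simp⟩
  guarded := fun r s _ => by
    have : {x | ∃ q, Reaches ⟨fun r s => r ∈ par s⟩ Set.univ s q ∧ x ∈ ({q} : Finset (Fin n))} =
        (sub s : Set (Fin n)) := by
      ext x
      simp [h.reaches_iff]
    rw [this]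
    exact (h.guards s).isGuarded

theorem ParentData.width_le (h : ParentData D par guard sub) {w : ℕ}
    (hw : ∀ r, ∃ N : Finset (Fin n), N.card ≤ w ∧ r ∈ N ∧ guard r ⊆ N ∧
      ∀ s, r ∈ par s → guard s ⊆ N) :
    h.decomposition.width ≤ (w : ℤ) - 1 := by
  have : (Finset.univ.sup fun r => (h.decomposition.nodeSet r).card) ≤ w := by
    refine Finset.sup_le fun r _ => ?_
    obtain ⟨N, hN, hr, hg, hs⟩ := hw r
    refine (Finset.card_le_card fun x hx => ?_).trans hN
    simp only [ArborealDecomposition.nodeSet, Finset.mem_filter, Finset.mem_univ, true_and] at hx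
    rcases hx with hx | ⟨p, q, hpq, rfl | rfl, hx⟩
    · rw [show x = r by simpa [ParentData.decomposition] using hx]
      exact hr
    · exact hs q hpq hx
    · exact hg hx
  rw [ArborealDecomposition.width]
  omega

end ParentData

/-! ### The decomposition algorithm -/

open Classical in
/-- The set consisting of the greatest element of `S`, empty if `S` is. -/
noncomputable def greatest {n : ℕ} (S : Finset (Fin n)) : Finset (Fin n) :=
  {x ∈ S | ∀ y ∈ S, ¬ x < y}

open Classical in
/-- The elements of `S` below `u`. -/
noncomputable def below {n : ℕ} (S : Finset (Fin n)) (u : Fin n) : Finset (Fin n) := {v ∈ S | v < u}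

/-- A part of the digraph that remains to be decomposed: its vertices, its guard, and the node to
which it will be attached (a singleton, or empty in the beginning). -/
structure Part (n : ℕ) where
  verts : Finset (Fin n)
  guard : Finset (Fin n)
  parent : Finset (Fin n)

section Part
variable {n : ℕ} (E : Fin n → Fin n → Prop) (k : ℕ)

/-- The whole digraph. -/
def Part.init (n : ℕ) : Part n := ⟨Finset.univ, ∅, ∅⟩

/-- The balanced separator of the guard of a part, and one vertex of the part. -/
noncomputable def Part.cutset (p : Part n) : Finset (Fin n) := separator E k p.guard ∪ least p.verts

/-- The vertices of a part that are turned into a path of nodes, in increasing order. -/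
noncomputable def Part.bag (p : Part n) : Finset (Fin n) := p.cutset E k ∩ p.verts

/-- The search for a balanced separator of the guard has been successful. -/
def Part.Good (p : Part n) : Prop := Balanced E k p.guard (separator E k p.guard)

/-- The part that contains `u` after the bag has been removed. -/
noncomputable def Part.next (u : Fin n) (p : Part n) : Part n where
  verts := component E (p.verts \ p.bag E k)ᶜ u
  guard := p.cutset E k ∪ (p.guard ∩ component E (separator E k p.guard) u)
  parent := greatest (p.bag E k)

open Classical in
/-- One step in the search for the part whose bag contains `u`; it is idle if that part has been
found or if no balanced separator exists. -/
noncomputable def Part.step (u : Fin n) (p : Part n) : Part n :=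
  if u ∈ p.bag E k ∨ ¬ p.Good E k then p else p.next E k u

/-- The part whose bag contains `u`, if all separators exist. -/
noncomputable def finalPart (u : Fin n) : Part n := (Part.step E k u)^[n] (.init n)

open Classical in
/-- The parent of the node `u`: the preceding vertex of the same bag or, for the first vertex of the
bag, the node to which the part is attached. -/
noncomputable def parentOf (u : Fin n) : Finset (Fin n) :=
  if below ((finalPart E k u).bag E k) u = ∅ then (finalPart E k u).parent
  else greatest (below ((finalPart E k u).bag E k) u)

/-- The guard of the edge that enters the node `u`. -/
noncomputable def guardOf (u : Fin n) : Finset (Fin n) :=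
  (finalPart E k u).guard ∪ below ((finalPart E k u).bag E k) u

/-- The vertices at or below the node `u`. -/
noncomputable def subOf (u : Fin n) : Finset (Fin n) :=
  (finalPart E k u).verts \ below ((finalPart E k u).bag E k) u

/-- The parts that contain `u` in the course of the algorithm. -/
inductive Reached (u : Fin n) : Part n → Prop where
  | init : Reached u (.init n)
  | next {p} : Reached u p → u ∉ p.bag E k → p.Good E k → Reached u (p.next E k u)

end Part

section Algorithm
variable {n k : ℕ} {E : Fin n → Fin n → Prop} {p : Part n} {S : Finset (Fin n)} {u v x : Fin n}

theorem mem_below : v ∈ below S u ↔ v ∈ S ∧ v < u := by simp [below]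

theorem exists_greatest_eq (h : S.Nonempty) :
    ∃ x ∈ S, greatest S = {x} ∧ ∀ y ∈ S, y ≤ x := by
  refine ⟨S.max' h, S.max'_mem h, ?_, fun y hy => S.le_max' y hy⟩
  ext y
  simp only [greatest, Finset.mem_filter, Finset.mem_singleton, not_lt]
  constructor
  · rintro ⟨hy, h'⟩
    exact le_antisymm (S.le_max' _ hy) (h' _ (S.max'_mem h))
  · rintro rfl
    exact ⟨S.max'_mem h, fun z hz => S.le_max' z hz⟩

theorem Part.bag_subset : p.bag E k ⊆ p.verts := Finset.inter_subset_right

theorem Part.bag_nonempty (h : p.verts.Nonempty) : (p.bag E k).Nonempty := by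
  obtain ⟨x, hx, he⟩ := exists_least_eq h
  exact ⟨x, Finset.mem_inter.2 ⟨Finset.mem_union_right _ (by simp [he]), hx⟩⟩

theorem Part.card_cutset_le (h : p.Good E k) : (p.cutset E k).card ≤ k := by
  have h1 := Finset.card_union_le (separator E k p.guard) (least p.verts)
  have h2 : (least p.verts).card ≤ 1 := by
    rcases p.verts.eq_empty_or_nonempty with h | h
    · simp [h, least_empty]
    · obtain ⟨x, _, he⟩ := exists_least_eq h
      simp [he]
  have := h.1
  rw [Part.cutset]
  omega

theorem Part.verts_next_subset (hu : u ∈ p.verts) (hb : u ∉ p.bag E k) :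
    (p.next E k u).verts ⊆ p.verts \ p.bag E k := fun x hx => by
  have h : u ∉ (p.verts \ p.bag E k)ᶜ := by simp [hu, hb]
  simpa using (mem_component.1 hx).1.notMem h

theorem Reached.mem (h : Reached E k u p) : u ∈ p.verts := by
  cases h with
  | init => exact Finset.mem_univ u
  | next _ _ _ => exact self_mem_component

theorem Part.separator_subset : separator E k p.guard ⊆ (p.verts \ p.bag E k)ᶜ := fun y hy => by
  simp only [Finset.mem_compl, Finset.mem_sdiff, not_and, not_not]
  exact fun h => Finset.mem_inter.2 ⟨Finset.mem_union_left _ hy, h⟩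

theorem Part.mem_component_separator (hx : x ∈ (p.next E k u).verts) :
    x ∈ component E (separator E k p.guard) u := by
  have := mem_component.1 hx
  exact mem_component.2 ⟨this.1.mono Part.separator_subset, this.2.mono Part.separator_subset⟩

/-- The parts reached from different vertices are the same. -/
theorem Reached.of_mem (h : Reached E k u p) (hx : x ∈ p.verts) : Reached E k x p := by
  induction h with
  | init => exact .init
  | @next p h hb hg ih =>
    have hx' := Part.verts_next_subset h.mem hb hx
    rw [Finset.mem_sdiff] at hx'
    have := (ih hx'.1).next hx'.2 hg
    have e : p.next E k x = p.next E k u := by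
      have h1 : component E (p.verts \ p.bag E k)ᶜ x = component E (p.verts \ p.bag E k)ᶜ u :=
        component_eq_of_mem hx
      have h2 := component_eq_of_mem (Part.mem_component_separator hx)
      rw [Part.next, Part.next, h1, h2]
    rwa [e] at this

theorem Reached.exists_iterate (h : Reached E k u p) :
    ∃ j, j + p.verts.card ≤ n ∧ (Part.step E k u)^[j] (.init n) = p := by
  induction h with
  | init => exact ⟨0, by simp [Part.init], rfl⟩
  | @next p h hb hg ih =>
    obtain ⟨j, hj, he⟩ := ih
    refine ⟨j + 1, ?_, ?_⟩
    · have h1 := Finset.card_le_card (Part.verts_next_subset h.mem hb)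
      have h2 := Finset.card_sdiff_add_card_eq_card (Part.bag_subset (E := E) (k := k) (p := p))
      have h3 := Finset.card_pos.2 (Part.bag_nonempty (E := E) (k := k) ⟨u, h.mem⟩)
      omega
    · rw [Function.iterate_succ_apply', he, Part.step, if_neg]
      simp [hb, hg]

theorem Reached.finalPart_eq (h : Reached E k u p) (hu : u ∈ p.bag E k ∨ ¬ p.Good E k) :
    finalPart E k u = p := by
  obtain ⟨j, hj, he⟩ := h.exists_iterate
  have hfix : Part.step E k u p = p := if_pos hu
  have hn : finalPart E k u = (Part.step E k u)^[(n - j) + j] (.init n) :=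
    congrArg (fun m => (Part.step E k u)^[m] (.init n)) (by omega)
  rw [hn, Function.iterate_add_apply, he]
  exact Function.iterate_fixed hfix _

theorem reached_finalPart (u : Fin n) :
    Reached E k u (finalPart E k u) ∧
      (u ∈ (finalPart E k u).bag E k ∨ ¬ (finalPart E k u).Good E k) := by
  have key : ∀ j, Reached E k u ((Part.step E k u)^[j] (.init n)) ∧
      ((u ∈ ((Part.step E k u)^[j] (.init n)).bag E k ∨
        ¬ ((Part.step E k u)^[j] (.init n)).Good E k) ∨
        j + ((Part.step E k u)^[j] (.init n)).verts.card ≤ n) := by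
    intro j
    induction j with
    | zero => exact ⟨.init, .inr (by simp [Part.init])⟩
    | succ j ih =>
      rw [Function.iterate_succ_apply']
      set p := (Part.step E k u)^[j] (.init n)
      by_cases hp : u ∈ p.bag E k ∨ ¬ p.Good E k
      · rw [Part.step, if_pos hp]
        exact ⟨ih.1, .inl hp⟩
      · rw [Part.step, if_neg hp]
        rw [not_or, not_not] at hp
        refine ⟨ih.1.next hp.1 hp.2, .inr ?_⟩
        have h0 := ih.2.resolve_left (by simp [hp])
        have h1 := Finset.card_le_card (Part.verts_next_subset ih.1.mem hp.1)
        have h2 := Finset.card_sdiff_add_card_eq_card (Part.bag_subset (E := E) (k := k) (p := p))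
        have h3 := Finset.card_pos.2 (Part.bag_nonempty (E := E) (k := k) ⟨u, ih.1.mem⟩)
        omega
  refine ⟨(key n).1, (key n).2.resolve_right fun h => ?_⟩
  have := Finset.card_pos.2 ⟨u, (key n).1.mem⟩
  omega

/-- The size of the guards does not exceed `2 * k - 1`: one half of the old guard and the separator
are taken over, and one vertex is added. -/
theorem Reached.card_guard_le (h : Reached E k u p) : p.guard.card ≤ 2 * k - 1 := by
  induction h with
  | init => simp [Part.init]
  | @next p h hb hg ih =>
    have h1 := Finset.card_union_le (p.cutset E k)
      (p.guard ∩ component E (separator E k p.guard) u)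
    have h2 := Part.card_cutset_le hg
    have hu : u ∉ separator E k p.guard := fun h' =>
      hb (Finset.mem_inter.2 ⟨Finset.mem_union_left _ h', h.mem⟩)
    have h3 := hg.2 u hu
    have h4 := hg.1
    simp only [Part.next]
    omega

theorem Reached.guards (h : Reached E k u p) : Guards E p.guard p.verts := by
  induction h with
  | init => exact ⟨by simp [Part.init], fun _ _ _ _ _ _ _ => by simp [Part.init]⟩
  | @next p h hb hg ih =>
    have hsub := Part.verts_next_subset h.mem hb
    have hdisj : Disjoint (p.verts \ p.bag E k) (p.next E k u).guard := by
      refine Finset.disjoint_left.2 fun x hx hx' => ?_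
      rw [Finset.mem_sdiff] at hx
      rcases Finset.mem_union.1 hx' with hx' | hx'
      · exact hx.2 (Finset.mem_inter.2 ⟨hx', hx.1⟩)
      · exact Finset.disjoint_left.1 ih.1 hx.1 (Finset.mem_inter.1 hx').1
    refine ⟨hdisj.mono_left hsub, fun a ha b hb' x hax hxb => ?_⟩
    have haK := mem_component.1 (Part.mem_component_separator ha)
    have hbK := mem_component.1 (Part.mem_component_separator hb')
    have hane : a ∉ (p.next E k u).guard := Finset.disjoint_left.1 hdisj (hsub ha)
    have hcut : p.cutset E k ⊆ (p.next E k u).guard := Finset.subset_union_left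
    have hsep : separator E k p.guard ⊆ (p.next E k u).guard :=
      Finset.subset_union_left.trans hcut
    have haV := Finset.mem_sdiff.1 (hsub ha)
    have hbV := Finset.mem_sdiff.1 (hsub hb')
    -- A walk between `a` and `b` stays in one strong component of the digraph without the
    -- separator, and therefore meets the old guard only in vertices of the new one.
    have hnot : ∀ y, Path E (p.next E k u).guard a y → Path E (p.next E k u).guard y b →
        y ∉ p.guard := by
      intro y hay hyb hy
      refine hay.notMem hane (Finset.mem_union_right _ (Finset.mem_inter.2 ⟨hy, ?_⟩))
      exact mem_component.2 ⟨haK.1.trans (hay.mono hsep), (hyb.mono hsep).trans hbK.2⟩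
    have hmem : ∀ y, Path E (p.next E k u).guard a y → Path E (p.next E k u).guard y b →
        y ∉ (p.verts \ p.bag E k)ᶜ := by
      intro y hay hyb
      have h1 := Path.transfer hnot hay hyb
      have h2 := ih.2 a haV.1 b hbV.1 y h1.1 h1.2
      rw [Finset.mem_compl, not_not, Finset.mem_sdiff]
      exact ⟨h2, fun h => hay.notMem hane (hcut (Finset.mem_inter.1 h).1)⟩
    have h1 := Path.transfer hmem hax hxb
    have ha' := mem_component.1 (show a ∈ component E (p.verts \ p.bag E k)ᶜ u from ha)
    have hb'' := mem_component.1 (show b ∈ component E (p.verts \ p.bag E k)ᶜ u from hb')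
    exact mem_component.2 ⟨ha'.1.trans h1.1, h1.2.trans hb''.2⟩

/-- A part other than the whole digraph is attached to the last vertex of the bag of an earlier
part. -/
theorem Reached.parent (h : Reached E k u p) : p = .init n ∨
    ∃ q r, Reached E k r q ∧ r ∈ q.bag E k ∧ p.parent = {r} ∧ (∀ v ∈ q.bag E k, v ≤ r) ∧
      p.verts ⊆ q.verts \ q.bag E k ∧ p.guard ⊆ q.guard ∪ q.cutset E k := by
  cases h with
  | init => exact .inl rfl
  | @next q h hb hg =>
    obtain ⟨r, hr, he, hle⟩ := exists_greatest_eq (Part.bag_nonempty (E := E) (k := k) ⟨u, h.mem⟩)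
    refine .inr ⟨q, r, h.of_mem (Part.bag_subset hr), hr, he, hle,
      Part.verts_next_subset h.mem hb, ?_⟩
    refine Finset.union_subset Finset.subset_union_right ?_
    exact Finset.inter_subset_left.trans Finset.subset_union_left

theorem Reached.finalPart_eq_of_mem (h : Reached E k u p) (hx : x ∈ p.bag E k) :
    finalPart E k x = p :=
  (h.of_mem (Part.bag_subset hx)).finalPart_eq (.inl hx)

/-- The two ways in which `r` can be the parent of `s`. -/
theorem mem_parentOf {r s : Fin n} (h : r ∈ parentOf E k s) :
    (finalPart E k r = finalPart E k s ∧ r ∈ (finalPart E k s).bag E k ∧ r < s ∧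
      ∀ v ∈ (finalPart E k s).bag E k, v < s → v ≤ r) ∨
    (below ((finalPart E k s).bag E k) s = ∅ ∧ r ∈ (finalPart E k r).bag E k ∧
      (∀ v ∈ (finalPart E k r).bag E k, v ≤ r) ∧
      (finalPart E k s).verts ⊆ (finalPart E k r).verts \ (finalPart E k r).bag E k ∧
      (finalPart E k s).guard ⊆ (finalPart E k r).guard ∪ (finalPart E k r).cutset E k) := by
  have hs := (reached_finalPart (E := E) (k := k) s).1
  rw [parentOf] at h
  split_ifs at h with he
  · rcases hs.parent with hi | ⟨q, r', hr', hb, hp, hle, hv, hg⟩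
    · rw [hi] at h
      simp [Part.init] at h
    · rw [hp, Finset.mem_singleton] at h
      subst h
      have := hr'.finalPart_eq (.inl hb)
      rw [this]
      exact .inr ⟨he, hb, hle, hv, hg⟩
  · obtain ⟨x, hx, hxe, hle⟩ := exists_greatest_eq (Finset.nonempty_iff_ne_empty.2 he)
    rw [hxe, Finset.mem_singleton] at h
    subst h
    rw [mem_below] at hx
    exact .inl ⟨hs.finalPart_eq_of_mem hx.1, hx.1, hx.2, fun v hv hvs =>
      hle v (mem_below.2 ⟨hv, hvs⟩)⟩

/-- If all separators exist, then the parent function describes an arboreal decomposition: the bag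
of every part is a path, traversed in increasing order, and the parts inside it are attached to the
last vertex of that path. -/
theorem parentData (hn : 0 < n) (D : Digraph (Fin n))
    (hgood : ∀ u, (finalPart D.Adj k u).Good D.Adj k) :
    ParentData D (parentOf D.Adj k) (guardOf D.Adj k) (subOf D.Adj k) := by
  have hbag : ∀ u, u ∈ (finalPart D.Adj k u).bag D.Adj k := fun u =>
    (reached_finalPart u).2.resolve_right fun h => h (hgood u)
  have hreach : ∀ u, Reached D.Adj k u (finalPart D.Adj k u) := fun u => (reached_finalPart u).1
  have hself : ∀ s, s ∈ subOf D.Adj k s := fun s =>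
    Finset.mem_sdiff.2 ⟨(hreach s).mem, fun h => (mem_below.1 h).2.false⟩
  refine ⟨hself, fun r s hrs => ?_, fun r x hx hxr => ?_, fun s r hr r' hr' => ?_, ?_, fun s => ?_⟩
  · intro x hx
    rw [subOf, Finset.mem_sdiff, mem_below] at hx
    rw [Finset.mem_erase, subOf, Finset.mem_sdiff, mem_below]
    rcases mem_parentOf hrs with ⟨he, hr, hlt, -⟩ | ⟨he, hr, -, hv, -⟩
    · rw [he]
      refine ⟨?_, hx.1, fun h => hx.2 ⟨h.1, h.2.trans hlt⟩⟩
      rintro rfl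
      exact hx.2 ⟨hr, hlt⟩
    · have := Finset.mem_sdiff.1 (hv hx.1)
      refine ⟨?_, this.1, fun h => this.2 h.1⟩
      rintro rfl
      exact this.2 hr
  · rw [subOf, Finset.mem_sdiff, mem_below] at hx
    set p := finalPart D.Adj k r with hp
    by_cases hlast : ∃ v ∈ p.bag D.Adj k, r < v
    · -- The next vertex of the same bag is a child.
      obtain ⟨s, hs, hmin⟩ := Finset.exists_min_image
        ((p.bag D.Adj k).filter fun v => r < v) _root_.id
        (by obtain ⟨v, hv, hrv⟩ := hlast; exact ⟨v, Finset.mem_filter.2 ⟨hv, hrv⟩⟩)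
      rw [Finset.mem_filter] at hs
      have hfs : finalPart D.Adj k s = p := (hreach r).finalPart_eq_of_mem hs.1
      have hrb : r ∈ below (p.bag D.Adj k) s := mem_below.2 ⟨hbag r, hs.2⟩
      refine ⟨s, ?_, ?_⟩
      · obtain ⟨y, hy, he, hle⟩ := exists_greatest_eq ⟨r, hrb⟩
        rw [parentOf, hfs, if_neg (Finset.ne_empty_of_mem hrb), he, Finset.mem_singleton]
        refine le_antisymm (hle r hrb) (not_lt.1 fun hlt => ?_)
        rw [mem_below] at hy
        exact absurd (hmin y (Finset.mem_filter.2 ⟨hy.1, hlt⟩)) (not_le.2 hy.2)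
      · rw [subOf, hfs, Finset.mem_sdiff, mem_below]
        refine ⟨hx.1, fun h => ?_⟩
        have hrx : r < x := lt_of_le_of_ne (not_lt.1 fun h' => hx.2 ⟨h.1, h'⟩) (Ne.symm hxr)
        exact absurd (hmin x (Finset.mem_filter.2 ⟨h.1, hrx⟩)) (not_le.2 h.2)
    · -- The first vertex in the bag of the part that contains `x` is a child.
      push Not at hlast
      have hxb : x ∉ p.bag D.Adj k := fun h =>
        hx.2 ⟨h, lt_of_le_of_ne (hlast x h) hxr⟩
      have hq := ((hreach r).of_mem hx.1).next hxb (hgood r)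
      set q := p.next D.Adj k x with hqdef
      obtain ⟨y, hy, he⟩ := exists_least_eq (Part.bag_nonempty (E := D.Adj) (k := k) ⟨x, hq.mem⟩)
      have hfy : finalPart D.Adj k y = q := hq.finalPart_eq_of_mem hy
      have hempty : below (q.bag D.Adj k) y = ∅ := by
        refine Finset.eq_empty_of_forall_notMem fun z hz => ?_
        rw [mem_below] at hz
        have : y ∈ least (q.bag D.Adj k) := by simp [he]
        exact (Finset.mem_filter.1 this).2 z hz.1 hz.2
      refine ⟨y, ?_, ?_⟩
      · rw [parentOf, hfy, if_pos hempty]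
        exact Finset.mem_filter.2 ⟨hbag r, fun v hv => not_lt.2 (hlast v hv)⟩
      · rw [subOf, hfy, hempty, Finset.sdiff_empty]
        exact hq.mem
  · rw [parentOf] at hr hr'
    split_ifs at hr hr' with h
    · rcases (hreach s).parent with hi | ⟨q, r'', -, -, he, -⟩
      · rw [hi] at hr
        simp [Part.init] at hr
      · rw [he, Finset.mem_singleton] at hr hr'
        rw [hr, hr']
    · obtain ⟨x, -, he, -⟩ := exists_greatest_eq (Finset.nonempty_iff_ne_empty.2 h)
      rw [he, Finset.mem_singleton] at hr hr'
      rw [hr, hr']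
  · have hi : Reached D.Adj k ⟨0, hn⟩ (.init n) := .init
    obtain ⟨y, hy, he⟩ := exists_least_eq (Part.bag_nonempty (E := D.Adj) (k := k) ⟨_, hi.mem⟩)
    have hfy : finalPart D.Adj k y = .init n := hi.finalPart_eq_of_mem hy
    have hempty : below ((Part.init n).bag D.Adj k) y = ∅ := by
      refine Finset.eq_empty_of_forall_notMem fun z hz => ?_
      rw [mem_below] at hz
      have : y ∈ least ((Part.init n).bag D.Adj k) := by simp [he]
      exact (Finset.mem_filter.1 this).2 z hz.1 hz.2
    refine ⟨y, ?_, ?_⟩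
    · rw [parentOf, hfy, if_pos hempty]
      rfl
    · rw [subOf, hfy, hempty, Finset.sdiff_empty]
      rfl
  · have hg := (hreach s).guards
    refine ⟨Finset.disjoint_left.2 fun x hx hx' => ?_, fun a ha b hb x hax hxb => ?_⟩
    · rw [subOf, Finset.mem_sdiff] at hx
      rcases Finset.mem_union.1 hx' with hx' | hx'
      · exact Finset.disjoint_left.1 hg.1 hx.1 hx'
      · exact hx.2 hx'
    · rw [subOf, Finset.mem_sdiff] at ha hb ⊢
      have hsub : (finalPart D.Adj k s).guard ⊆ guardOf D.Adj k s := Finset.subset_union_left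
      refine ⟨hg.2 a ha.1 b hb.1 x (hax.mono hsub) (hxb.mono hsub), fun h => ?_⟩
      refine hax.notMem (fun h' => ?_) (Finset.mem_union_right _ h)
      rcases Finset.mem_union.1 h' with h' | h'
      · exact Finset.disjoint_left.1 hg.1 ha.1 h'
      · exact ha.2 h'

/-- The vertex of a node and all guards at it lie in the union of the guard and the cutset of its
part. -/
theorem exists_node_bound (hgood : ∀ u, (finalPart E k u).Good E k) (r : Fin n) :
    ∃ N : Finset (Fin n), N.card ≤ 3 * k - 1 ∧ r ∈ N ∧ guardOf E k r ⊆ N ∧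
      ∀ s, r ∈ parentOf E k s → guardOf E k s ⊆ N := by
  have hr := (reached_finalPart (E := E) (k := k) r).1
  have hbag : ∀ u, u ∈ (finalPart E k u).bag E k := fun u =>
    (reached_finalPart u).2.resolve_right fun h => h (hgood u)
  have hbelow : ∀ p : Part n, ∀ s, below (p.bag E k) s ⊆ p.cutset E k := fun p s v hv =>
    (Finset.mem_inter.1 (mem_below.1 hv).1).1
  refine ⟨(finalPart E k r).guard ∪ (finalPart E k r).cutset E k, ?_, ?_, ?_, fun s hs => ?_⟩
  · have h1 := Finset.card_union_le (finalPart E k r).guard ((finalPart E k r).cutset E k)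
    have h2 := hr.card_guard_le
    have h3 := Part.card_cutset_le (hgood r)
    have h4 := (hgood r).1
    omega
  · exact Finset.mem_union_right _ (Finset.mem_inter.1 (hbag r)).1
  · exact Finset.union_subset_union_right (hbelow _ r)
  · rcases mem_parentOf hs with ⟨he, -⟩ | ⟨he, -, -, -, hg⟩
    · rw [he]
      exact Finset.union_subset_union_right (hbelow _ s)
    · rw [guardOf, he, Finset.union_empty]
      exact hg

/-- If the algorithm fails to find a separator, then there is none, and there is a haven. -/
theorem hasHaven_of_not_good (hn : 0 < n) (D : Digraph (Fin n)) {u : Fin n}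
    (h : ¬ (finalPart D.Adj k u).Good D.Adj k) : HasHaven D k :=
  hasHaven_of_not_balanced hn fun _ hZ => h
    (balanced_separator ((reached_finalPart u).1.card_guard_le.trans (Nat.sub_le _ _)) hZ)

end Algorithm

/-! ### Running time of the algorithm -/

section Sets
variable {I : Type*} {s : I → ℕ} {c : I → Val} {n : I → ℕ}
  {S T Z : ∀ i, Finset (Fin (n i))} {u v : ∀ i, Fin (n i)}

theorem PolyTime.empty (hn : PolyNat s c n) :
    PolyTime s c (fun i => encodeSet (∅ : Finset (Fin (n i)))) :=
  .set hn (PolyTime.false.bit_congr fun _ => by simp)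

theorem PolyTime.univ (hn : PolyNat s c n) :
    PolyTime s c (fun i => encodeSet (Finset.univ : Finset (Fin (n i)))) :=
  .set hn (PolyTime.true.bit_congr fun _ => by simp)

theorem PolyTime.singleton (hn : PolyNat s c n) (hv : PolyTime s c (fun i => encodeNat (v i))) :
    PolyTime s c (fun i => encodeSet ({v i} : Finset (Fin (n i)))) :=
  .set hn ((PolyTime.eqFin (hn.2.comp _) (.top _) hv.wk).bit_congr fun _ => by simp)

theorem PolyTime.union (hn : PolyNat s c n) (hS : PolyTime s c (fun i => encodeSet (S i)))
    (hT : PolyTime s c (fun i => encodeSet (T i))) :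
    PolyTime s c (fun i => encodeSet (S i ∪ T i)) :=
  .set hn (((PolyTime.mem (hn.2.comp _) hS.wk (.top _)).or
    (.mem (hn.2.comp _) hT.wk (.top _))).bit_congr fun _ => by simp)

theorem PolyTime.inter (hn : PolyNat s c n) (hS : PolyTime s c (fun i => encodeSet (S i)))
    (hT : PolyTime s c (fun i => encodeSet (T i))) :
    PolyTime s c (fun i => encodeSet (S i ∩ T i)) :=
  .set hn (((PolyTime.mem (hn.2.comp _) hS.wk (.top _)).and
    (.mem (hn.2.comp _) hT.wk (.top _))).bit_congr fun _ => by simp)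

theorem PolyTime.compl (hn : PolyNat s c n) (hS : PolyTime s c (fun i => encodeSet (S i))) :
    PolyTime s c (fun i => encodeSet (S i)ᶜ) :=
  .set hn ((PolyTime.mem (hn.2.comp _) hS.wk (.top _)).not.bit_congr fun _ => by simp)

theorem PolyTime.sdiff (hn : PolyNat s c n) (hS : PolyTime s c (fun i => encodeSet (S i)))
    (hT : PolyTime s c (fun i => encodeSet (T i))) :
    PolyTime s c (fun i => encodeSet (S i \ T i)) :=
  (PolyTime.inter hn hS (.compl hn hT)).congr fun i => by rw [Finset.sdiff_eq_inter_compl]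

theorem PolyTime.below (hn : PolyNat s c n) (hS : PolyTime s c (fun i => encodeSet (S i)))
    (hv : PolyTime s c (fun i => encodeNat (v i))) :
    PolyTime s c (fun i => encodeSet (below (S i) (v i))) :=
  .set hn (((PolyTime.mem (hn.2.comp _) hS.wk (.top _)).and
    (.ltFin (hn.2.comp _) (.top _) hv.wk)).bit_congr fun _ => by simp [Arboreal.below])

theorem PolyTime.least (hn : PolyNat s c n) (hS : PolyTime s c (fun i => encodeSet (S i))) :
    PolyTime s c (fun i => encodeSet (least (S i))) :=
  .set hn (((PolyTime.mem (hn.2.comp _) hS.wk (.top _)).and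
    (.forall (P := fun (j : Σ i, Fin (n i)) y => y ∈ S j.1 → ¬ y < j.2) hn.wk
      ((PolyTime.mem (hn.2.comp _) hS.lift₂ (.top _)).imp
        (PolyTime.ltFin (hn.2.comp _) (.top _) (.top₂ _ _)).not))).bit_congr
    fun _ => by simp [Arboreal.least])

theorem PolyTime.greatest (hn : PolyNat s c n) (hS : PolyTime s c (fun i => encodeSet (S i))) :
    PolyTime s c (fun i => encodeSet (greatest (S i))) :=
  .set hn (((PolyTime.mem (hn.2.comp _) hS.wk (.top _)).and
    (.forall (P := fun (j : Σ i, Fin (n i)) y => y ∈ S j.1 → ¬ j.2 < y) hn.wk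
      ((PolyTime.mem (hn.2.comp _) hS.lift₂ (.top _)).imp
        (PolyTime.ltFin (hn.2.comp _) (.top₂ _ _) (.top _)).not))).bit_congr
    fun _ => by simp [Arboreal.greatest])

theorem PolyTime.isEmpty (hn : PolyNat s c n) (hS : PolyTime s c (fun i => encodeSet (S i))) :
    PolyTime s c (fun i => encodeBit (S i = ∅)) :=
  (PolyTime.forall (P := fun i v => v ∉ S i) hn
    (PolyTime.mem (hn.2.comp _) hS.wk (.top _)).not).bit_congr fun _ =>
      Finset.eq_empty_iff_forall_notMem.symm

theorem PolyTime.subset (hn : PolyNat s c n) (hS : PolyTime s c (fun i => encodeSet (S i)))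
    (hT : PolyTime s c (fun i => encodeSet (T i))) :
    PolyTime s c (fun i => encodeBit (S i ⊆ T i)) :=
  .forall (P := fun i v => v ∈ S i → v ∈ T i) hn
    ((PolyTime.mem (hn.2.comp _) hS.wk (.top _)).imp (.mem (hn.2.comp _) hT.wk (.top _)))

theorem PolyNat.rank (hn : PolyNat s c n) (hS : PolyTime s c (fun i => encodeSet (S i)))
    (hv : PolyTime s c (fun i => encodeNat (v i))) :
    PolyNat s c (fun i => rank (S i) (v i)) :=
  .cardSet hn (.below hn hS hv)

theorem PolyTime.layer {r : ∀ i, Fin (n i) → Fin (n i) → Prop} {m : I → ℕ} (hn : PolyNat s c n)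
    (hr : PolyTime s c (fun i => encodeRel (r i))) (hS : PolyTime s c (fun i => encodeSet (S i)))
    (hm : PolyNat s c m) : PolyTime s c (fun i => encodeSet (layer (r i) (S i) (m i))) := by
  refine .iterate (σ := fun i => Finset (Fin (n i))) (enc := fun _ => encodeSet)
    (f := fun i => expand (r i)) hm hS (.set hn.wk (PolyTime.bit_congr (.or
      (.mem (hn.2.comp _) (.top₂ _ _) (.top _))
      (.exists (P := fun (j : Σ j : Σ i, Finset (Fin (n i)), Fin (n j.1)) y =>
          y ∈ j.1.2 ∧ r j.1.1 j.2 y)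
        hn.lift₂
        (.and (.mem (hn.2.comp _) (.top₃ _ _ _) (.top _))
          (.relApply (hn.2.comp _) hr.lift₃
            (.top₂ _ _) (.top _))))) fun j => ?_))
  simp [mem_expand]

theorem PolyTime.path {E : ∀ i, Fin (n i) → Fin (n i) → Prop} (hn : PolyNat s c n)
    (hE : PolyTime s c (fun i => encodeRel (E i))) (hZ : PolyTime s c (fun i => encodeSet (Z i))) :
    PolyTime s c (fun i => encodeRel (Path (E i) (Z i))) := by
  have hav : PolyTime s c (fun i => encodeRel (Avoiding (E i) (Z i))) :=
    .rel hn (.and (.relApply (hn.2.comp _) hE.lift₂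
        (.top₂ _ _) (.top _))
      (.and (PolyTime.mem (hn.2.comp _) hZ.lift₂ (.top₂ _ _)).not
        (PolyTime.mem (hn.2.comp _) hZ.lift₂ (.top _)).not))
  refine .rel hn (PolyTime.bit_congr (.mem (hn.2.comp _)
    (.layer hn.lift₂ hav.lift₂ (.singleton hn.lift₂ (.top _)) hn.lift₂) (.top₂ _ _))
    fun j => ?_)
  rw [mem_layer]
  simp [Path]

theorem PolyTime.component {E : ∀ i, Fin (n i) → Fin (n i) → Prop} (hn : PolyNat s c n)
    (hE : PolyTime s c (fun i => encodeRel (E i))) (hZ : PolyTime s c (fun i => encodeSet (Z i)))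
    (hu : PolyTime s c (fun i => encodeNat (u i))) :
    PolyTime s c (fun i => encodeSet (Arboreal.component (E i) (Z i) (u i))) := by
  have hp := PolyTime.path hn hE hZ
  exact .set hn (PolyTime.bit_congr (.and (.relApply (hn.2.comp _) hp.wk hu.wk (.top _))
    (.relApply (hn.2.comp _) hp.wk (.top _) hu.wk)) fun j => mem_component.symm)

theorem PolyTime.balanced {E : ∀ i, Fin (n i) → Fin (n i) → Prop} {k : I → ℕ}
    (hn : PolyNat s c n) (hk : PolyNat s c k) (hE : PolyTime s c (fun i => encodeRel (E i)))
    (hT : PolyTime s c (fun i => encodeSet (T i))) (hZ : PolyTime s c (fun i => encodeSet (Z i))) :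
    PolyTime s c (fun i => encodeBit (Balanced (E i) (k i) (T i) (Z i))) :=
  .and (.lt (.cardSet hn hZ) hk)
    (.forall (P := fun i u => u ∉ Z i →
        2 * (T i ∩ Arboreal.component (E i) (Z i) u).card ≤ (T i).card) hn
      (.imp (PolyTime.mem (hn.2.comp _) hZ.wk (.top _)).not
        (.le (.mul (.const 2) (.cardSet hn.wk (.inter hn.wk hT.wk
          (.component hn.wk hE.wk hZ.wk (.top _))))) (.cardSet hn.wk hT.wk))))

end Sets

section Flow
variable {I : Type*} {s : I → ℕ} {c : I → Val} {m k : I → ℕ}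
  {w : ∀ i, Fin (m i) → Fin (m i) → ℕ} {A S X Y : ∀ i, Finset (Fin (m i))}

theorem PolyTime.residual (hm : PolyNat s c m) (hw : PolyTime s c (fun i => encodeMatrix (w i))) :
    PolyTime s c (fun i => encodeRel (Residual (w i))) :=
  .rel hm (PolyTime.matrixApply (hm.2.comp _) hw.lift₂
    (.top₂ _ _) (.top _)).pos

theorem PolyTime.reverseArc (hm : PolyNat s c m)
    (hw : PolyTime s c (fun i => encodeMatrix (w i))) (hX : PolyTime s c (fun i => encodeSet (X i)))
    (hY : PolyTime s c (fun i => encodeSet (Y i))) :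
    PolyTime s c (fun i => encodeMatrix (reverseArc (w i) (X i) (Y i))) := by
  classical
  have hw' : PolyTime (fun j : Σ j : Σ i, Fin (m i), Fin (m j.1) => s j.1.1)
      (fun j => .cons (encodeNat j.2) (.cons (encodeNat j.1.2) (c j.1.1)))
      (fun j => encodeNat (w j.1.1 j.1.2 j.2)) :=
    .matrixApply (hm.2.comp _) hw.lift₂ (.top₂ _ _) (.top _)
  refine .matrix hm (PolyTime.congr (.ite
    (P := fun j : Σ j : Σ i, Fin (m i), Fin (m j.1) => j.1.2 ∈ X j.1.1 ∧ j.2 ∈ Y j.1.1)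
    (.and (.mem (hm.2.comp _) hX.lift₂ (.top₂ _ _)) (.mem (hm.2.comp _) hY.lift₂ (.top _)))
    hw'.pred (.ite
    (P := fun j : Σ j : Σ i, Fin (m i), Fin (m j.1) => j.1.2 ∈ Y j.1.1 ∧ j.2 ∈ X j.1.1)
    (.and (.mem (hm.2.comp _) hY.lift₂ (.top₂ _ _)) (.mem (hm.2.comp _) hX.lift₂ (.top _)))
    hw'.succ hw')) fun j => ?_)
  simp only [Arboreal.reverseArc]
  split_ifs <;> rfl

theorem PolyTime.augment (hm : PolyNat s c m) (hw : PolyTime s c (fun i => encodeMatrix (w i)))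
    (hA : PolyTime s c (fun i => encodeSet (A i))) (hS : PolyTime s c (fun i => encodeSet (S i))) :
    PolyTime s c (fun i => encodeMatrix (augment (A i) (S i) (w i))) := by
  classical
  have hr := PolyTime.residual hm hw
  have hinit := PolyTime.cons (.least hm (.inter hm hA (.layer hm hr hS hm))) hw
  refine (PolyTime.foldr (σ := fun i => Finset (Fin (m i)) × (Fin (m i) → Fin (m i) → ℕ))
    (enc := fun _ q => .cons (encodeSet q.1) (encodeMatrix q.2))
    (f := fun i j q => augmentStep (w i) (S i) j q) hm hinit ?_).tl
  set J := Σ i, Fin (m i) × Finset (Fin (m i)) × (Fin (m i) → Fin (m i) → ℕ)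
  let ctx : J → Val := fun j => .cons (encodeNat j.2.1)
    (.cons (.cons (encodeSet j.2.2.1) (encodeMatrix j.2.2.2)) (c j.1))
  have hm' := hm.wk₂ (β := fun i => Fin (m i) × Finset (Fin (m i)) × (Fin (m i) → Fin (m i) → ℕ))
    (u := fun j => encodeNat j.2.1)
    (v := fun j => .cons (encodeSet j.2.2.1) (encodeMatrix j.2.2.2))
  have hr' : PolyTime (fun j : J => s j.1) ctx (fun j => encodeRel (Residual (w j.1))) := hr.wk₂
  have hL := PolyTime.layer hm' hr' hS.wk₂ (.fin (hm.2.comp _) (.top _))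
  have hq : PolyTime (fun j : J => s j.1) ctx (fun j : J =>
      .cons (encodeSet j.2.2.1) (encodeMatrix j.2.2.2)) := .top₂ _ _
  have hX : PolyTime (fun j : J => s j.1) ctx (fun j : J => encodeSet j.2.2.1) := hq.hd
  have hW : PolyTime (fun j : J => s j.1) ctx (fun j : J => encodeMatrix j.2.2.2) := hq.tl
  have hY := PolyTime.least (S := fun j : J =>
      {y ∈ Arboreal.layer (Residual (w j.1)) (S j.1) j.2.1 |
        ∃ x ∈ j.2.2.1, Residual (w j.1) x y}) hm'
    (.set hm' (PolyTime.bit_congr (.and (.mem (hm.2.comp _) hL.wk (.top _))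
      (.exists (P := fun (j' : Σ j : J, Fin (m j.1)) x =>
          x ∈ j'.1.2.2.1 ∧ Residual (w j'.1.1) x j'.2) hm'.wk
        (.and (.mem (hm.2.comp _) hX.lift₂ (.top _))
          (.relApply (hm.2.comp _) hr'.lift₂ (.top _) (.top₂ _ _)))))
      fun j => by simp))
  refine (PolyTime.ite (.subset hm' hX hL) hq (.cons hY (.reverseArc hm' hW hX hY))).congr
    fun j => ?_
  rw [augmentStep]
  split_ifs <;> rfl

theorem PolyTime.farCut (hm : PolyNat s c m) (hk : PolyNat s c k)
    (hw : PolyTime s c (fun i => encodeMatrix (w i)))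
    (hA : PolyTime s c (fun i => encodeSet (A i))) (hS : PolyTime s c (fun i => encodeSet (S i))) :
    PolyTime s c (fun i => encodeSet (farCut (k i) (w i) (A i) (S i))) := by
  have h := PolyTime.iterate (σ := fun i => Fin (m i) → Fin (m i) → ℕ)
    (enc := fun _ => encodeMatrix) (f := fun i => Arboreal.augment (A i) (S i)) hk hw
    (.augment hm.wk (.top _) hA.wk hS.wk)
  exact .compl hm (.layer hm (.residual hm h) hS hm)

end Flow

section Separator
variable {I : Type*} {s : I → ℕ} {c : I → Val} {n k q a : I → ℕ}
  {E : ∀ i, Fin (n i) → Fin (n i) → Prop} {U C S T : ∀ i, Finset (Fin (n i))}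
  {R : ∀ i, Finset (Fin (n i + n i))} {v : ∀ i, Fin (n i)}

theorem PolyTime.castAdd (hv : PolyTime s c (fun i => encodeNat (v i))) :
    PolyTime s c (fun i => encodeNat (Fin.castAdd (n i) (v i))) := hv

theorem PolyTime.natAdd (hn : PolyNat s c n) (hv : PolyTime s c (fun i => encodeNat (v i))) :
    PolyTime s c (fun i => encodeNat (Fin.natAdd (n i) (v i))) :=
  (hn.1.add (.fin hn.2 hv)).congr fun _ => rfl

theorem PolyTime.splitWeight (hn : PolyNat s c n) (hk : PolyNat s c k)
    (hE : PolyTime s c (fun i => encodeRel (E i))) (hU : PolyTime s c (fun i => encodeSet (U i))) :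
    PolyTime s c (fun i => encodeMatrix (splitWeight (E i) (k i) (U i))) := by
  classical
  have hN := hn.add hn
  refine .matrix hN (PolyTime.congr (.ite
    (P := fun j : Σ j : Σ i, Fin (n i + n i), Fin (n j.1 + n j.1) =>
      ∃ v, v ∉ U j.1.1 ∧ j.1.2 = Fin.castAdd (n j.1.1) v ∧
      j.2 = Fin.natAdd (n j.1.1) v)
    (.exists hn.lift₂ (.and (PolyTime.mem (hn.2.comp _) hU.lift₃ (.top _)).not
      (.and (.eqFin (hN.2.comp _) (.top₃ _ _ _) (.castAdd (.top _)))
        (.eqFin (hN.2.comp _) (.top₂ _ _) (.natAdd hn.lift₃ (.top _))))))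
    (PolyNat.const 1).1
    (.ite (P := fun j : Σ j : Σ i, Fin (n i + n i), Fin (n j.1 + n j.1) =>
        ∃ u v, E j.1.1 u v ∧ j.1.2 = Fin.natAdd (n j.1.1) u ∧
        j.2 = Fin.castAdd (n j.1.1) v)
      (.exists hn.lift₂ (.exists
        (P := fun (j' : Σ j : Σ j : Σ i, Fin (n i + n i), Fin (n j.1 + n j.1), Fin (n j.1.1)) v =>
          E j'.1.1.1 j'.2 v ∧ j'.1.1.2 = Fin.natAdd (n j'.1.1.1) j'.2 ∧
          j'.1.2 = Fin.castAdd (n j'.1.1.1) v) hn.lift₃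
        (.and (.relApply (hn.2.comp _) hE.lift₄ (.top₂ _ _) (.top _))
          (.and (.eqFin (hN.2.comp _) (.top₄ _ _ _ _)
              (.natAdd hn.lift₄ (.top₂ _ _)))
            (.eqFin (hN.2.comp _) (.top₃ _ _ _) (.castAdd (.top _)))))))
      hk.lift₂.1 .nil)) fun j => ?_)
  simp only [Arboreal.splitWeight]
  split_ifs <;> rfl

theorem PolyTime.crossing (hn : PolyNat s c n) (hU : PolyTime s c (fun i => encodeSet (U i)))
    (hR : PolyTime s c (fun i => encodeSet (R i))) :
    PolyTime s c (fun i => encodeSet (crossing (U i) (R i))) :=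
  .set hn (PolyTime.bit_congr (.and (PolyTime.mem (hn.2.comp _) hU.wk (.top _)).not
    (.and (.mem ((hn.add hn).2.comp _) hR.wk (.castAdd (.top _)))
      (PolyTime.mem ((hn.add hn).2.comp _) hR.wk (.natAdd hn.wk (.top _))).not))
    fun _ => mem_crossing.symm)

theorem PolyTime.sources (hn : PolyNat s c n) (hS : PolyTime s c (fun i => encodeSet (S i))) :
    PolyTime s c (fun i => encodeSet (sources (S i))) :=
  .set (hn.add hn) (PolyTime.bit_congr
    (.exists (P := fun (j : Σ i, Fin (n i + n i)) v => v ∈ S j.1 ∧ j.2 = Fin.natAdd (n j.1) v) hn.wk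
      (.and (.mem (hn.2.comp _) hS.lift₂ (.top _))
        (.eqFin ((hn.add hn).2.comp _) (.top₂ _ _) (.natAdd hn.lift₂ (.top _)))))
    fun _ => by simp [Arboreal.sources])

theorem PolyTime.sinks (hn : PolyNat s c n) (hS : PolyTime s c (fun i => encodeSet (S i))) :
    PolyTime s c (fun i => encodeSet (sinks (S i))) :=
  .set (hn.add hn) (PolyTime.bit_congr
    (.exists (P := fun (j : Σ i, Fin (n i + n i)) v =>
        v ∈ S j.1 ∧ j.2 = Fin.castAdd (n j.1) v) hn.wk
      (.and (.mem (hn.2.comp _) hS.lift₂ (.top _))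
        (.eqFin ((hn.add hn).2.comp _) (.top₂ _ _) (.castAdd (.top _)))))
    fun _ => by simp [Arboreal.sinks])

theorem PolyTime.pushStep (hn : PolyNat s c n) (hk : PolyNat s c k)
    (hE : PolyTime s c (fun i => encodeRel (E i))) (hU : PolyTime s c (fun i => encodeSet (U i)))
    (hS : PolyTime s c (fun i => encodeSet (S i))) (ha : PolyNat s c a)
    (hR : PolyTime s c (fun i => encodeSet (R i))) :
    PolyTime s c (fun i => encodeSet (pushStep (E i) (k i) (U i) (S i) (a i) (R i))) := by
  have hN := hn.add hn
  have hc := PolyTime.crossing hn hU hR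
  exact .farCut hN hk (.splitWeight hn hk hE hU) (.union hN hR (.sources hn (.set hn
    (PolyTime.bit_congr (.and (.mem (hn.2.comp _) hc.wk (.top _))
      (.eq (.rank hn.wk hc.wk (.top _)) ha.wk)) fun _ => by simp)))) (.sinks hn hS)

theorem PolyNat.digits (hk : PolyNat s c k) (hq : PolyNat s c q) (ha : PolyNat s c a) :
    PolyNat s c (fun i => digits (k i) (q i) (a i)) :=
  .digit hq (hk.add (.const 4)) ha fun _ => by omega

theorem PolyTime.pushes (hn : PolyNat s c n) (hk : PolyNat s c k) (hq : PolyNat s c q)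
    (hE : PolyTime s c (fun i => encodeRel (E i))) (hU : PolyTime s c (fun i => encodeSet (U i)))
    (hC : PolyTime s c (fun i => encodeSet (C i))) (hS : PolyTime s c (fun i => encodeSet (S i))) :
    PolyTime s c (fun i => encodeSet (pushes (E i) (k i) (U i) (C i) (S i)
      (fun a => Arboreal.digits (k i) (q i) (2 * k i + a)) (k i))) := by
  have hN := hn.add hn
  exact .foldr (σ := fun i => Finset (Fin (n i + n i))) (enc := fun _ => encodeSet)
    (f := fun i a R => Arboreal.pushStep (E i) (k i) (U i) (S i)
      (Arboreal.digits (k i) (q i) (2 * k i + a)) R) hk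
    (.farCut hN hk (.splitWeight hn hk hE hU) (.sources hn hC) (.sinks hn hS))
    (.pushStep hn.wk₂ hk.wk₂ hE.wk₂ hU.wk₂ hS.wk₂
      (.digits hk.wk₂ hq.wk₂ (.add (.mul (.const 2) hk.wk₂) (.fin (hk.2.comp _) (.top _))))
      (.top₂ _ _))

theorem PolyTime.labelled (hn : PolyNat s c n) (hk : PolyNat s c k) (hq : PolyNat s c q)
    (hT : PolyTime s c (fun i => encodeSet (T i))) (a : ℕ) :
    PolyTime s c (fun i => encodeSet (labelled (T i) (Arboreal.digits (k i) (q i)) a)) :=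
  .set hn (PolyTime.bit_congr (.and (.mem (hn.2.comp _) hT.wk (.top _))
    (.eq (.digits hk.wk hq.wk (.rank hn.wk hT.wk (.top _))) (.const a)))
    fun _ => by simp [Arboreal.labelled])

theorem PolyTime.candidate (hn : PolyNat s c n) (hk : PolyNat s c k) (hq : PolyNat s c q)
    (hE : PolyTime s c (fun i => encodeRel (E i))) (hT : PolyTime s c (fun i => encodeSet (T i))) :
    PolyTime s c (fun i => encodeSet
      (candidate (E i) (k i) (T i) (Arboreal.digits (k i) (q i)))) := by
  have hl := PolyTime.labelled hn hk hq hT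
  have h1 : PolyTime s c (fun i => encodeSet
      (candidate₁ (E i) (k i) (T i) (Arboreal.digits (k i) (q i)))) :=
    .union hn (hl 3) (.crossing hn (hl 3)
      (.pushes hn hk hq hE (hl 3) (hl 2) (.union hn (hl 0) (hl 1))))
  exact .union hn h1 (.crossing hn h1 (.farCut (hn.add hn) hk (.splitWeight hn hk hE h1)
    (.sources hn (hl 1)) (.sinks hn (hl 0))))

theorem PolyTime.separator (hn : PolyNat s c n) (hk : PolyNat s c k)
    (hw : PolyNat s c (fun i => (k i + 4) ^ (3 * k i)))
    (hE : PolyTime s c (fun i => encodeRel (E i))) (hT : PolyTime s c (fun i => encodeSet (T i))) :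
    PolyTime s c (fun i => encodeSet (separator (E i) (k i) (T i))) := by
  classical
  refine .foldr (σ := fun i => Finset (Fin (n i))) (enc := fun _ => encodeSet)
    (f := fun i q acc => if Balanced (E i) (k i) (T i)
      (Arboreal.candidate (E i) (k i) (T i) (Arboreal.digits (k i) q)) then
        Arboreal.candidate (E i) (k i) (T i) (Arboreal.digits (k i) q) else acc) hw (.empty hn) ?_
  have hc := PolyTime.candidate (q := fun j : Σ i, Fin ((k i + 4) ^ (3 * k i)) ×
      Finset (Fin (n i)) => j.2.1) (hn.wk₂ (u := fun j => encodeNat j.2.1)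
      (v := fun j => encodeSet j.2.2)) hk.wk₂ (.fin (hw.2.comp _) (.top _)) hE.wk₂ hT.wk₂
  exact (PolyTime.ite (.balanced hn.wk₂ hk.wk₂ hE.wk₂ hT.wk₂ hc) hc (.top₂ _ _)).congr fun j =>
    (apply_ite encodeSet _ _ _).symm

end Separator

/-- A part is written as the list of its three sets. -/
noncomputable def Part.encode {n : ℕ} (p : Part n) : Val :=
  .cons (encodeSet p.verts) (.cons (encodeSet p.guard) (encodeSet p.parent))

section Decomposition
variable {I : Type*} {s : I → ℕ} {c : I → Val} {n k : I → ℕ}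
  {E : ∀ i, Fin (n i) → Fin (n i) → Prop} {p : ∀ i, Part (n i)} {u : ∀ i, Fin (n i)}

theorem PolyTime.verts (hp : PolyTime s c (fun i => (p i).encode)) :
    PolyTime s c (fun i => encodeSet (p i).verts) := hp.hd

theorem PolyTime.guard (hp : PolyTime s c (fun i => (p i).encode)) :
    PolyTime s c (fun i => encodeSet (p i).guard) := hp.tl.hd

theorem PolyTime.parent (hp : PolyTime s c (fun i => (p i).encode)) :
    PolyTime s c (fun i => encodeSet (p i).parent) := hp.tl.tl

theorem PolyTime.cutset (hn : PolyNat s c n) (hk : PolyNat s c k)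
    (hw : PolyNat s c (fun i => (k i + 4) ^ (3 * k i)))
    (hE : PolyTime s c (fun i => encodeRel (E i)))
    (hp : PolyTime s c (fun i => (p i).encode)) :
    PolyTime s c (fun i => encodeSet ((p i).cutset (E i) (k i))) :=
  .union hn (.separator hn hk hw hE hp.guard) (.least hn hp.verts)

theorem PolyTime.bag (hn : PolyNat s c n) (hk : PolyNat s c k)
    (hw : PolyNat s c (fun i => (k i + 4) ^ (3 * k i)))
    (hE : PolyTime s c (fun i => encodeRel (E i)))
    (hp : PolyTime s c (fun i => (p i).encode)) :
    PolyTime s c (fun i => encodeSet ((p i).bag (E i) (k i))) :=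
  .inter hn (.cutset hn hk hw hE hp) hp.verts

theorem PolyTime.good (hn : PolyNat s c n) (hk : PolyNat s c k)
    (hw : PolyNat s c (fun i => (k i + 4) ^ (3 * k i)))
    (hE : PolyTime s c (fun i => encodeRel (E i)))
    (hp : PolyTime s c (fun i => (p i).encode)) :
    PolyTime s c (fun i => encodeBit ((p i).Good (E i) (k i))) :=
  .balanced hn hk hE hp.guard (.separator hn hk hw hE hp.guard)

theorem PolyTime.next (hn : PolyNat s c n) (hk : PolyNat s c k)
    (hw : PolyNat s c (fun i => (k i + 4) ^ (3 * k i)))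
    (hE : PolyTime s c (fun i => encodeRel (E i)))
    (hu : PolyTime s c (fun i => encodeNat (u i)))
    (hp : PolyTime s c (fun i => (p i).encode)) :
    PolyTime s c (fun i => ((p i).next (E i) (k i) (u i)).encode) :=
  have hb := PolyTime.bag hn hk hw hE hp
  .cons (.component hn hE (.compl hn (.sdiff hn hp.verts hb)) hu)
    (.cons (.union hn (.cutset hn hk hw hE hp) (.inter hn hp.guard
      (.component hn hE (.separator hn hk hw hE hp.guard) hu))) (.greatest hn hb))

theorem PolyTime.finalPart (hn : PolyNat s c n) (hk : PolyNat s c k)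
    (hw : PolyNat s c (fun i => (k i + 4) ^ (3 * k i)))
    (hE : PolyTime s c (fun i => encodeRel (E i)))
    (hu : PolyTime s c (fun i => encodeNat (u i))) :
    PolyTime s c (fun i => (finalPart (E i) (k i) (u i)).encode) := by
  classical
  refine .iterate (σ := fun i => Part (n i)) (enc := fun _ => Part.encode)
    (f := fun i => Part.step (E i) (k i) (u i)) hn
    (.cons (.univ hn) (.cons (.empty hn) (.empty hn))) ?_
  have hp : PolyTime (fun j : Σ i, Part (n i) => s j.1) (fun j => .cons j.2.encode (c j.1))
    (fun j => j.2.encode) := .top _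
  refine (PolyTime.ite (.or (.mem (hn.2.comp _) (.bag hn.wk hk.wk hw.wk hE.wk hp) hu.wk)
    (PolyTime.good hn.wk hk.wk hw.wk hE.wk hp).not) hp
    (.next hn.wk hk.wk hw.wk hE.wk hu.wk hp)).congr fun j => ?_
  rw [Part.step]
  split_ifs <;> rfl

theorem PolyTime.parentOf (hn : PolyNat s c n) (hk : PolyNat s c k)
    (hw : PolyNat s c (fun i => (k i + 4) ^ (3 * k i)))
    (hE : PolyTime s c (fun i => encodeRel (E i)))
    (hu : PolyTime s c (fun i => encodeNat (u i))) :
    PolyTime s c (fun i => encodeSet (parentOf (E i) (k i) (u i))) := by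
  classical
  have hp := PolyTime.finalPart hn hk hw hE hu
  have hb := PolyTime.below hn (.bag hn hk hw hE hp) hu
  refine (PolyTime.ite (.isEmpty hn hb) hp.parent (.greatest hn hb)).congr fun i => ?_
  rw [Arboreal.parentOf]
  split_ifs <;> rfl

theorem PolyTime.guardOf (hn : PolyNat s c n) (hk : PolyNat s c k)
    (hw : PolyNat s c (fun i => (k i + 4) ^ (3 * k i)))
    (hE : PolyTime s c (fun i => encodeRel (E i)))
    (hu : PolyTime s c (fun i => encodeNat (u i))) :
    PolyTime s c (fun i => encodeSet (guardOf (E i) (k i) (u i))) :=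
  have hp := PolyTime.finalPart hn hk hw hE hu
  .union hn hp.guard (.below hn (.bag hn hk hw hE hp) hu)

end Decomposition

/-! ### Lengths and powers -/

section Input
variable {I : Type*} {s : I → ℕ} {c : I → Val}

theorem encodeList_eq_nil {l : List Val} : encodeList l = .nil ↔ l = [] := by
  cases l <;> simp [encodeList]

theorem encodeList_tl (l : List Val) : (encodeList l).tl = encodeList l.tail := by
  cases l <;> rfl

/-- The length of a list is computable in unary. -/
theorem PolyNat.length {n : I → ℕ} {f : ∀ i, Fin (n i) → Val} (hn : PolyBound s n)
    (hf : PolyTime s c (fun i => encodeFamily (f i))) : PolyNat s c n := by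
  -- The counter for `a` further rounds is the list of the last `a` entries, padded by `nil`.
  refine ⟨(PolyTime.foldrList (σ := fun _ => ℕ) (enc := fun _ => encodeNat)
    (f := fun i (_ : Fin (n i)) a => a + 1) (init := fun _ => 0)
    (fun i a => encodeList ((List.replicate a Val.nil ++ List.ofFn (f i)).drop (n i))) hn
    (fun i => encodeList_eq_nil.2 (by simp)) (fun i a => ?_) (fun i a => ?_)
    (hf.congr fun i => by rw [List.drop_left' (by simp)]; rfl) .nil
    (PolyTime.top₂ _ _).succ).congr fun i => ?_, hn⟩
  · rw [Ne, encodeList_eq_nil, List.drop_eq_nil_iff]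
    simp
  · rw [encodeList_tl, List.tail_drop, List.replicate_succ, List.cons_append, List.drop_succ_cons]
  · rw [foldr_const]
    simp

theorem PolyNat.pow {a b : I → ℕ} (ha : PolyNat s c a) (hb : PolyNat s c b) (hpos : ∀ i, 0 < a i)
    (h : PolyBound s (fun i => a i ^ b i)) : PolyNat s c (fun i => a i ^ b i) := by
  classical
  -- The loop carries the exponent, to keep the powers bounded.
  have := PolyTime.iterate (σ := fun i => {r : ℕ // r ≤ b i})
    (enc := fun i r => .cons (encodeNat r) (encodeNat (a i ^ (r : ℕ))))
    (f := fun i r => ⟨min (r + 1) (b i), min_le_right _ _⟩) (init := fun i => ⟨0, Nat.zero_le _⟩)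
    hb (.cons .nil (PolyNat.const 1).1) ?_
  · refine ⟨this.tl.congr fun i => ?_, h⟩
    have hit : ∀ m ≤ b i, ((fun r : {r : ℕ // r ≤ b i} =>
        (⟨min (r + 1) (b i), min_le_right _ _⟩ : {r : ℕ // r ≤ b i}))^[m]
          ⟨0, Nat.zero_le _⟩ : ℕ) = m := by
      intro m hm
      induction m with
      | zero => rfl
      | succ m ih =>
        rw [Function.iterate_succ_apply']
        simp only [ih (by omega)]
        omega
    simp only [Val.tl_cons]
    rw [hit _ le_rfl]
  · have hr : PolyNat (fun j : Σ i, {r : ℕ // r ≤ b i} => s j.1)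
        (fun j => .cons (.cons (encodeNat j.2) (encodeNat (a j.1 ^ (j.2 : ℕ)))) (c j.1))
        (fun j => (j.2 : ℕ)) := ⟨(PolyTime.top _).hd, (hb.2.comp _).mono fun j => j.2.2⟩
    have hp : PolyNat (fun j : Σ i, {r : ℕ // r ≤ b i} => s j.1)
        (fun j => .cons (.cons (encodeNat j.2) (encodeNat (a j.1 ^ (j.2 : ℕ)))) (c j.1))
        (fun j => a j.1 ^ (j.2 : ℕ)) := ⟨(PolyTime.top _).tl, (h.comp _).mono fun j =>
          Nat.pow_le_pow_right (hpos _) j.2.2⟩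
    refine (PolyTime.ite (.lt hr hb.wk) (.cons hr.1.succ (hp.mul ha.wk).1)
      (.cons hr.1 hp.1)).congr fun j => ?_
    split_ifs with hj
    · simp only [min_eq_left (Nat.succ_le_of_lt hj), pow_succ]
    · simp only [show min ((j.2 : ℕ) + 1) (b j.1) = j.2 by have := j.2.2; omega]

end Input

/-! ### The algorithm on an instance -/

/-- An instance of the problem: a digraph with at least one vertex, given by its adjacency matrix,
and a parameter. -/
structure Instance where
  n : ℕ
  pos : 0 < n
  M : Fin n → Fin n → ℕ
  k : ℕ

namespace Instance

/-- The measure of an instance in which the running time is polynomial; the second summand is the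
number of candidates among which each separator is searched. -/
def size (i : Instance) : ℕ := i.n + (i.k + 4) ^ (3 * i.k)

/-- The input tree. -/
def input (i : Instance) : Val := encodeInstance i.M i.k

/-- Some part of the vertex set comes without a balanced separator. -/
def Fails (i : Instance) : Prop :=
  ∃ u, ¬ (finalPart (support i.M).Adj i.k u).Good (support i.M).Adj i.k

open Classical in
/-- The tree that the algorithm puts out. -/
noncomputable def output (i : Instance) : Val :=
  if h : i.Fails then statesHaven else
    (parentData i.pos (support i.M) fun u => not_not.1 (not_exists.1 h u)).decomposition.encode

theorem polyTime_output : PolyTime size input output := by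
  classical
  have hn : PolyNat size input n :=
    .length (f := fun i u => encodeFamily fun v => encodeNat (i.M u v))
      (PolyBound.self.mono fun i => Nat.le_add_right _ _) PolyTime.id.tl
  have hw : PolyBound size fun i => (i.k + 4) ^ (3 * i.k) :=
    PolyBound.self.mono fun i => Nat.le_add_left _ _
  have hk : PolyNat size input k := ⟨PolyTime.id.hd, hw.mono fun i =>
    i.k.lt_two_pow_self.le.trans ((Nat.pow_le_pow_left (by omega) _).trans
      (Nat.pow_le_pow_right (by omega) (by omega)))⟩
  have hw : PolyNat size input fun i => (i.k + 4) ^ (3 * i.k) :=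
    .pow (hk.add (.const 4)) ((PolyNat.const 3).mul hk) (fun i => by omega) hw
  have hM : PolyTime size input fun i => encodeMatrix i.M := PolyTime.id.tl
  have hE : PolyTime size input fun i => encodeRel (support i.M).Adj :=
    .rel hn ((PolyTime.matrixApply (hn.2.comp _) hM.lift₂ (.top₂ _ _) (.top _)).pos.bit_congr
      fun j => Nat.pos_iff_ne_zero)
  have hF : PolyTime size input fun i => encodeBit i.Fails :=
    .exists hn (PolyTime.good hn.wk hk.wk hw.wk hE.wk
      (.finalPart hn.wk hk.wk hw.wk hE.wk (.top _))).not
  have hR : PolyTime size input fun i => encodeFamily fun r => encodeFamily fun t =>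
      if r ∈ parentOf (support i.M).Adj i.k t then
        .cons .nil (encodeSet (guardOf (support i.M).Adj i.k t)) else .nil :=
    .matrixOf hn (.ite (.mem (hn.2.comp _)
      (.parentOf hn.lift₂ hk.lift₂ hw.lift₂ hE.lift₂ (.top _)) (.top₂ _ _))
      (.cons .nil (.guardOf hn.lift₂ hk.lift₂ hw.lift₂ hE.lift₂ (.top _))) .nil)
  have hB : PolyTime size input fun i => encodeFamily fun r : Fin i.n => encodeSet {r} :=
    .family hn (.singleton hn.wk (.top _))
  refine (PolyTime.ite hF .nil (.cons hR hB)).congr fun i => ?_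
  rw [output]
  split_ifs with h
  · rfl
  · rw [ArborealDecomposition.encode]
    congr! 6

theorem output_correct (i : Instance) :
    (i.output = statesHaven ∧ HasHaven (support i.M) i.k) ∨
      ∃ (m : ℕ) (A : ArborealDecomposition (support i.M) (Fin m)),
        i.output = A.encode ∧ A.width ≤ 3 * (i.k : ℤ) - 2 := by
  rw [output]
  split_ifs with h
  · obtain ⟨u, hu⟩ := h
    exact .inl ⟨rfl, hasHaven_of_not_good i.pos _ hu⟩
  · have hgood := fun u => not_not.1 (not_exists.1 h u)
    refine .inr ⟨i.n, _, rfl, (ParentData.width_le _ (exists_node_bound hgood)).trans ?_⟩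
    -- A good part has a separator of fewer than `k` vertices.
    have := (hgood ⟨0, i.pos⟩).1
    omega

end Instance

/-- The exponent of `2` in the running time. -/
theorem isBigO_logb (e : ℕ) :
    (fun k : ℕ => e * Real.logb 2 ((k + 4) ^ (3 * k) + 3)) =O[Filter.atTop]
      fun k : ℕ => (k : ℝ) * Real.log k := by
  refine .of_bound (e * (8 / Real.log 2)) (Filter.eventually_atTop.2 ⟨4, fun k hk => ?_⟩)
  have hk : (4 : ℝ) ≤ k := by exact_mod_cast hk
  have hlog : 0 < Real.log k := Real.log_pos (by linarith)
  have h2 : 0 < Real.log 2 := Real.log_pos (by norm_num)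
  have h1 : (1 : ℝ) ≤ (k + 4) ^ (3 * k) := one_le_pow₀ (by linarith)
  have hle : ((k : ℝ) + 4) ^ (3 * k) + 3 ≤ k ^ (8 * k) := by
    calc ((k : ℝ) + 4) ^ (3 * k) + 3 ≤ (k + 4) ^ (3 * k) * (k + 4) := by nlinarith
      _ = (k + 4) ^ (3 * k + 1) := (pow_succ _ _).symm
      _ ≤ (k ^ 2) ^ (3 * k + 1) := by gcongr; nlinarith
      _ = k ^ (2 * (3 * k + 1)) := (pow_mul _ _ _).symm
      _ ≤ k ^ (8 * k) := by
        have : 4 ≤ k := by exact_mod_cast hk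
        exact pow_le_pow_right₀ (by linarith) (by omega)
  have hlb : 0 ≤ Real.logb 2 ((k + 4) ^ (3 * k) + 3) :=
    Real.logb_nonneg (by norm_num) (by linarith)
  have h : Real.logb 2 ((k + 4) ^ (3 * k) + 3) ≤ 8 / Real.log 2 * (k * Real.log k) := by
    rw [Real.logb, div_mul_eq_mul_div]
    gcongr
    calc Real.log ((k + 4) ^ (3 * k) + 3) ≤ Real.log (k ^ (8 * k)) :=
          Real.log_le_log (by linarith) hle
      _ = 8 * (k * Real.log k) := by rw [Real.log_pow]; push_cast; ring
  rw [Real.norm_of_nonneg (by positivity), Real.norm_of_nonneg (by positivity), mul_assoc]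
  gcongr

end Arboreal

theorem mainTheorem2 :
    ∃ (p : Prog) (f : ℕ → ℝ) (d : ℕ),
      f =O[Filter.atTop] (fun k : ℕ => (k : ℝ) * Real.log k) ∧
      ∀ (n : ℕ) (M : Fin n → Fin n → ℕ) (k : ℕ), 0 < n →
        ∃ (t : ℕ) (out : Val),
          Computes p (encodeInstance M k) t out ∧
          (t : ℝ) ≤ 2 ^ f k * (n : ℝ) ^ d ∧
          ((out = statesHaven ∧ HasHaven (support M) k) ∨
            ∃ (m : ℕ) (A : ArborealDecomposition (support M) (Fin m)),
              out = A.encode ∧ A.width ≤ 3 * (k : ℤ) - 2) := by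
  obtain ⟨p, T, ⟨e, hT⟩, hp⟩ := Instance.polyTime_output
  refine ⟨p, _, e, isBigO_logb e, fun n M k hn => ?_⟩
  obtain ⟨t, σ, hr, ht, h0, -⟩ := hp ⟨n, hn, M, k⟩
    (Function.update (fun _ => .nil) 0 (encodeInstance M k)) (by simp [Instance.input])
  refine ⟨t, _, ⟨σ, hr, h0⟩, ?_, Instance.output_correct _⟩
  have hpos : (0 : ℝ) < ((k : ℝ) + 4) ^ (3 * k) + 3 := by positivity
  have hn' : (1 : ℝ) ≤ n := by exact_mod_cast hn
  have h1 : (1 : ℝ) ≤ (k + 4) ^ (3 * k) := one_le_pow₀ (by linarith [k.cast_nonneg (α := ℝ)])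
  calc (t : ℝ) ≤ ((n : ℝ) + (k + 4) ^ (3 * k) + 2) ^ e := by
        exact_mod_cast ht.trans (hT ⟨n, hn, M, k⟩)
    _ ≤ (((k + 4) ^ (3 * k) + 3) * n) ^ e := by
        gcongr
        nlinarith
    _ = 2 ^ (e * Real.logb 2 ((k + 4) ^ (3 * k) + 3)) * (n : ℝ) ^ e := by
        rw [mul_pow, mul_comm (e : ℝ), Real.rpow_mul_natCast (by norm_num),
          Real.rpow_logb (by norm_num) (by norm_num) hpos]
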